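/- Let $(Y,y)$ be a normal germ of complex analytic space of dimension $3$ with (at most) an isolated singularity, that is, the local rings $\mathcal{O}_{Y,p}$ at all points $p\neq y$ of $Y$ sufficiently close to $y$ are regular. Let $f\in\mathcal{O}_{Y,y}$ be a nonzero germ of holomorphic function with $f(y)=0$, and endow its zero-locus $(f^{-1}(0),y)$ with the analytic structure defined by the ideal $(f)$, so that its local ring is $\mathcal{O}_{Y,y}/(f)$. Assume that the germ of complex analytic space $(f^{-1}(0),y)$ also has (at most) an isolated singularity. Then $(f^{-1}(0),y)$ is normal if and only if $(Y,y)$ is Cohen--Macaulay. Here a germ $(X,x)$ is called normal if its local ring $\mathcal{O}_{X,x}$ is reduced and integrally closed in its total ring of fractions, and Cohen--Macaulay if the maximal ideal of $\mathcal{O}_{X,x}$ contains a regular sequence of length $\dim \mathcal{O}_{X,x}$. -/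

import Mathlib

open Filter Topology

/-- The ring `𝒪_{ℂⁿ,p}` of germs at `p` of holomorphic functions on `ℂⁿ`. -/
def holomorphicGerms (n : ℕ) (p : Fin n → ℂ) : Subring (Germ (𝓝 p) ℂ) where
  carrier := {φ | ∃ g : (Fin n → ℂ) → ℂ, AnalyticAt ℂ g p ∧ (g : Germ (𝓝 p) ℂ) = φ}
  mul_mem' := by
    rintro _ _ ⟨g, hg, rfl⟩ ⟨h, hh, rfl⟩
    exact ⟨g * h, hg.mul hh, rfl⟩
  one_mem' := ⟨1, analyticAt_const, rfl⟩
  add_mem' := by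
    rintro _ _ ⟨g, hg, rfl⟩ ⟨h, hh, rfl⟩
    exact ⟨g + h, hg.add hh, rfl⟩
  zero_mem' := ⟨0, analyticAt_const, rfl⟩
  neg_mem' := by
    rintro _ ⟨g, hg, rfl⟩
    exact ⟨-g, hg.neg, rfl⟩

/-- The germ at `p` of a function that is holomorphic at `p`. -/
noncomputable def holomorphicGerms.mk {n : ℕ} {p : Fin n → ℂ} (g : (Fin n → ℂ) → ℂ) (hg : AnalyticAt ℂ g p) :
    holomorphicGerms n p :=
  ⟨(g : Germ (𝓝 p) ℂ), g, hg, rfl⟩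

/-- A germ of complex analytic space (possibly non-reduced), given by a local model: the closed
analytic subspace of `(ℂⁿ, 0)` defined by finitely many functions that are holomorphic near `0`
and vanish at `0`. Its base point is `0`. -/
structure ComplexSpaceGerm where
  /-- the dimension of the ambient space -/
  n : ℕ
  /-- the number of equations -/
  k : ℕ
  /-- the equations -/
  eqn : Fin k → (Fin n → ℂ) → ℂ
  analyticAt : ∀ i, AnalyticAt ℂ (eqn i) 0
  eqn_zero : ∀ i, eqn i 0 = 0

namespace ComplexSpaceGerm

/-- The ideal of `𝒪_{ℂⁿ,p}` generated by the germs at `p` of the equations. (All the equations are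
holomorphic at `p` when `p` is close to the base point.) -/
noncomputable def idealAt (X : ComplexSpaceGerm) (p : Fin X.n → ℂ) : Ideal (holomorphicGerms X.n p) :=
  Ideal.span {φ | ∃ (i : Fin X.k) (h : AnalyticAt ℂ (X.eqn i) p),
    φ = holomorphicGerms.mk (X.eqn i) h}

/-- The stalk at `p` of the structure sheaf of (a representative of) the germ, for `p` close to the
base point: `𝒪_{X,p} = 𝒪_{ℂⁿ,p} / I_p`. -/
abbrev stalk (X : ComplexSpaceGerm) (p : Fin X.n → ℂ) : Type :=
  holomorphicGerms X.n p ⧸ X.idealAt p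

/-- The local ring `𝒪_{X,x}` of the germ `(X,x)`: the stalk at the base point. -/
abbrev localRing (X : ComplexSpaceGerm) : Type := X.stalk 0

/-- The class in `𝒪_{X,x}` of a function on the ambient space that is holomorphic at the base
point. -/
noncomputable def toLocalRing (X : ComplexSpaceGerm) (F : (Fin X.n → ℂ) → ℂ) (hF : AnalyticAt ℂ F 0) :
    X.localRing :=
  Ideal.Quotient.mk (X.idealAt 0) (holomorphicGerms.mk F hF)

/-- The germ has (at most) an isolated singularity: every point of a representative that is close
to the base point and distinct from it is a smooth point, i.e. has a regular local ring. -/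
def HasIsolatedSingularity (X : ComplexSpaceGerm) : Prop :=
  ∀ᶠ p in 𝓝[≠] (0 : Fin X.n → ℂ), (∀ i, X.eqn i p = 0) → IsRegularLocalRing (X.stalk p)

/-- The germ is normal: its local ring is reduced and integrally closed in its total ring of
fractions (`IsIntegrallyClosed R` refers to the localization of `R` at all its non-zero-divisors). -/
def IsNormal (X : ComplexSpaceGerm) : Prop :=
  IsReduced X.localRing ∧ IsIntegrallyClosed X.localRing

/-- The zero-locus `(f⁻¹(0), x)` with its analytic structure `𝒪_{X,x} / (f)`, where `f` is the
function on `X` induced by `F`: the equation `F` is added to those of `X`. -/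
noncomputable def zeroLocus (X : ComplexSpaceGerm) (F : (Fin X.n → ℂ) → ℂ) (hF : AnalyticAt ℂ F 0)
    (hF0 : F 0 = 0) : ComplexSpaceGerm where
  n := X.n
  k := X.k + 1
  eqn := Fin.cons F X.eqn
  analyticAt := Fin.cases hF X.analyticAt
  eqn_zero := Fin.cases hF0 X.eqn_zero

end ComplexSpaceGerm

theorem holomorphicGerms.isUnit_mk {n : ℕ} {p : Fin n → ℂ} (g : (Fin n → ℂ) → ℂ)
    (hg : AnalyticAt ℂ g p) (h0 : g p ≠ 0) : IsUnit (holomorphicGerms.mk g hg) := by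
  refine IsUnit.of_mul_eq_one (holomorphicGerms.mk g⁻¹ (hg.inv h0)) (Subtype.ext ?_)
  refine Germ.coe_eq.2 ?_
  filter_upwards [hg.continuousAt.eventually_ne h0] with q hq
  simp [hq]

instance holomorphicGerms.isLocalRing (n : ℕ) (p : Fin n → ℂ) :
    IsLocalRing (holomorphicGerms n p) := by
  refine IsLocalRing.of_isUnit_or_isUnit_one_sub_self ?_
  rintro ⟨_, g, hg, rfl⟩
  by_cases h0 : g p = 0
  · exact Or.inr (holomorphicGerms.isUnit_mk (1 - g) (analyticAt_const.sub hg) (by simp [h0]))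
  · exact Or.inl (holomorphicGerms.isUnit_mk g hg h0)

theorem ComplexSpaceGerm.idealAt_ne_top (X : ComplexSpaceGerm) : X.idealAt 0 ≠ ⊤ := by
  have key : ∀ φ ∈ X.idealAt 0, (φ : Germ (𝓝 (0 : Fin X.n → ℂ)) ℂ).value = 0 := by
    intro φ hφ
    induction hφ using Submodule.span_induction with
    | mem x hx =>
      obtain ⟨i, h, rfl⟩ := hx
      exact X.eqn_zero i
    | zero => rfl
    | add x y _ _ hx hy =>
      exact (map_add Germ.valueRingHom x.1 y.1).trans (by
        change x.1.value + y.1.value = 0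
        rw [hx, hy, add_zero])
    | smul a x _ hx =>
      exact (map_mul Germ.valueRingHom a.1 x.1).trans (by
        change a.1.value * x.1.value = 0
        rw [hx, mul_zero])
  intro h
  exact one_ne_zero (α := ℂ) (key 1 (h ▸ Submodule.mem_top))

instance ComplexSpaceGerm.isLocalRing_localRing (X : ComplexSpaceGerm) :
    IsLocalRing X.localRing :=
  haveI : Nontrivial X.localRing := Ideal.Quotient.nontrivial_iff.2 X.idealAt_ne_top
  IsLocalRing.of_surjective' (Ideal.Quotient.mk (X.idealAt 0)) Ideal.Quotient.mk_surjective

/-- A (Noetherian) local ring is Cohen–Macaulay if its maximal ideal contains a regular sequence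
whose length is the dimension of the ring. -/
def IsCohenMacaulayLocalRing (R : Type*) [CommRing R] [IsLocalRing R] : Prop :=
  ∃ rs : List R, (∀ r ∈ rs, r ∈ IsLocalRing.maximalIdeal R) ∧
    RingTheory.Sequence.IsRegular R rs ∧ (rs.length : WithBot ℕ∞) = ringKrullDim R

/-- The germ is Cohen–Macaulay: its local ring is. -/
def ComplexSpaceGerm.IsCohenMacaulay (X : ComplexSpaceGerm) : Prop :=
  IsCohenMacaulayLocalRing X.localRing

/-! Since `Y` is normal, its local ring is a domain, so the nonzero germ of `F` is a nonzerodivisor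
and the zero locus `Z` has dimension two. If `Z` is normal it has depth two
(`exists_regularMod_of_isNormal`), and putting `F` in front of a regular sequence on `Z` gives one
of length three on `Y`. Conversely, if `Y` is Cohen–Macaulay, its regular sequence of length three
can be exchanged for one starting with `F` (`exchange_two`). So `Z` has depth two and an isolated
singularity, and it is normal by an analytic form of Serre's criterion (`isNormal_of_depth`).

The difficulty in that criterion is that regularity is given for the stalks at nearby points, not
for localizations of the local ring at the origin. Regular local rings are normal domains, so what
has to be transferred is ideal membership: for a nonzerodivisor `b` on a surface germ of depth two
with ideal `I`, a germ lies in `J = I + (b)` as soon as it does at all nearby points of the germ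
other than the origin. This is deduced from `mk_mem_span_of_eventually`.

That lemma works as follows. Choose `s` in the maximal ideal, regular modulo `J`, such that `J +
(s)` contains a power of the maximal ideal. By Weierstrass division `𝒪_n / J` is finite over `𝒪_1`
through `s`; being torsion-free over a principal ideal domain, it is free. The coordinates of
convergent series in a basis converge on a fixed disc. For `z ≠ 0` in that disc, the series whose
coordinates vanish at `z` form an ideal of finite codimension. The points where it vanishes satisfy
`s p = z`, so they differ from the origin, and Krull's intersection theorem reduces membership in it
to congruences of all orders at such points, which the local hypothesis supplies. Hence the
coordinates of the given germ vanish off the origin, so identically, and the germ lies in `J`.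

The analytic input is a Weierstrass division with uniform radii, proved with weighted `ℓ¹`-norms; it
also yields that `𝒪_n` is Noetherian. -/

namespace MvPowerSeries

/-! ### Weighted norms and evaluation of power series -/

open scoped ENNReal NNReal

variable {n : ℕ}

/-- The weighted `ℓ¹`-norm of a power series on the polydisc of radius `ρ`. -/
noncomputable def nrm (ρ : ℝ≥0) (φ : MvPowerSeries (Fin n) ℂ) : ℝ≥0∞ :=
  ∑' α, ‖coeff α φ‖ₑ * (ρ : ℝ≥0∞) ^ α.degree

/-- The value at `x` of the sum of a power series. -/
noncomputable def ev (x : Fin n → ℂ) (φ : MvPowerSeries (Fin n) ℂ) : ℂ :=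
  ∑' α, coeff α φ * ∏ i, x i ^ α i

variable {ρ : ℝ≥0} {φ ψ : MvPowerSeries (Fin n) ℂ} {x : Fin n → ℂ}

theorem nrm_add_le : nrm ρ (φ + ψ) ≤ nrm ρ φ + nrm ρ ψ := by
  unfold nrm
  rw [← ENNReal.tsum_add]
  refine ENNReal.tsum_le_tsum fun α => ?_
  rw [← add_mul, map_add]
  gcongr
  exact enorm_add_le _ _

theorem nrm_zero : nrm ρ (0 : MvPowerSeries (Fin n) ℂ) = 0 := by simp [nrm]

theorem nrm_mono {ρ' : ℝ≥0} (h : ρ' ≤ ρ) : nrm ρ' φ ≤ nrm ρ φ := by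
  unfold nrm
  gcongr

theorem nrm_sum_le {ι : Type*} (s : Finset ι) (f : ι → MvPowerSeries (Fin n) ℂ) :
    nrm ρ (∑ i ∈ s, f i) ≤ ∑ i ∈ s, nrm ρ (f i) :=
  Finset.le_sum_of_subadditive _ nrm_zero.le (fun _ _ => nrm_add_le) _ _

theorem nrm_monomial (α : Fin n →₀ ℕ) (c : ℂ) :
    nrm ρ (monomial α c) = ‖c‖ₑ * (ρ : ℝ≥0∞) ^ α.degree := by
  classical
  unfold nrm
  rw [tsum_eq_single α]
  · simp
  · intro β hβ
    simp [coeff_monomial, hβ]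

theorem nrm_C (c : ℂ) : nrm ρ (C c : MvPowerSeries (Fin n) ℂ) = ‖c‖ₑ := by
  rw [← monomial_zero_eq_C_apply, nrm_monomial]; simp

theorem nrm_X (i : Fin n) : nrm ρ (X i : MvPowerSeries (Fin n) ℂ) = ρ := by
  rw [X, nrm_monomial]; simp

theorem nrm_one : nrm ρ (1 : MvPowerSeries (Fin n) ℂ) = 1 := by
  rw [← map_one (C (σ := Fin n) (R := ℂ)), nrm_C]; simp

theorem nrm_mul_le : nrm ρ (φ * ψ) ≤ nrm ρ φ * nrm ρ ψ := by
  classical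
  unfold nrm
  calc ∑' α, ‖coeff α (φ * ψ)‖ₑ * (ρ : ℝ≥0∞) ^ α.degree
      ≤ ∑' α : Fin n →₀ ℕ, ∑' p : Finset.HasAntidiagonal.antidiagonal α,
        (‖coeff p.1.1 φ‖ₑ * (ρ : ℝ≥0∞) ^ p.1.1.degree) *
          (‖coeff p.1.2 ψ‖ₑ * (ρ : ℝ≥0∞) ^ p.1.2.degree) := by
        refine ENNReal.tsum_le_tsum fun α => ?_
        rw [Finset.tsum_subtype (Finset.HasAntidiagonal.antidiagonal α) (fun p : (Fin n →₀ ℕ) × (Fin n →₀ ℕ) =>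
          (‖coeff p.1 φ‖ₑ * (ρ : ℝ≥0∞) ^ p.1.degree) *
          (‖coeff p.2 ψ‖ₑ * (ρ : ℝ≥0∞) ^ p.2.degree)), coeff_mul]
        refine (mul_le_mul_left (enorm_sum_le _ _) _).trans ?_
        rw [Finset.sum_mul]
        refine Finset.sum_le_sum fun p hp => le_of_eq ?_
        rw [← Finset.HasAntidiagonal.mem_antidiagonal.1 hp, map_add, pow_add, enorm_mul]
        ring
    _ = ∑' p : (Fin n →₀ ℕ) × (Fin n →₀ ℕ), (‖coeff p.1 φ‖ₑ * (ρ : ℝ≥0∞) ^ p.1.degree) *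
          (‖coeff p.2 ψ‖ₑ * (ρ : ℝ≥0∞) ^ p.2.degree) := by
        rw [← ENNReal.tsum_sigma
          (f := fun α (p : Finset.HasAntidiagonal.antidiagonal α) => (‖coeff p.1.1 φ‖ₑ * (ρ : ℝ≥0∞) ^ p.1.1.degree) *
          (‖coeff p.1.2 ψ‖ₑ * (ρ : ℝ≥0∞) ^ p.1.2.degree)),
          ← Finset.HasAntidiagonal.sigmaAntidiagonalEquivProd.tsum_eq]
        rfl
    _ = _ := by
        rw [ENNReal.tsum_prod (f := fun a b => (‖coeff a φ‖ₑ * (ρ : ℝ≥0∞) ^ a.degree) *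
          (‖coeff b ψ‖ₑ * (ρ : ℝ≥0∞) ^ b.degree))]
        simp_rw [ENNReal.tsum_mul_left, ENNReal.tsum_mul_right]

theorem enorm_coeff_mul_le (α : Fin n →₀ ℕ) :
    ‖coeff α φ‖ₑ * (ρ : ℝ≥0∞) ^ α.degree ≤ nrm ρ φ :=
  ENNReal.le_tsum (f := fun α => ‖coeff α φ‖ₑ * (ρ : ℝ≥0∞) ^ α.degree) α

theorem enorm_constantCoeff_le : ‖constantCoeff φ‖ₑ ≤ nrm ρ φ := by
  simpa using enorm_coeff_mul_le (φ := φ) (ρ := ρ) 0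

/-- Every monomial that occurs has positive degree, so it gains at least one factor `ρ' / ρ`. This
is what makes series without constant term small after shrinking the polydisc. -/
theorem nrm_le_div_mul_nrm {ρ' : ℝ≥0} (hρ : 0 < ρ) (h : ρ' ≤ ρ) (h0 : constantCoeff φ = 0) :
    nrm ρ' φ ≤ (ρ' / ρ : ℝ≥0) * nrm ρ φ := by
  unfold nrm
  rw [← ENNReal.tsum_mul_left]
  refine ENNReal.tsum_le_tsum fun α => ?_
  rcases eq_or_ne α 0 with rfl | hα
  · simp [h0]
  · rw [mul_left_comm]
    gcongr
    obtain ⟨k, hk⟩ : ∃ k, α.degree = k + 1 :=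
      Nat.exists_eq_succ_of_ne_zero (by simpa [Finsupp.degree_eq_zero_iff] using hα)
    rw [hk]
    norm_cast
    rw [pow_succ, pow_succ, mul_comm (ρ ^ k) ρ, ← mul_assoc, div_mul_cancel₀ _ hρ.ne', mul_comm]
    gcongr

theorem enorm_prod_pow_le (hx : ‖x‖ ≤ ρ) (α : Fin n →₀ ℕ) :
    ‖∏ i, x i ^ α i‖ₑ ≤ (ρ : ℝ≥0∞) ^ α.degree := by
  have hx' : ∀ i, ‖x i‖₊ ≤ ρ := fun i => by
    have := (norm_le_pi_norm x i).trans hx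
    exact_mod_cast this
  rw [enorm_eq_nnnorm, Finsupp.degree_eq_sum]
  norm_cast
  rw [nnnorm_prod, ← Finset.prod_pow_eq_pow_sum]
  refine Finset.prod_le_prod' fun i _ => ?_
  rw [nnnorm_pow]
  gcongr
  exact hx' i

theorem tsum_enorm_ev_le (hx : ‖x‖ ≤ ρ) :
    ∑' α, ‖coeff α φ * ∏ i, x i ^ α i‖ₑ ≤ nrm ρ φ := by
  refine ENNReal.tsum_le_tsum fun α => ?_
  rw [enorm_mul]
  gcongr
  exact enorm_prod_pow_le hx α

theorem summable_ev (hφ : nrm ρ φ ≠ ∞) (hx : ‖x‖ ≤ ρ) :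
    Summable fun α => ‖coeff α φ * ∏ i, x i ^ α i‖ :=
  tsum_enorm_ne_top_iff_summable_norm.1 (ne_top_of_le_ne_top hφ (tsum_enorm_ev_le hx))

theorem hasSum_ev (hφ : nrm ρ φ ≠ ∞) (hx : ‖x‖ ≤ ρ) :
    HasSum (fun α => coeff α φ * ∏ i, x i ^ α i) (ev x φ) :=
  (summable_ev hφ hx).of_norm.hasSum

theorem enorm_ev_le (hx : ‖x‖ ≤ ρ) : ‖ev x φ‖ₑ ≤ nrm ρ φ :=
  enorm_tsum_le_tsum_enorm.trans (tsum_enorm_ev_le hx)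

theorem ev_add (hφ : nrm ρ φ ≠ ∞) (hψ : nrm ρ ψ ≠ ∞) (hx : ‖x‖ ≤ ρ) :
    ev x (φ + ψ) = ev x φ + ev x ψ := by
  refine HasSum.tsum_eq ?_
  simpa [add_mul] using (hasSum_ev hφ hx).add (hasSum_ev hψ hx)

theorem ev_monomial (α : Fin n →₀ ℕ) (c : ℂ) : ev x (monomial α c) = c * ∏ i, x i ^ α i := by
  classical
  unfold ev
  rw [tsum_eq_single α]
  · simp
  · intro β hβ
    simp [coeff_monomial, hβ]

theorem ev_C (c : ℂ) : ev x (C c) = c := by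
  rw [← monomial_zero_eq_C_apply, ev_monomial]; simp

theorem ev_X (i : Fin n) : ev x (X i) = x i := by
  rw [X, ev_monomial, one_mul, Finset.prod_eq_single i] <;> simp +contextual

theorem ev_zero_point : ev (0 : Fin n → ℂ) φ = constantCoeff φ := by
  unfold ev
  rw [tsum_eq_single 0]
  · simp
  · intro β hβ
    obtain ⟨i, hi⟩ := Finsupp.ne_iff.1 hβ
    rw [Finset.prod_eq_zero (Finset.mem_univ i) (by simpa using hi), mul_zero]

theorem ev_mul (hφ : nrm ρ φ ≠ ∞) (hψ : nrm ρ ψ ≠ ∞) (hx : ‖x‖ ≤ ρ) :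
    ev x (φ * ψ) = ev x φ * ev x ψ := by
  classical
  unfold ev
  have h1 := summable_ev hφ hx
  have h2 := summable_ev hψ hx
  have h3 := summable_mul_of_summable_norm h1 h2
  have h4 := h1.of_norm
  have h5 := h2.of_norm
  have := h4.tsum_mul_tsum_eq_tsum_sum_antidiagonal h5 h3
  rw [this]
  refine tsum_congr fun α => ?_
  rw [coeff_mul, Finset.sum_mul]
  refine Finset.sum_congr rfl fun p hp => ?_
  rw [← Finset.HasAntidiagonal.mem_antidiagonal.1 hp]
  simp only [Finsupp.add_apply, pow_add, Finset.prod_mul_distrib]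
  ring

/-! ### Coefficientwise sums of families of power series -/

section Families

variable {ι : Type*} {f g : ι → MvPowerSeries (Fin n) ℂ} {S T : MvPowerSeries (Fin n) ℂ}

/-- Coefficientwise convergence of a family of power series to the sum `S`. -/
def CoeffHasSum (f : ι → MvPowerSeries (Fin n) ℂ) (S : MvPowerSeries (Fin n) ℂ) : Prop :=
  ∀ α, HasSum (fun i => coeff α (f i)) (coeff α S)

theorem summable_coeff_of_tsum_nrm (hρ : 0 < ρ) (hf : ∑' i, nrm ρ (f i) ≠ ∞) (α : Fin n →₀ ℕ) :
    Summable fun i => ‖coeff α (f i)‖ := by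
  rw [← tsum_enorm_ne_top_iff_summable_norm]
  have h0 : (ρ : ℝ≥0∞) ^ α.degree ≠ 0 := pow_ne_zero _ (by exact_mod_cast hρ.ne')
  have h : (∑' i, ‖coeff α (f i)‖ₑ) * (ρ : ℝ≥0∞) ^ α.degree ≠ ∞ := by
    rw [← ENNReal.tsum_mul_right]
    exact ne_top_of_le_ne_top hf (ENNReal.tsum_le_tsum fun i => enorm_coeff_mul_le α)
  exact fun h' => h (by rw [h', ENNReal.top_mul h0])

/-- Summing coefficient by coefficient avoids any topology on the ring of series;
`CoeffHasSum.nrm_le` and `CoeffHasSum.hasSum_ev` recover the norm estimate and the values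
afterwards. -/
theorem exists_coeffHasSum (hρ : 0 < ρ) (hf : ∑' i, nrm ρ (f i) ≠ ∞) : ∃ S, CoeffHasSum f S :=
  ⟨fun α => ∑' i, coeff α (f i), fun α => (summable_coeff_of_tsum_nrm hρ hf α).of_norm.hasSum⟩

namespace CoeffHasSum

theorem unique (h : CoeffHasSum f S) (h' : CoeffHasSum f T) : S = T :=
  MvPowerSeries.ext fun α => (h α).unique (h' α)

theorem mul_left (h : CoeffHasSum f S) (ψ : MvPowerSeries (Fin n) ℂ) :
    CoeffHasSum (fun i => ψ * f i) (ψ * S) := by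
  classical
  intro α
  simp only [coeff_mul]
  exact hasSum_sum fun p _ => (h p.2).mul_left _

theorem mul_right (h : CoeffHasSum f S) (ψ : MvPowerSeries (Fin n) ℂ) :
    CoeffHasSum (fun i => f i * ψ) (S * ψ) := by
  simpa only [mul_comm] using h.mul_left ψ

theorem add (h : CoeffHasSum f S) (h' : CoeffHasSum g T) :
    CoeffHasSum (fun i => f i + g i) (S + T) := fun α => by
  simpa using (h α).add (h' α)

theorem sum {κ : Type*} (s : Finset κ) {F : κ → ι → MvPowerSeries (Fin n) ℂ}
    {S : κ → MvPowerSeries (Fin n) ℂ} (h : ∀ k ∈ s, CoeffHasSum (F k) (S k)) :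
    CoeffHasSum (fun i => ∑ k ∈ s, F k i) (∑ k ∈ s, S k) := fun α => by
  simp only [map_sum]
  exact hasSum_sum fun k hk => h k hk α

theorem nrm_le (h : CoeffHasSum f S) : nrm ρ S ≤ ∑' i, nrm ρ (f i) := by
  unfold nrm
  rw [ENNReal.tsum_comm]
  refine ENNReal.tsum_le_tsum fun α => ?_
  rw [ENNReal.tsum_mul_right, ← (h α).tsum_eq]
  gcongr
  exact enorm_tsum_le_tsum_enorm

/-- Absolute summability over pairs (index, exponent) allows the two summations to be interchanged.
-/
theorem hasSum_ev (h : CoeffHasSum f S) (hf : ∑' i, nrm ρ (f i) ≠ ∞) (hx : ‖x‖ ≤ ρ) :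
    HasSum (fun i => ev x (f i)) (ev x S) := by
  have hfin : ∀ i, nrm ρ (f i) ≠ ∞ := fun i => ne_top_of_le_ne_top hf (ENNReal.le_tsum i)
  have hs : Summable fun p : ι × (Fin n →₀ ℕ) => coeff p.2 (f p.1) * ∏ i, x i ^ p.2 i := by
    refine Summable.of_norm (tsum_enorm_ne_top_iff_summable_norm.1 ?_)
    rw [ENNReal.tsum_prod (f := fun i α => ‖coeff α (f i) * ∏ j, x j ^ α j‖ₑ)]
    exact ne_top_of_le_ne_top hf (ENNReal.tsum_le_tsum fun i => tsum_enorm_ev_le hx)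
  have h1 : HasSum (fun i => ev x (f i))
      (∑' p : ι × (Fin n →₀ ℕ), coeff p.2 (f p.1) * ∏ i, x i ^ p.2 i) :=
    hs.hasSum.prod_fiberwise fun i => MvPowerSeries.hasSum_ev (hfin i) hx
  have h2 : ∑' p : ι × (Fin n →₀ ℕ), coeff p.2 (f p.1) * ∏ i, x i ^ p.2 i = ev x S := by
    have h3 := hs.prod_symm
    have h4 := h3.tsum_prod
    rw [ev, ← (Equiv.prodComm ι (Fin n →₀ ℕ)).symm.tsum_eq]
    refine h4.trans (tsum_congr fun α => ?_)
    exact ((h α).mul_right (∏ i, x i ^ α i)).tsum_eq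
  rwa [← h2]

end CoeffHasSum

theorem coeffHasSum_monomials (φ : MvPowerSeries (Fin n) ℂ) :
    CoeffHasSum (fun α => monomial α (coeff α φ)) φ := by
  classical
  intro α
  convert hasSum_ite_eq α (coeff α φ) using 2 with β
  rw [coeff_monomial]
  split_ifs <;> simp_all

end Families

/-- The power series that converge absolutely on the closed polydisc of radius `ρ`. -/
noncomputable def conv (n : ℕ) (ρ : ℝ≥0) : Subalgebra ℂ (MvPowerSeries (Fin n) ℂ) where
  carrier := {φ | nrm ρ φ ≠ ∞}
  mul_mem' ha hb := ne_top_of_le_ne_top (ENNReal.mul_ne_top ha hb) nrm_mul_le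
  add_mem' ha hb := ne_top_of_le_ne_top (ENNReal.add_ne_top.2 ⟨ha, hb⟩) nrm_add_le
  algebraMap_mem' c := by
    change nrm ρ (C c) ≠ ∞
    rw [nrm_C]
    exact enorm_ne_top

theorem mem_conv : φ ∈ conv n ρ ↔ nrm ρ φ ≠ ∞ := Iff.rfl

theorem conv_mono {ρ' : ℝ≥0} (h : ρ' ≤ ρ) : conv n ρ ≤ conv n ρ' := fun _ hφ =>
  ne_top_of_le_ne_top hφ (nrm_mono h)

theorem X_mem_conv (i : Fin n) : X i ∈ conv n ρ := by
  rw [mem_conv, nrm_X]; exact ENNReal.coe_ne_top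

theorem C_mem_conv (c : ℂ) : C c ∈ conv n ρ := (conv n ρ).algebraMap_mem c

/-- Evaluation at a point of the closed polydisc of radius `ρ`. -/
noncomputable def evHom (x : Fin n → ℂ) (hx : ‖x‖ ≤ ρ) : conv n ρ →ₐ[ℂ] ℂ where
  toFun φ := ev x φ.1
  map_one' := by
    change ev x (1 : MvPowerSeries (Fin n) ℂ) = 1
    rw [← map_one (C (σ := Fin n) (R := ℂ)), ev_C]
  map_mul' φ ψ := ev_mul φ.2 ψ.2 hx
  map_zero' := by
    change ev x (0 : MvPowerSeries (Fin n) ℂ) = 0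
    rw [← map_zero (C (σ := Fin n) (R := ℂ)), ev_C]
  map_add' φ ψ := ev_add φ.2 ψ.2 hx
  commutes' c := ev_C c

/-! ### Hadamard's lemma with estimates -/

theorem monomial_single_add (i : Fin n) (α : Fin n →₀ ℕ) (c : ℂ) :
    monomial (Finsupp.single i 1 + α) c = X i * monomial α c := by
  rw [X, monomial_mul_monomial, one_mul]

/-- **Hadamard's lemma** for a monomial, with estimates. -/
theorem exists_monomial_eq {p : Fin n → ℂ} {r : ℝ≥0} (hp : ‖p‖ ≤ r) (hr : r < ρ)
    (α : Fin n →₀ ℕ) :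
    ∃ q : Fin n → MvPowerSeries (Fin n) ℂ,
      (∀ i, nrm ρ (q i) ≤ ((ρ - r)⁻¹ : ℝ≥0) * (ρ : ℝ≥0∞) ^ α.degree) ∧
      monomial α 1 = C (∏ i, p i ^ α i) + ∑ i, (X i - C (p i)) * q i := by
  classical
  induction hk : α.degree generalizing α with
  | zero =>
    rw [Finsupp.degree_eq_zero_iff] at hk
    subst hk
    exact ⟨fun _ => 0, fun i => by simp [nrm_zero], by simp [monomial_zero_eq_C_apply]⟩
  | succ k ih =>
    have hα : α ≠ 0 := by
      rintro rfl
      simp at hk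
    obtain ⟨j, hj⟩ := Finsupp.ne_iff.1 hα
    have hle : Finsupp.single j 1 ≤ α := by
      rw [Finsupp.single_le_iff]
      exact Nat.one_le_iff_ne_zero.2 hj
    obtain ⟨β, rfl⟩ := exists_add_of_le hle
    have hβ : β.degree = k := by
      rw [map_add, Finsupp.degree_single] at hk
      omega
    obtain ⟨q, hq, he⟩ := ih β hβ
    -- The quotients come from `x_j x^β - p_j p^β = (x_j - p_j) x^β + p_j (x^β - p^β)`. The bound
    -- reproduces itself because `ρ^k + r ρ^k / (ρ - r) = ρ^(k+1) / (ρ - r)`.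
    refine ⟨fun i => (if i = j then monomial β 1 else 0) + C (p j) * q i, fun i => ?_, ?_⟩
    · have h1 : nrm ρ (if i = j then monomial β (1 : ℂ) else 0) ≤ (ρ : ℝ≥0∞) ^ k := by
        split_ifs
        · rw [nrm_monomial, hβ]; simp
        · rw [nrm_zero]; exact zero_le
      have h2 : nrm ρ (C (p j) * q i) ≤ r * (((ρ - r)⁻¹ : ℝ≥0) * (ρ : ℝ≥0∞) ^ k) := by
        refine nrm_mul_le.trans ?_
        rw [nrm_C]
        gcongr
        · rw [enorm_eq_nnnorm]
          have : ‖p j‖ ≤ r := (norm_le_pi_norm p j).trans hp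
          exact_mod_cast this
        · exact hq i
      refine (nrm_add_le.trans (add_le_add h1 h2)).trans (le_of_eq ?_)
      norm_cast
      have h3 : (ρ - r : ℝ≥0) ≠ 0 := (tsub_pos_of_lt hr).ne'
      have h4 : (ρ - r) + r = ρ := tsub_add_cancel_of_le hr.le
      generalize ρ - r = s at h3 h4
      subst h4
      field_simp
      ring
    · have h5 : ∏ i, p i ^ ((Finsupp.single j 1 + β : Fin n →₀ ℕ) i) = p j * ∏ i, p i ^ β i := by
        simp only [Finsupp.add_apply, pow_add, Finset.prod_mul_distrib]
        congr 1
        rw [Finset.prod_eq_single j] <;> simp +contextual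
      rw [monomial_single_add, h5, map_mul]
      simp only [mul_add, Finset.sum_add_distrib, mul_ite, mul_zero, Finset.sum_ite_eq',
        Finset.mem_univ, if_true]
      have h6 : ∑ i, (X i - C (p i)) * (C (p j) * q i) = C (p j) * ∑ i, (X i - C (p i)) * q i := by
        rw [Finset.mul_sum]
        exact Finset.sum_congr rfl fun i _ => by ring
      rw [h6]
      have h7 : ∑ i, (X i - C (p i)) * q i = monomial β 1 - C (∏ i, p i ^ β i) := by
        rw [he]; ring
      rw [h7]
      ring

/-- **Hadamard's lemma** at a point `p` of the polydisc, with estimates. -/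
theorem exists_eq_C_add_sum {r : ℝ≥0} (hr : r < ρ) :
    ∃ K : ℝ≥0, ∀ p : Fin n → ℂ, ‖p‖ ≤ r → ∀ φ ∈ conv n ρ, ∃ q : Fin n → MvPowerSeries (Fin n) ℂ,
      (∀ i, nrm ρ (q i) ≤ K * nrm ρ φ) ∧ φ = C (ev p φ) + ∑ i, (X i - C (p i)) * q i := by
  have hρ : 0 < ρ := zero_le.trans_lt hr
  refine ⟨(ρ - r)⁻¹, fun p hp φ hφ => ?_⟩
  choose q hq he using fun α : Fin n →₀ ℕ => exists_monomial_eq hp hr α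
  have hb : ∀ i α, nrm ρ (C (coeff α φ) * q α i) ≤
      ((ρ - r)⁻¹ : ℝ≥0) * (‖coeff α φ‖ₑ * (ρ : ℝ≥0∞) ^ α.degree) := fun i α => by
    refine nrm_mul_le.trans ?_
    rw [nrm_C, mul_left_comm]
    gcongr
    exact hq α i
  have hs : ∀ i, ∑' α, nrm ρ (C (coeff α φ) * q α i) ≤ ((ρ - r)⁻¹ : ℝ≥0) * nrm ρ φ := fun i => by
    unfold nrm at *
    rw [← ENNReal.tsum_mul_left]
    exact ENNReal.tsum_le_tsum (hb i)
  have hfin : ∀ i, ∑' α, nrm ρ (C (coeff α φ) * q α i) ≠ ∞ := fun i =>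
    ne_top_of_le_ne_top (ENNReal.mul_ne_top ENNReal.coe_ne_top hφ) (hs i)
  choose Q hQ using fun i => exists_coeffHasSum hρ (hfin i)
  refine ⟨Q, fun i => (hQ i).nrm_le.trans (hs i), ?_⟩
  have h1 := coeffHasSum_monomials φ
  have hc : CoeffHasSum (fun α => C (coeff α φ * ∏ i, p i ^ α i)) (C (ev p φ) :
      MvPowerSeries (Fin n) ℂ) := by
    classical
    intro β
    simp only [coeff_C]
    split_ifs with h
    · exact hasSum_ev hφ (hp.trans (by exact_mod_cast hr.le))
    · exact hasSum_zero
  have h2 := hc.add (CoeffHasSum.sum Finset.univ fun i _ => (hQ i).mul_left (X i - C (p i)))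
  refine h1.unique ?_
  convert h2 using 2 with α
  have : monomial α (coeff α φ) = C (coeff α φ) * monomial α 1 := by
    rw [← monomial_zero_eq_C_apply, monomial_mul_monomial, zero_add, mul_one]
  rw [this, he α, mul_add, ← map_mul, Finset.mul_sum]
  congr 1
  exact Finset.sum_congr rfl fun i _ => by ring

/-! ### Convergent power series and analytic functions -/

variable {n : ℕ} {ρ : ℝ≥0} {φ : MvPowerSeries (Fin n) ℂ}

theorem exists_word (k : ℕ) (α : Fin n →₀ ℕ) (hα : α.degree = k) :
    ∃ w : Fin k → Fin n, ∀ x : Fin n → ℂ, ∏ j, x (w j) = ∏ i, x i ^ α i := by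
  classical
  induction k generalizing α with
  | zero =>
    rw [Finsupp.degree_eq_zero_iff] at hα
    subst hα
    exact ⟨Fin.elim0, fun x => by simp⟩
  | succ k ih =>
    have hα0 : α ≠ 0 := by
      rintro rfl
      simp at hα
    obtain ⟨j, hj⟩ := Finsupp.ne_iff.1 hα0
    have hle : Finsupp.single j 1 ≤ α := by
      rw [Finsupp.single_le_iff]
      exact Nat.one_le_iff_ne_zero.2 hj
    obtain ⟨β, rfl⟩ := exists_add_of_le hle
    have hβ : β.degree = k := by
      rw [map_add, Finsupp.degree_single] at hα
      omega
    obtain ⟨w, hw⟩ := ih β hβ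
    refine ⟨Fin.cons j w, fun x => ?_⟩
    rw [Fin.prod_univ_succ]
    simp only [Fin.cons_zero, Fin.cons_succ, hw, Finsupp.add_apply, pow_add,
      Finset.prod_mul_distrib]
    congr 1
    rw [Finset.prod_eq_single j] <;> simp +contextual

/-- The multilinear map `(y₁, …, y_k) ↦ ∏ y_j (w j)`. -/
noncomputable def wordMap {k : ℕ} (w : Fin k → Fin n) :
    ContinuousMultilinearMap ℂ (fun _ : Fin k => Fin n → ℂ) ℂ :=
  (ContinuousMultilinearMap.mkPiAlgebra ℂ (Fin k) ℂ).compContinuousLinearMap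
    fun j => ContinuousLinearMap.proj (w j)

theorem wordMap_apply {k : ℕ} (w : Fin k → Fin n) (y : Fin k → Fin n → ℂ) :
    wordMap w y = ∏ j, y j (w j) := by
  simp [wordMap]

theorem norm_wordMap_le {k : ℕ} (w : Fin k → Fin n) : ‖wordMap w‖ ≤ 1 := by
  refine ContinuousMultilinearMap.opNorm_le_bound zero_le_one fun y => ?_
  rw [wordMap_apply, one_mul, norm_prod]
  exact Finset.prod_le_prod (fun _ _ => norm_nonneg _) fun j _ => norm_le_pi_norm (y j) (w j)

/-- Monomials are grouped by degree, each being the diagonal value of some `wordMap`. The polynomial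
`P` records the homogeneous part on the diagonal, which is all that uniqueness of the expansion
controls. -/
theorem exists_hasFPowerSeriesOnBall (hρ : 0 < ρ) (hφ : φ ∈ conv n ρ) :
    ∃ p : FormalMultilinearSeries ℂ (Fin n → ℂ) ℂ, HasFPowerSeriesOnBall (fun x => ev x φ) p (0 : Fin n → ℂ) ρ ∧
      ∀ k, ∃ P : MvPolynomial (Fin n) ℂ, (∀ α, α.degree = k → P.coeff α = coeff α φ) ∧
        ∀ y, (p k fun _ => y) = MvPolynomial.eval y P := by
  classical
  choose w hw using fun k (α : {α : Fin n →₀ ℕ // α.degree = k}) => exists_word k α.1 α.2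
  have : ∀ k, Fintype {α : Fin n →₀ ℕ // α.degree = k} := fun k =>
    (Finsupp.finite_of_degree_eq k).fintype
  let p : FormalMultilinearSeries ℂ (Fin n → ℂ) ℂ := fun k =>
    ∑ α : {α : Fin n →₀ ℕ // α.degree = k}, coeff α.1 φ • wordMap (w k α)
  have hs : Summable fun α : Fin n →₀ ℕ => ‖coeff α φ‖ * (ρ : ℝ) ^ α.degree := by
    have h : (∑' α : Fin n →₀ ℕ, ‖(coeff α φ * ((ρ : ℝ) : ℂ) ^ α.degree : ℂ)‖ₑ : ℝ≥0∞) ≠ ∞ := by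
      refine ne_of_eq_of_ne (b := nrm ρ φ) ?_ hφ
      refine tsum_congr fun α => ?_
      rw [enorm_mul, enorm_pow]
      congr 2
      rw [enorm_eq_nnnorm]
      norm_cast
      ext
      simp
    have h1 := tsum_enorm_ne_top_iff_summable_norm.1 h
    simpa using h1
  have hs' := (Equiv.sigmaFiberEquiv (fun α : Fin n →₀ ℕ => α.degree)).summable_iff.2 hs
  have hp : ∀ k y, (p k fun _ => y) = ∑ α : {α : Fin n →₀ ℕ // α.degree = k},
      coeff α.1 φ * ∏ i, y i ^ α.1 i := fun k y => by
    simp only [p, sum_apply, smul_apply, wordMap_apply, hw, smul_eq_mul]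
  refine ⟨p, ⟨?_, by exact_mod_cast hρ, fun {y} hy => ?_⟩, fun k =>
    ⟨∑ α : {α : Fin n →₀ ℕ // α.degree = k}, MvPolynomial.monomial α.1 (coeff α.1 φ),
      fun α hα => ?_, fun y => ?_⟩⟩
  · refine p.le_radius_of_summable (Summable.of_nonneg_of_le (fun k => by positivity) (fun k => ?_)
      hs'.sigma)
    rw [tsum_fintype]
    calc ‖p k‖ * (ρ : ℝ) ^ k
        ≤ (∑ α : {α : Fin n →₀ ℕ // α.degree = k}, ‖coeff α.1 φ‖) * (ρ : ℝ) ^ k := by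
          gcongr
          refine (norm_sum_le _ _).trans (Finset.sum_le_sum fun α _ => ?_)
          rw [norm_smul]
          exact mul_le_of_le_one_right (norm_nonneg _) (norm_wordMap_le _)
      _ = _ := by
          rw [Finset.sum_mul]
          refine Finset.sum_congr rfl fun α _ => ?_
          simp [Equiv.sigmaFiberEquiv, α.2]
  · have hy' : ‖y‖ ≤ ρ := by
      rw [Metric.mem_eball, edist_zero_right, enorm_eq_nnnorm] at hy
      exact_mod_cast hy.le
    rw [zero_add]
    have h1 := (Equiv.sigmaFiberEquiv (fun α : Fin n →₀ ℕ => α.degree)).hasSum_iff.2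
      (hasSum_ev hφ hy')
    have h2 := h1.sigma fun k => hasSum_fintype _
    have h3 : (fun k => p k fun _ => y) = fun k => ∑ α : {α : Fin n →₀ ℕ // α.degree = k},
        coeff α.1 φ * ∏ i, y i ^ α.1 i := funext fun k => hp k y
    rw [h3]
    exact h2
  · rw [MvPolynomial.coeff_sum, Finset.sum_eq_single ⟨α, hα⟩]
    · simp
    · intro β _ hβ
      rw [MvPolynomial.coeff_monomial, if_neg]
      exact fun h => hβ (Subtype.ext h)
    · simp
  · rw [hp, map_sum]
    refine Finset.sum_congr rfl fun α _ => ?_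
    rw [MvPolynomial.eval_monomial, Finsupp.prod_fintype]
    simp

/-- The expansion of the zero function vanishes on the diagonal in each degree, and a polynomial
over an infinite field is determined by its values. -/
theorem eq_zero_of_ev_eventually_eq_zero (hρ : 0 < ρ) (hφ : φ ∈ conv n ρ)
    (h : ∀ᶠ x in 𝓝 0, ev x φ = 0) : φ = 0 := by
  obtain ⟨p, hp, hP⟩ := exists_hasFPowerSeriesOnBall hρ hφ
  ext α
  obtain ⟨P, hP1, hP2⟩ := hP α.degree
  have h0 : HasFPowerSeriesAt (0 : (Fin n → ℂ) → ℂ) p 0 := hp.hasFPowerSeriesAt.congr h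
  have hP0 : P = 0 := MvPolynomial.funext fun y => by
    rw [← hP2, h0.apply_eq_zero, map_zero]
  rw [← hP1 α rfl, hP0]
  simp

theorem analyticAt_ev (hφ : φ ∈ conv n ρ) {p : Fin n → ℂ} (hp : ‖p‖ < ρ) :
    AnalyticAt ℂ (fun x => ev x φ) p := by
  have hρ : 0 < ρ := by
    have := (norm_nonneg p).trans_lt hp
    exact_mod_cast this
  obtain ⟨q, hq, -⟩ := exists_hasFPowerSeriesOnBall hρ hφ
  refine hq.analyticAt_of_mem ?_
  rw [Metric.mem_eball, edist_zero_right, enorm_eq_nnnorm]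
  exact_mod_cast hp

/-- The `k`-th term of the Taylor expansion is expanded multilinearly over words of length `k` in
the basis vectors; words with the same letters contribute to the same monomial. -/
theorem exists_ev_eq {g : (Fin n → ℂ) → ℂ} (hg : AnalyticAt ℂ g 0) :
    ∃ ρ > 0, ∃ φ ∈ conv n ρ, ∀ x, ‖x‖ ≤ ρ → ev x φ = g x := by
  classical
  obtain ⟨p, R, hp⟩ := hg
  obtain ⟨r, hr0, hrR⟩ := ENNReal.lt_iff_exists_nnreal_btwn.1 hp.r_pos
  have hr0' : 0 < r := by exact_mod_cast hr0
  obtain ⟨C, hC0, hC⟩ := p.norm_mul_pow_le_of_lt_radius (hrR.trans_le hp.r_le)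
  -- There are `n ^ k` words of length `k`, and `n * ρ ≤ r / 2`, so the terms of degree `k` sum to
  -- at most `C / 2 ^ k`.
  set ρ : ℝ≥0 := r / (2 * (n + 1)) with hρ
  have hn0 : (0 : ℝ≥0) < 2 * (n + 1) := by positivity
  have hρ0 : 0 < ρ := div_pos hr0' hn0
  have hρr : ρ * (2 * (n + 1)) = r := div_mul_cancel₀ _ hn0.ne'
  let e : (Σ k : ℕ, Fin k → Fin n) → ℂ := fun w => p w.1 fun j => Pi.single (w.2 j) 1
  let c : (Σ k : ℕ, Fin k → Fin n) → (Fin n →₀ ℕ) := fun w => ∑ j, Finsupp.single (w.2 j) 1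
  have hdeg : ∀ w, (c w).degree = w.1 := fun w => by simp [c]
  have hprod : ∀ w (x : Fin n → ℂ), ∏ i, x i ^ (c w i) = ∏ j, x (w.2 j) := fun w x => by
    simp only [c, Finsupp.finsetSum_apply, ← Finset.prod_pow_eq_pow_sum]
    rw [Finset.prod_comm]
    refine Finset.prod_congr rfl fun j _ => ?_
    rw [Finset.prod_eq_single (w.2 j)] <;> simp +contextual
  have he : ∀ w, ‖e w‖ ≤ ‖p w.1‖ := fun w => by
    refine ((p w.1).le_opNorm _).trans ?_
    refine mul_le_of_le_one_right (norm_nonneg _) (Finset.prod_le_one (fun _ _ => norm_nonneg _)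
      fun j _ => ?_)
    rw [pi_norm_le_iff_of_nonneg zero_le_one]
    intro i
    by_cases h : i = w.2 j
    · subst h; simp
    · simp [h]
  have hsum : ∑' w, nrm ρ (monomial (c w) (e w)) ≠ ∞ := by
    rw [ENNReal.tsum_sigma']
    have hle : ∀ k, ∑' w : Fin k → Fin n, nrm ρ (monomial (c ⟨k, w⟩) (e ⟨k, w⟩)) ≤
        ‖(C * (1 / 2) ^ k : ℝ)‖ₑ := fun k => by
      calc ∑' w : Fin k → Fin n, nrm ρ (monomial (c ⟨k, w⟩) (e ⟨k, w⟩))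
          ≤ ∑' w : Fin k → Fin n, ‖p k‖ₑ * (ρ : ℝ≥0∞) ^ k := by
            refine ENNReal.tsum_le_tsum fun w => ?_
            rw [nrm_monomial, hdeg]
            gcongr
            rw [enorm_le_iff_norm_le]
            exact he ⟨k, w⟩
        _ = ‖(‖p k‖ * ((n : ℝ) * ρ) ^ k : ℝ)‖ₑ := by
            rw [tsum_fintype, Finset.sum_const, Finset.card_univ, Fintype.card_fun,
              Fintype.card_fin, Fintype.card_fin, nsmul_eq_mul, enorm_mul, enorm_norm, enorm_pow,
              enorm_mul, mul_pow]
            have h1 : ‖(ρ : ℝ)‖ₑ = ρ := by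
              rw [enorm_eq_nnnorm]; congr 1; ext; simp
            have h2 : ‖(n : ℝ)‖ₑ = n := by
              rw [enorm_eq_nnnorm]; norm_cast
            rw [h1, h2]
            push_cast
            ring
        _ ≤ _ := by
            rw [enorm_le_iff_norm_le, Real.norm_of_nonneg (by positivity),
              Real.norm_of_nonneg (by positivity)]
            have h3 : (n : ℝ) * ρ ≤ r * (1 / 2) := by
              have : (ρ : ℝ) * (2 * (n + 1)) = r := by exact_mod_cast hρr
              have h4 : (0 : ℝ) ≤ ρ := ρ.2
              nlinarith
            calc ‖p k‖ * ((n : ℝ) * ρ) ^ k ≤ ‖p k‖ * (r * (1 / 2)) ^ k := by gcongr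
              _ = (‖p k‖ * (r : ℝ) ^ k) * (1 / 2) ^ k := by rw [mul_pow]; ring
              _ ≤ C * (1 / 2) ^ k := by
                  gcongr
                  exact hC k
    refine ne_top_of_le_ne_top ?_ (ENNReal.tsum_le_tsum hle)
    rw [tsum_enorm_ne_top_iff_summable_norm]
    exact (Summable.mul_left C (summable_geometric_of_lt_one (by norm_num) (by norm_num))).norm
  obtain ⟨S, hS⟩ := exists_coeffHasSum hρ0 hsum
  refine ⟨ρ, hρ0, S, ne_top_of_le_ne_top hsum hS.nrm_le, fun x hx => ?_⟩
  have h1 := hS.hasSum_ev hsum hx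
  have h2 := h1.sigma fun k => hasSum_fintype _
  refine h2.unique ?_
  have hxR : x ∈ Metric.eball (0 : Fin n → ℂ) R := by
    rw [Metric.mem_eball, edist_zero_right, enorm_eq_nnnorm]
    refine lt_of_le_of_lt ?_ hrR
    have h3 : ρ ≤ r := div_le_self zero_le (by
      have : (0 : ℝ≥0) ≤ n := zero_le
      calc (1 : ℝ≥0) ≤ 2 * (0 + 1) := by norm_num
        _ ≤ _ := by gcongr)
    have : ‖x‖₊ ≤ ρ := by exact_mod_cast hx
    exact_mod_cast this.trans h3
  have h5 := hp.hasSum hxR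
  rw [zero_add] at h5
  have hx1 : x = ∑ i, x i • Pi.single i (1 : ℂ) := by
    ext j
    simp [Finset.sum_apply, Pi.single_apply]
  have h6 : (fun k => p k fun _ => x) =
      fun k => ∑ w : Fin k → Fin n, ev x (monomial (c ⟨k, w⟩) (e ⟨k, w⟩)) := by
    funext k
    have h7 : (p k fun _ => x) = p k fun _ => ∑ i, x i • Pi.single i (1 : ℂ) :=
      congrArg (fun z => p k fun _ => z) hx1
    rw [h7, ContinuousMultilinearMap.map_sum]
    refine Finset.sum_congr rfl fun w _ => ?_
    rw [ContinuousMultilinearMap.map_smul_univ, ev_monomial, hprod, mul_comm, smul_eq_mul]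
  rw [h6] at h5
  exact h5

/-! ### Weierstrass division with uniform radii -/

/-- Sorting words by their first letter is what makes the iterated division telescope. -/
theorem hasSum_list_cons {d : ℕ} {F : List (Fin d) → ℂ} {r : Fin d → ℂ}
    (h : ∀ l, HasSum (fun w => F (l :: w)) (r l)) : HasSum F (F [] + ∑ l, r l) := by
  classical
  have h1 : ∀ l, HasSum (fun w => if w.head? = some l then F w else 0) (r l) := fun l => by
    have hinj : Function.Injective (fun w : List (Fin d) => l :: w) := List.cons_injective
    rw [← hinj.hasSum_iff]
    · simpa [Function.comp_def] using h l
    · intro w hw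
      rw [if_neg]
      intro h'
      cases w with
      | nil => simp at h'
      | cons m w =>
        simp only [List.head?_cons, Option.some.injEq] at h'
        subst h'
        exact hw ⟨w, rfl⟩
  have h2 : HasSum (fun w : List (Fin d) => if w = [] then F [] else 0) (F []) := hasSum_ite_eq [] (F [])
  convert h2.add (hasSum_sum fun l (_ : l ∈ Finset.univ) => h1 l) using 1
  funext w
  cases w with
  | nil => simp
  | cons m w => simp

theorem tsum_list_pow_length (d : ℕ) (r : ℝ≥0∞) :
    ∑' w : List (Fin d), r ^ w.length = ∑' k : ℕ, (d * r) ^ k := by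
  rw [← List.equivSigmaTuple.symm.tsum_eq, ENNReal.tsum_sigma']
  refine tsum_congr fun k => ?_
  simp [List.equivSigmaTuple, mul_pow]

variable {n : ℕ} {ρ : ℝ≥0} {J κ ι : Type*} [Fintype J] [Fintype κ] [Fintype ι]
  {e : J → MvPowerSeries (Fin n) ℂ} {g : κ → MvPowerSeries (Fin n) ℂ}
  {a : ι → MvPowerSeries (Fin n) ℂ} {y z : MvPowerSeries (Fin n) ℂ}

/-- All multiples of `y` by a series convergent on the polydisc of radius `ρ` are linear
combinations of the `e j` with constant coefficients, and of the `g k` and `a l` with convergent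
coefficients, with linear estimates. -/
def Decomposes (ρ : ℝ≥0) (e : J → MvPowerSeries (Fin n) ℂ) (g : κ → MvPowerSeries (Fin n) ℂ)
    (a : ι → MvPowerSeries (Fin n) ℂ) (y : MvPowerSeries (Fin n) ℂ) : Prop :=
  ∃ K : ℝ≥0, ∀ h ∈ conv n ρ, ∃ (c : J → ℂ) (u : κ → MvPowerSeries (Fin n) ℂ)
    (v : ι → MvPowerSeries (Fin n) ℂ), (∀ j, ‖c j‖ₑ ≤ K * nrm ρ h) ∧
    (∀ k, nrm ρ (u k) ≤ K * nrm ρ h) ∧ (∀ l, nrm ρ (v l) ≤ K * nrm ρ h) ∧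
    y * h = ∑ j, C (c j) * e j + ∑ k, u k * g k + ∑ l, v l * a l

namespace Decomposes

theorem mul (hy : Decomposes ρ e g a y) (hz : z ∈ conv n ρ) : Decomposes ρ e g a (y * z) := by
  obtain ⟨K, hK⟩ := hy
  refine ⟨K * (nrm ρ z).toNNReal, fun h hh => ?_⟩
  obtain ⟨c, u, v, hc, hu, hv, he⟩ := hK (z * h) ((conv n ρ).mul_mem hz hh)
  have hle : (K : ℝ≥0∞) * nrm ρ (z * h) ≤ (K * (nrm ρ z).toNNReal : ℝ≥0) * nrm ρ h := by
    rw [ENNReal.coe_mul, ENNReal.coe_toNNReal hz, mul_assoc]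
    gcongr
    exact nrm_mul_le
  exact ⟨c, u, v, fun j => (hc j).trans hle, fun k => (hu k).trans hle, fun l => (hv l).trans hle,
    by rw [mul_assoc, he]⟩

theorem zero : Decomposes ρ e g a 0 :=
  ⟨0, fun h _ => ⟨0, 0, 0, by simp, by simp [nrm_zero], by simp [nrm_zero], by simp⟩⟩

theorem add (hy : Decomposes ρ e g a y) (hz : Decomposes ρ e g a z) :
    Decomposes ρ e g a (y + z) := by
  obtain ⟨K, hK⟩ := hy
  obtain ⟨L, hL⟩ := hz
  refine ⟨K + L, fun h hh => ?_⟩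
  obtain ⟨c, u, v, hc, hu, hv, he⟩ := hK h hh
  obtain ⟨c', u', v', hc', hu', hv', he'⟩ := hL h hh
  refine ⟨c + c', u + u', v + v', fun j => ?_, fun k => ?_, fun l => ?_, ?_⟩
  · rw [ENNReal.coe_add, add_mul]
    exact (enorm_add_le _ _).trans (add_le_add (hc j) (hc' j))
  · rw [ENNReal.coe_add, add_mul]
    exact nrm_add_le.trans (add_le_add (hu k) (hu' k))
  · rw [ENNReal.coe_add, add_mul]
    exact nrm_add_le.trans (add_le_add (hv l) (hv' l))
  · rw [add_mul, he, he']
    simp only [Pi.add_apply, map_add, add_mul, Finset.sum_add_distrib]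
    ring

theorem sum {τ : Type*} (s : Finset τ) {y : τ → MvPowerSeries (Fin n) ℂ}
    (h : ∀ t ∈ s, Decomposes ρ e g a (y t)) : Decomposes ρ e g a (∑ t ∈ s, y t) :=
  Finset.sum_induction y _ (fun _ _ => add) zero h

theorem of_left (k : κ) : Decomposes ρ e g a (g k) := by
  classical
  refine ⟨1, fun h _ => ⟨0, Pi.single k h, 0, by simp, fun i => ?_, by simp [nrm_zero], ?_⟩⟩
  · by_cases hi : i = k
    · subst hi; simp
    · simp [hi, nrm_zero]
  · simp [Pi.single_apply, mul_comm]

theorem of_right (l : ι) : Decomposes ρ e g a (a l) := by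
  classical
  refine ⟨1, fun h _ => ⟨0, 0, Pi.single l h, by simp, by simp [nrm_zero], fun i => ?_, ?_⟩⟩
  · by_cases hi : i = l
    · subst hi; simp
    · simp [hi, nrm_zero]
  · simp [Pi.single_apply, mul_comm]

/-- By Hadamard at the origin, `h = h(0) + ∑ x_i q_i`, so `e_j h = h(0) e_j + ∑ (x_i e_j) q_i`: only
the constant multiple of `e_j` itself remains. -/
theorem of_forall_X_mul (hρ : 0 < ρ) (j : J) (h : ∀ i, Decomposes ρ e g a (X i * e j)) :
    Decomposes ρ e g a (e j) := by
  classical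
  choose K hK using h
  obtain ⟨L, hL⟩ := exists_eq_C_add_sum (n := n) hρ
  refine ⟨1 + ∑ i, K i * L, fun h hh => ?_⟩
  obtain ⟨q, hq, hqe⟩ := hL 0 (by simp) h hh
  have hqm : ∀ i, q i ∈ conv n ρ := fun i =>
    ne_top_of_le_ne_top (ENNReal.mul_ne_top ENNReal.coe_ne_top hh) (hq i)
  choose c u v hc hu hv he using fun i => hK i (q i) (hqm i)
  have hb : ∀ i, (K i : ℝ≥0∞) * nrm ρ (q i) ≤ (K i * L : ℝ≥0) * nrm ρ h := fun i => by
    rw [ENNReal.coe_mul, mul_assoc]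
    gcongr
    exact hq i
  have hcoe : ((1 + ∑ i, K i * L : ℝ≥0) : ℝ≥0∞) * nrm ρ h =
      nrm ρ h + ∑ i, ((K i * L : ℝ≥0) : ℝ≥0∞) * nrm ρ h := by
    rw [ENNReal.coe_add, ENNReal.coe_one, add_mul, one_mul, ENNReal.ofNNReal_finsetSum, Finset.sum_mul]
  refine ⟨fun j' => (if j' = j then constantCoeff h else 0) + ∑ i, c i j', fun k => ∑ i, u i k,
    fun l => ∑ i, v i l, fun j' => ?_, fun k => ?_, fun l => ?_, ?_⟩
  · rw [hcoe]
    refine (enorm_add_le _ _).trans (add_le_add ?_ ((enorm_sum_le _ _).trans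
      (Finset.sum_le_sum fun i _ => (hc i j').trans (hb i))))
    split_ifs
    · exact enorm_constantCoeff_le
    · simp
  · rw [hcoe]
    exact (nrm_sum_le _ _).trans ((Finset.sum_le_sum fun i _ => (hu i k).trans (hb i)).trans
      le_add_self)
  · rw [hcoe]
    exact (nrm_sum_le _ _).trans ((Finset.sum_le_sum fun i _ => (hv i l).trans (hb i)).trans
      le_add_self)
  · rw [ev_zero_point] at hqe
    have h1 : e j * h = C (constantCoeff h) * e j + ∑ i, X i * e j * q i := by
      conv_lhs => rw [hqe]
      simp only [Pi.zero_apply, map_zero, sub_zero, mul_add, Finset.mul_sum]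
      rw [mul_comm (e j)]
      congr 1
      exact Finset.sum_congr rfl fun i _ => by ring
    rw [h1, Finset.sum_congr rfl fun i _ => he i]
    simp only [map_add, map_sum, add_mul, Finset.sum_add_distrib, Finset.sum_mul]
    rw [Finset.sum_comm (f := fun i j' => C (c i j') * e j'),
      Finset.sum_comm (f := fun i k => u i k * g k), Finset.sum_comm (f := fun i l => v i l * a l)]
    have h2 : ∑ j', C (if j' = j then constantCoeff h else 0) * e j' =
        C (constantCoeff h) * e j := by
      rw [Finset.sum_eq_single j] <;> simp +contextual
    rw [h2]
    ring

end Decomposes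

/-- The monomials with all exponents less than `N`. -/
noncomputable def boxMon (n N : ℕ) (j : Fin n → Fin N) : MvPowerSeries (Fin n) ℂ :=
  ∏ i, X i ^ (j i : ℕ)

theorem boxMon_mem_conv {N : ℕ} (j : Fin n → Fin N) : boxMon n N j ∈ conv n ρ :=
  Subalgebra.prod_mem _ fun _ _ => Subalgebra.pow_mem _ (X_mem_conv _) _

/-- Downward induction from large monomials, on the deficit `∑ (N - α i)`. A monomial with some
exponent at least `N` is a multiple of some `X i ^ N`; one inside the box is a `boxMon`, and its
products with the variables have smaller deficit. -/
theorem decomposes_one (hρ : 0 < ρ) {N : ℕ}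
    (h : ∀ i, ∃ (u : κ → MvPowerSeries (Fin n) ℂ) (v : ι → MvPowerSeries (Fin n) ℂ),
      (∀ k, u k ∈ conv n ρ) ∧ (∀ l, v l ∈ conv n ρ) ∧
      X i ^ N = ∑ k, u k * g k + ∑ l, v l * a l) :
    Decomposes ρ (boxMon n N) g a 1 := by
  classical
  have hN : ∀ i, Decomposes ρ (boxMon n N) g a (X i ^ N) := fun i => by
    obtain ⟨u, v, hu, hv, he⟩ := h i
    rw [he]
    refine (Decomposes.sum _ fun k _ => ?_).add (Decomposes.sum _ fun l _ => ?_)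
    · rw [mul_comm]; exact (Decomposes.of_left k).mul (hu k)
    · rw [mul_comm]; exact (Decomposes.of_right l).mul (hv l)
  have key : ∀ (m : ℕ) (α : Fin n → ℕ), ∑ i, (N - α i) = m →
      Decomposes ρ (boxMon n N) g a (∏ i, X i ^ α i) := by
    intro m
    induction m using Nat.strong_induction_on with
    | _ m ih =>
      intro α hα
      by_cases hex : ∃ i, N ≤ α i
      · obtain ⟨i, hi⟩ := hex
        rw [← Finset.mul_prod_erase _ _ (Finset.mem_univ i), ← Nat.add_sub_cancel' hi, pow_add,
          mul_assoc]
        exact (hN i).mul ((conv n ρ).mul_mem ((conv n ρ).pow_mem (X_mem_conv _) _)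
          (Subalgebra.prod_mem _ fun _ _ => Subalgebra.pow_mem _ (X_mem_conv _) _))
      · push Not at hex
        refine Decomposes.of_forall_X_mul (e := boxMon n N) hρ (fun i => ⟨α i, hex i⟩) fun i => ?_
        have h1 : X i * boxMon n N (fun i => ⟨α i, hex i⟩) =
            ∏ i', X i' ^ ((α + Pi.single i 1 : Fin n → ℕ) i') := by
          simp only [boxMon, Pi.add_apply, pow_add, Finset.prod_mul_distrib]
          rw [mul_comm]
          congr 1
          rw [Finset.prod_eq_single i] <;> simp +contextual
        rw [h1]
        refine ih _ ?_ _ rfl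
        rw [← hα]
        refine Finset.sum_lt_sum (fun i' _ => Nat.sub_le_sub_left (by simp) _)
          ⟨i, Finset.mem_univ i, ?_⟩
        have := hex i
        simp only [Pi.add_apply, Pi.single_eq_same]
        omega
  simpa using key _ 0 rfl

theorem list_prod_mem_conv {n : ℕ} {ρ : ℝ≥0} {ι : Type*} {a : ι → MvPowerSeries (Fin n) ℂ}
    (ha : ∀ l, a l ∈ conv n ρ) (w : List ι) : (w.map a).prod ∈ conv n ρ :=
  Subalgebra.list_prod_mem _ fun y hy => by
    obtain ⟨l, _, rfl⟩ := List.mem_map.1 hy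
    exact ha l

theorem nrm_list_prod_le {n : ℕ} {ρ σ : ℝ≥0} {ι : Type*} {a : ι → MvPowerSeries (Fin n) ℂ}
    (ha : ∀ l, nrm ρ (a l) ≤ σ) (w : List ι) : nrm ρ (w.map a).prod ≤ (σ : ℝ≥0∞) ^ w.length := by
  induction w with
  | nil => simp [nrm_one]
  | cons l w ih =>
    rw [List.map_cons, List.prod_cons, List.length_cons, pow_succ']
    exact nrm_mul_le.trans (mul_le_mul' (ha l) ih)

theorem ev_list_prod {n : ℕ} {ρ : ℝ≥0} {ι : Type*} {a : ι → MvPowerSeries (Fin n) ℂ}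
    (ha : ∀ l, a l ∈ conv n ρ) {x : Fin n → ℂ} (hx : ‖x‖ ≤ ρ) (w : List ι) :
    ev x (w.map a).prod = (w.map fun l => ev x (a l)).prod := by
  induction w with
  | nil => exact (evHom x hx).map_one
  | cons l w ih =>
    rw [List.map_cons, List.prod_cons, List.map_cons, List.prod_cons,
      ev_mul (ha l) (list_prod_mem_conv ha w) hx, ih]

/-- **Weierstrass division**, in a general form and with uniform radii: the series convergent on a
polydisc are combinations of the `e j` with coefficients that are convergent series in the `a l`,
modulo the `g k`. -/
theorem weierstrass_division {n d : ℕ} {ρ : ℝ≥0} (hρ : 0 < ρ) {J κ : Type*} [Fintype J]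
    [Fintype κ] {e : J → MvPowerSeries (Fin n) ℂ} {g : κ → MvPowerSeries (Fin n) ℂ}
    {a : Fin d → MvPowerSeries (Fin n) ℂ} (ha : ∀ l, a l ∈ conv n ρ)
    (ha0 : ∀ l, constantCoeff (a l) = 0) (H : Decomposes ρ e g a 1) :
    ∃ ρ' > 0, ρ' ≤ ρ ∧ ∃ σ : ℝ≥0, 0 < σ ∧ (∀ l, nrm ρ' (a l) ≤ σ) ∧ ∀ φ ∈ conv n ρ,
      ∃ Ω : J → MvPowerSeries (Fin d) ℂ, (∀ j, Ω j ∈ conv d σ) ∧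
      ∃ T : J → MvPowerSeries (Fin n) ℂ, (∀ j, T j ∈ conv n ρ' ∧
        ∀ x, ‖x‖ ≤ ρ' → ev x (T j) = ev (fun l => ev x (a l)) (Ω j)) ∧
      ∃ u : κ → MvPowerSeries (Fin n) ℂ, (∀ k, u k ∈ conv n ρ') ∧
        φ = ∑ j, T j * e j + ∑ k, u k * g k := by
  classical
  obtain ⟨K, hK⟩ := H
  choose! cf uf vf hcf huf hvf hdec using hK
  -- This ensures `d * σ * K < 1`, so that the sums over all words in `d` letters are dominated by a
  -- convergent geometric series.
  set σ : ℝ≥0 := (2 * (d + 1) * (K + 1))⁻¹ with hσ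
  have hσ0 : 0 < σ := by positivity
  set A : ℝ≥0 := ∑ l, (nrm ρ (a l)).toNNReal with hA
  -- Since the `a l` have no constant term, shrinking by the factor `σ / (A + σ)` brings their norms
  -- below `σ`.
  set ρ' : ℝ≥0 := ρ * (σ / (A + σ)) with hρ'
  have hAσ : 0 < A + σ := by positivity
  have hρ'0 : 0 < ρ' := by positivity
  have hρ'le : ρ' ≤ ρ := mul_le_of_le_one_right zero_le (div_le_one_of_le₀ le_add_self zero_le)
  have haσ : ∀ l, nrm ρ' (a l) ≤ σ := fun l => by
    refine (nrm_le_div_mul_nrm hρ hρ'le (ha0 l)).trans ?_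
    rw [← ENNReal.coe_toNNReal (ha l), ← ENNReal.coe_mul, ENNReal.coe_le_coe, hρ',
      mul_div_cancel_left₀ _ hρ.ne']
    calc σ / (A + σ) * (nrm ρ (a l)).toNNReal ≤ σ / (A + σ) * (A + σ) := by
          gcongr
          exact (Finset.single_le_sum (f := fun l => (nrm ρ (a l)).toNNReal)
            (fun _ _ => zero_le) (Finset.mem_univ l)).trans le_self_add
      _ = σ := div_mul_cancel₀ _ hAσ.ne'
  refine ⟨ρ', hρ'0, hρ'le, σ, hσ0, haσ, fun φ hφ => ?_⟩
  -- Iterated division: `hw w` is the coefficient left over after decomposing repeatedly along the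
  -- letters of `w`, so that formally `φ` is the sum over `w` of `a^w` times the `e` and `g` parts
  -- of `hw w`.
  let hw : List (Fin d) → MvPowerSeries (Fin n) ℂ := fun w => w.rec φ fun l _ h => vf h l
  have hw_cons : ∀ l w, hw (l :: w) = vf (hw w) l := fun _ _ => rfl
  have hw_mem : ∀ w, hw w ∈ conv n ρ ∧ nrm ρ (hw w) ≤ (K : ℝ≥0∞) ^ w.length * nrm ρ φ := by
    intro w
    induction w with
    | nil => exact ⟨hφ, by simp [hw]⟩
    | cons l w ih =>
      have h1 : nrm ρ (hw (l :: w)) ≤ (K : ℝ≥0∞) ^ (l :: w).length * nrm ρ φ := by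
        rw [hw_cons, List.length_cons, pow_succ', mul_assoc]
        exact (hvf _ ih.1 l).trans (mul_le_mul_right ih.2 _)
      exact ⟨ne_top_of_le_ne_top (ENNReal.mul_ne_top (ENNReal.pow_ne_top ENNReal.coe_ne_top) hφ) h1,
        h1⟩
  let aw : List (Fin d) → MvPowerSeries (Fin n) ℂ := fun w => (w.map a).prod
  let zw : List (Fin d) → MvPowerSeries (Fin d) ℂ := fun w => (w.map X).prod
  have haw : ∀ w, nrm ρ' (aw w) ≤ (σ : ℝ≥0∞) ^ w.length := nrm_list_prod_le haσ
  have hzw : ∀ w, nrm σ (zw w) ≤ (σ : ℝ≥0∞) ^ w.length :=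
    nrm_list_prod_le fun l => (nrm_X l).le
  have hgeom : ∀ c : ℝ≥0∞, c ≠ ∞ →
      ∑' w : List (Fin d), c * ((σ : ℝ≥0∞) * K) ^ w.length ≠ ∞ := fun c hc => by
    rw [ENNReal.tsum_mul_left, tsum_list_pow_length, ENNReal.tsum_geometric]
    refine ENNReal.mul_ne_top hc (ENNReal.inv_ne_top.2 ?_)
    refine (tsub_pos_of_lt ?_).ne'
    have : (d * (σ * K) : ℝ≥0) < 1 := by
      rw [hσ, mul_comm _ K, ← mul_assoc, ← div_eq_mul_inv, div_lt_one (by positivity)]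
      have : (0 : ℝ) ≤ K := K.2
      have hd : (0 : ℝ) ≤ d := d.cast_nonneg
      rw [← NNReal.coe_lt_coe]
      push_cast
      nlinarith [mul_nonneg hd this]
    exact_mod_cast this
  have hbound : ∀ (F : List (Fin d) → ℝ≥0∞) (c : ℝ≥0∞), c ≠ ∞ →
      (∀ w, F w ≤ (σ : ℝ≥0∞) ^ w.length * (c * (K : ℝ≥0∞) ^ w.length)) → ∑' w, F w ≠ ∞ := by
    intro F c hc hF
    refine ne_top_of_le_ne_top (hgeom c hc) (ENNReal.tsum_le_tsum fun w => (hF w).trans ?_)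
    rw [mul_pow, mul_left_comm]
  have hKφ : (K : ℝ≥0∞) * nrm ρ φ ≠ ∞ := ENNReal.mul_ne_top ENNReal.coe_ne_top hφ
  have hKw : ∀ w, (K : ℝ≥0∞) * nrm ρ (hw w) ≤ K * nrm ρ φ * (K : ℝ≥0∞) ^ w.length := fun w => by
    rw [mul_assoc, mul_comm (nrm ρ φ)]
    exact mul_le_mul_right (hw_mem w).2 _
  have hT : ∀ j, ∑' w, nrm ρ' (C (cf (hw w) j) * aw w) ≠ ∞ := fun j => by
    refine hbound _ (K * nrm ρ φ) hKφ fun w => ?_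
    rw [mul_comm (C _)]
    refine nrm_mul_le.trans (mul_le_mul' (haw w) ?_)
    rw [nrm_C]
    exact (hcf _ (hw_mem w).1 j).trans (hKw w)
  have hΩ : ∀ j, ∑' w, nrm σ (C (cf (hw w) j) * zw w) ≠ ∞ := fun j => by
    refine hbound _ (K * nrm ρ φ) hKφ fun w => ?_
    rw [mul_comm (C _)]
    refine nrm_mul_le.trans (mul_le_mul' (hzw w) ?_)
    rw [nrm_C]
    exact (hcf _ (hw_mem w).1 j).trans (hKw w)
  have hU : ∀ k, ∑' w, nrm ρ' (aw w * uf (hw w) k) ≠ ∞ := fun k => by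
    refine hbound _ (K * nrm ρ φ) hKφ fun w => ?_
    refine nrm_mul_le.trans (mul_le_mul' (haw w) ?_)
    exact ((nrm_mono hρ'le).trans (huf _ (hw_mem w).1 k)).trans (hKw w)
  have hR : ∀ l, ∑' w, nrm ρ' (aw (l :: w) * hw (l :: w)) ≠ ∞ := fun l => by
    refine hbound _ (σ * (K * nrm ρ φ)) (ENNReal.mul_ne_top ENNReal.coe_ne_top hKφ) fun w => ?_
    refine nrm_mul_le.trans ((mul_le_mul' (haw _) (nrm_mono hρ'le)).trans ?_)
    rw [hw_cons, List.length_cons, pow_succ, mul_assoc, mul_assoc (σ : ℝ≥0∞)]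
    gcongr
    exact (hvf _ (hw_mem w).1 l).trans (hKw w)
  choose T hT' using fun j => exists_coeffHasSum hρ'0 (hT j)
  choose Ω hΩ' using fun j => exists_coeffHasSum hσ0 (hΩ j)
  choose U hU' using fun k => exists_coeffHasSum hρ'0 (hU k)
  choose R hR' using fun l => exists_coeffHasSum hρ'0 (hR l)
  refine ⟨Ω, fun j => ne_top_of_le_ne_top (hΩ j) (hΩ' j).nrm_le, T, fun j =>
    ⟨ne_top_of_le_ne_top (hT j) (hT' j).nrm_le, fun x hx => ?_⟩, U, fun k =>
    ne_top_of_le_ne_top (hU k) (hU' k).nrm_le, ?_⟩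
  · have hy : ‖(fun l => ev x (a l) : Fin d → ℂ)‖ ≤ σ := by
      refine (pi_norm_le_iff_of_nonneg σ.2).2 fun l => ?_
      have := (enorm_ev_le hx).trans (haσ l)
      rw [enorm_eq_nnnorm] at this
      exact_mod_cast this
    have h1 := (hT' j).hasSum_ev (hT j) hx
    have h2 := (hΩ' j).hasSum_ev (hΩ j) hy
    refine h1.unique ?_
    convert h2 using 2 with w
    have ha' : ∀ l, a l ∈ conv n ρ' := fun l => conv_mono hρ'le (ha l)
    rw [ev_mul (C_mem_conv _) (list_prod_mem_conv ha' w) hx,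
      ev_mul (C_mem_conv _) (list_prod_mem_conv X_mem_conv w) hy, ev_C, ev_C,
      ev_list_prod ha' hx, ev_list_prod X_mem_conv hy]
    simp only [ev_X]
  -- The sum of all `a^w * hw w` is computed twice: by first letter it is `φ + ∑ R l`, and after
  -- decomposing every `hw w` it is the desired combination plus the same `∑ R l`, which cancels.
  · have h1 : CoeffHasSum (fun w => aw w * hw w) (φ + ∑ l, R l) := by
      intro α
      have h2 := hasSum_list_cons (F := fun w => coeff α (aw w * hw w)) fun l => hR' l α
      rw [map_add, map_sum]
      simpa [aw, hw] using h2
    have h3 := ((CoeffHasSum.sum Finset.univ fun j _ => (hT' j).mul_right (e j)).add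
      (CoeffHasSum.sum Finset.univ fun k _ => (hU' k).mul_right (g k))).add
      (CoeffHasSum.sum Finset.univ fun l _ => hR' l)
    refine add_right_cancel (h1.unique ?_)
    · convert h3 using 2 with w
      have h4 := hdec (hw w) (hw_mem w).1
      rw [one_mul] at h4
      conv_lhs => rw [h4]
      simp only [mul_add, Finset.mul_sum, aw, List.map_cons, List.prod_cons, hw_cons]
      refine congr_arg₂ _ (congr_arg₂ _ ?_ ?_) ?_ <;> exact Finset.sum_congr rfl fun _ _ => by ring

end MvPowerSeries

open scoped ENNReal NNReal

/-! ### Rings of holomorphic germs and division for germs -/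

namespace holomorphicGerms

variable {n d : ℕ} {p : Fin n → ℂ}

theorem ext_iff_eventuallyEq {g h : (Fin n → ℂ) → ℂ} {hg : AnalyticAt ℂ g p}
    {hh : AnalyticAt ℂ h p} : mk g hg = mk h hh ↔ g =ᶠ[𝓝 p] h :=
  Subtype.ext_iff.trans Germ.coe_eq

theorem exists_mk_eq (γ : holomorphicGerms n p) : ∃ g hg, mk (p := p) g hg = γ := by
  obtain ⟨_, g, hg, rfl⟩ := γ
  exact ⟨g, hg, rfl⟩

/-- The value of a germ at the base point. -/
noncomputable def value : holomorphicGerms n p →+* ℂ :=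
  Germ.valueRingHom.comp (holomorphicGerms n p).subtype

theorem value_mk {g : (Fin n → ℂ) → ℂ} {hg : AnalyticAt ℂ g p} : value (mk g hg) = g p := rfl

theorem isUnit_iff_value_ne_zero {γ : holomorphicGerms n p} : IsUnit γ ↔ value γ ≠ 0 := by
  refine ⟨fun h => (h.map value).ne_zero, fun h => ?_⟩
  obtain ⟨g, hg, rfl⟩ := exists_mk_eq γ
  exact isUnit_mk g hg h

theorem mem_maximalIdeal_iff {γ : holomorphicGerms n p} :
    γ ∈ IsLocalRing.maximalIdeal (holomorphicGerms n p) ↔ value γ = 0 := by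
  rw [IsLocalRing.mem_maximalIdeal, mem_nonunits_iff, isUnit_iff_value_ne_zero, not_not]

/-- The constant germs. -/
noncomputable def const : ℂ →+* holomorphicGerms n p where
  toFun c := mk (fun _ => c) analyticAt_const
  map_one' := rfl
  map_mul' _ _ := rfl
  map_zero' := rfl
  map_add' _ _ := rfl

theorem const_apply (c : ℂ) : const (p := p) c = mk (fun _ => c) analyticAt_const := rfl

theorem analyticAt_coord (i : Fin n) : AnalyticAt ℂ (fun x : Fin n → ℂ => x i) p := by
  have h := (ContinuousLinearMap.proj (R := ℂ) (φ := fun _ : Fin n => ℂ) i).analyticAt p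
  exact h

/-- The germs of the coordinate functions. -/
noncomputable def coord (i : Fin n) : holomorphicGerms n p :=
  mk (fun x => x i) (analyticAt_coord i)

theorem coord_def (i : Fin n) : (coord i : holomorphicGerms n p) =
    mk (fun x => x i) (analyticAt_coord i) := rfl

/-- Composition with a holomorphic map. -/
noncomputable def comp {q : Fin d → ℂ} (a : (Fin n → ℂ) → Fin d → ℂ) (ha : AnalyticAt ℂ a p)
    (hq : a p = q) : holomorphicGerms d q →+* holomorphicGerms n p where
  toFun γ := ⟨(γ : Germ (𝓝 q) ℂ).compTendsto a (hq ▸ ha.continuousAt.tendsto), by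
    obtain ⟨_, g, hg, rfl⟩ := γ
    exact ⟨g ∘ a, AnalyticAt.comp (hq ▸ hg) ha, rfl⟩⟩
  map_one' := rfl
  map_mul' := by
    rintro ⟨_, g, hg, rfl⟩ ⟨_, h, hh, rfl⟩
    rfl
  map_zero' := rfl
  map_add' := by
    rintro ⟨_, g, hg, rfl⟩ ⟨_, h, hh, rfl⟩
    rfl

theorem comp_mk {q : Fin d → ℂ} {a : (Fin n → ℂ) → Fin d → ℂ} {ha : AnalyticAt ℂ a p}
    {hq : a p = q} {g : (Fin d → ℂ) → ℂ} {hg : AnalyticAt ℂ g q} :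
    comp a ha hq (mk g hg) = mk (g ∘ a) (AnalyticAt.comp (hq ▸ hg) ha) := rfl

open MvPowerSeries

variable {ρ : ℝ≥0}

/-- The germ at a point of the open polydisc of the sum of a convergent power series. -/
noncomputable def ofSeries (p : Fin n → ℂ) (hp : ‖p‖ < ρ) : conv n ρ →+* holomorphicGerms n p where
  toFun φ := mk (fun x => ev x φ.1) (analyticAt_ev φ.2 hp)
  map_one' := Subtype.ext ((Germ.coe_eq (f := fun x => ev x (1 : conv n ρ).1)
    (g := fun x => 1)).2 (by
      filter_upwards [(continuous_norm.isOpen_preimage _ isOpen_Iio).mem_nhds hp] with x hx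
      exact (evHom x (le_of_lt hx)).map_one))
  map_mul' φ ψ := Subtype.ext ((Germ.coe_eq (f := fun x => ev x (φ * ψ : conv n ρ).1)
    (g := fun x => ev x φ.1 * ev x ψ.1)).2 (by
      filter_upwards [(continuous_norm.isOpen_preimage _ isOpen_Iio).mem_nhds hp] with x hx
      exact (evHom x (le_of_lt hx)).map_mul φ ψ))
  map_zero' := Subtype.ext ((Germ.coe_eq (f := fun x => ev x (0 : conv n ρ).1)
    (g := fun x => 0)).2 (by
      filter_upwards [(continuous_norm.isOpen_preimage _ isOpen_Iio).mem_nhds hp] with x hx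
      exact (evHom x (le_of_lt hx)).map_zero))
  map_add' φ ψ := Subtype.ext ((Germ.coe_eq (f := fun x => ev x (φ + ψ : conv n ρ).1)
    (g := fun x => ev x φ.1 + ev x ψ.1)).2 (by
      filter_upwards [(continuous_norm.isOpen_preimage _ isOpen_Iio).mem_nhds hp] with x hx
      exact (evHom x (le_of_lt hx)).map_add φ ψ))

theorem ofSeries_apply (hp : ‖p‖ < ρ) (φ : conv n ρ) :
    ofSeries p hp φ = mk (fun x => ev x φ.1) (analyticAt_ev φ.2 hp) := rfl

/-- `ofSeries` at the origin. -/
noncomputable abbrev ofSeries₀ (hρ : 0 < ρ) : conv n ρ →+* holomorphicGerms n 0 :=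
  ofSeries 0 (by simpa using hρ)

theorem ofSeries₀_injective (hρ : 0 < ρ) :
    Function.Injective (ofSeries₀ hρ : conv n ρ →+* holomorphicGerms n 0) := by
  rw [injective_iff_map_eq_zero]
  intro φ hφ
  exact Subtype.ext (eq_zero_of_ev_eventually_eq_zero hρ φ.2
    ((Germ.coe_eq (g := fun _ => (0 : ℂ))).1 (congrArg Subtype.val hφ)))

theorem ofSeries₀_X (hρ : 0 < ρ) (i : Fin n) :
    ofSeries₀ hρ ⟨X i, X_mem_conv i⟩ = coord i := by
  rw [ofSeries_apply, coord_def, ext_iff_eventuallyEq]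
  exact Eventually.of_forall fun _ => ev_X i

theorem ofSeries₀_C (hρ : 0 < ρ) (c : ℂ) :
    ofSeries₀ (n := n) hρ ⟨C c, C_mem_conv c⟩ = const c := by
  rw [ofSeries_apply, const_apply, ext_iff_eventuallyEq]
  exact Eventually.of_forall fun _ => ev_C c

theorem value_ofSeries₀ (hρ : 0 < ρ) (φ : conv n ρ) :
    value (ofSeries₀ hρ φ) = constantCoeff φ.1 := by
  rw [ofSeries_apply, value_mk, ev_zero_point]

/-- Having all small radii available lets finitely many germs be represented on a common polydisc.
-/
theorem eventually_exists_ofSeries₀_eq (γ : holomorphicGerms n 0) :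
    ∀ᶠ ρ in 𝓝[>] (0 : ℝ≥0), ∀ hρ : 0 < ρ, ∃ φ : conv n ρ, ofSeries₀ hρ φ = γ := by
  obtain ⟨g, hg, rfl⟩ := exists_mk_eq γ
  obtain ⟨r, hr, φ, hφ, he⟩ := exists_ev_eq hg
  filter_upwards [Ioc_mem_nhdsGT hr] with ρ hρr hρ
  refine ⟨⟨φ, conv_mono hρr.2 hφ⟩, (ofSeries_apply _ _).trans (ext_iff_eventuallyEq.2 ?_)⟩
  have h0 : ‖(0 : Fin n → ℂ)‖ < r := by simpa using hr
  filter_upwards [(continuous_norm.isOpen_preimage _ isOpen_Iio).mem_nhds h0] with x hx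
  exact he x (le_of_lt hx)

theorem exists_eq_const_add_sum (γ : holomorphicGerms n 0) :
    ∃ q : Fin n → holomorphicGerms n 0, γ = const (value γ) + ∑ i, coord i * q i := by
  obtain ⟨ρ, hρ, h⟩ := ((eventually_mem_nhdsWithin (a := (0 : ℝ≥0)) (s := Set.Ioi 0)).and
    (eventually_exists_ofSeries₀_eq γ)).exists
  have hρ : 0 < ρ := hρ
  obtain ⟨φ, rfl⟩ := h hρ
  obtain ⟨K, hK⟩ := exists_eq_C_add_sum (n := n) hρ
  obtain ⟨q, hq, he⟩ := hK 0 (by simp) φ.1 φ.2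
  have hqm : ∀ i, q i ∈ conv n ρ := fun i =>
    ne_top_of_le_ne_top (ENNReal.mul_ne_top ENNReal.coe_ne_top φ.2) (hq i)
  refine ⟨fun i => ofSeries₀ hρ ⟨q i, hqm i⟩, ?_⟩
  rw [value_ofSeries₀, ← ofSeries₀_C hρ]
  simp only [← ofSeries₀_X hρ, ← map_mul, ← map_sum, ← map_add]
  congr 1
  refine Subtype.ext ?_
  conv_lhs => rw [he]
  simp [ev_zero_point]

theorem maximalIdeal_eq_span :
    IsLocalRing.maximalIdeal (holomorphicGerms n 0) = Ideal.span (Set.range coord) := by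
  refine le_antisymm (fun γ hγ => ?_) (Ideal.span_le.2 ?_)
  · obtain ⟨q, hq⟩ := exists_eq_const_add_sum γ
    rw [hq, mem_maximalIdeal_iff.1 hγ, map_zero, zero_add]
    exact Ideal.sum_mem _ fun i _ => Ideal.mul_mem_right _ _ (Ideal.subset_span ⟨i, rfl⟩)
  · rintro _ ⟨i, rfl⟩
    exact mem_maximalIdeal_iff.2 (by rw [coord_def, value_mk]; rfl)

/-- **Weierstrass division** for germs, with a radius `σ` for the coefficients that depends only on
the polydisc on which the dividend converges. -/
theorem weierstrass_division {κ : Type*} [Finite κ] (G : κ → holomorphicGerms n 0)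
    {a : (Fin n → ℂ) → Fin d → ℂ} (ha : AnalyticAt ℂ a 0) (ha0 : a 0 = 0) {N : ℕ}
    (hN : ∀ i, coord i ^ N ∈ Ideal.span (Set.range G) ⊔
      Ideal.span (Set.range fun l => comp a ha ha0 (coord l))) :
    ∀ᶠ ρ in 𝓝[>] (0 : ℝ≥0), ∀ hρ : 0 < ρ, ∃ σ, ∃ hσ : 0 < σ, ∀ φ : conv n ρ,
      ∃ Ω : (Fin n → Fin N) → conv d σ, ofSeries₀ hρ φ -
        ∑ j, comp a ha ha0 (ofSeries₀ hσ (Ω j)) * ofSeries₀ hρ ⟨boxMon n N j, boxMon_mem_conv j⟩ ∈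
        Ideal.span (Set.range G) := by
  classical
  have := Fintype.ofFinite κ
  have hN' : ∀ i, ∃ (u : κ → holomorphicGerms n 0) (v : Fin d → holomorphicGerms n 0),
      coord i ^ N = ∑ k, u k * G k + ∑ l, v l * comp a ha ha0 (coord l) := fun i => by
    obtain ⟨y, hy, z, hz, he⟩ := Submodule.mem_sup.1 (hN i)
    obtain ⟨u, rfl⟩ := Ideal.mem_span_range_iff_exists_fun.1 hy
    obtain ⟨v, rfl⟩ := Ideal.mem_span_range_iff_exists_fun.1 hz
    exact ⟨u, v, he.symm⟩
  choose u v huv using hN'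
  filter_upwards [eventually_all.2 fun k => eventually_exists_ofSeries₀_eq (G k),
    eventually_all.2 fun l => eventually_exists_ofSeries₀_eq (comp a ha ha0 (coord l)),
    eventually_all.2 fun i => eventually_all.2 fun k => eventually_exists_ofSeries₀_eq (u i k),
    eventually_all.2 fun i => eventually_all.2 fun l => eventually_exists_ofSeries₀_eq (v i l)]
    with ρ hG hA hu hv hρ
  choose g hg using fun k => hG k hρ
  choose b hb using fun l => hA l hρ
  choose u' hu' using fun i k => hu i k hρ
  choose v' hv' using fun i l => hv i l hρ
  have hX : ∀ i, (⟨X i, X_mem_conv i⟩ : conv n ρ) ^ N =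
      ∑ k, u' i k * g k + ∑ l, v' i l * b l := fun i => by
    apply ofSeries₀_injective hρ
    simp only [map_add, map_pow, map_sum, map_mul, ofSeries₀_X, hu', hv', hg, hb]
    exact huv i
  have hb0 : ∀ l, constantCoeff (b l).1 = 0 := fun l => by
    rw [← value_ofSeries₀ hρ, hb]
    rw [coord_def, comp_mk, value_mk, Function.comp_apply, ha0]; rfl
  have hdec : Decomposes ρ (boxMon n N) (fun k => (g k).1) (fun l => (b l).1) 1 := by
    refine decomposes_one hρ fun i => ⟨fun k => (u' i k).1, fun l => (v' i l).1,
      fun k => (u' i k).2, fun l => (v' i l).2, ?_⟩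
    simpa using congrArg Subtype.val (hX i)
  obtain ⟨ρ', hρ', hle, σ, hσ, hbσ, hdiv⟩ :=
    MvPowerSeries.weierstrass_division hρ (fun l => (b l).2) hb0 hdec
  refine ⟨σ, hσ, fun φ => ?_⟩
  obtain ⟨Ω, hΩ, T, hT, w, hw, he⟩ := hdiv φ.1 φ.2
  refine ⟨fun j => ⟨Ω j, hΩ j⟩, ?_⟩
  have hT' : ∀ j, comp a ha ha0 (ofSeries₀ hσ ⟨Ω j, hΩ j⟩) = ofSeries₀ hρ' ⟨T j, (hT j).1⟩ := by
    intro j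
    rw [ofSeries_apply, ofSeries_apply, comp_mk, ext_iff_eventuallyEq]
    have h0 : ‖(0 : Fin n → ℂ)‖ < ρ' := by simpa using hρ'
    have hb' : ∀ᶠ x in 𝓝 0, ∀ l, ev x (b l).1 = a x l :=
      eventually_all.2 fun l => by
        have h := hb l
        rwa [ofSeries_apply, coord_def, comp_mk, ext_iff_eventuallyEq] at h
    filter_upwards [(continuous_norm.isOpen_preimage _ isOpen_Iio).mem_nhds h0, hb'] with x hx hbx
    rw [(hT j).2 x (le_of_lt hx)]
    simp only [hbx]
    rfl
  have he' : (⟨φ.1, conv_mono hle φ.2⟩ : conv n ρ') =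
      ∑ j, ⟨T j, (hT j).1⟩ * ⟨boxMon n N j, boxMon_mem_conv j⟩ +
      ∑ k, ⟨w k, hw k⟩ * ⟨(g k).1, conv_mono hle (g k).2⟩ := Subtype.ext (by simpa using he)
  have h1 := congrArg (ofSeries₀ hρ') he'
  simp only [map_add, map_sum, map_mul, ← hT'] at h1
  have h2 : ofSeries₀ hρ φ = ofSeries₀ hρ' ⟨φ.1, conv_mono hle φ.2⟩ := by
    rw [ofSeries_apply, ofSeries_apply]
  rw [h2, h1]
  have h3 : ∀ j, ofSeries₀ hρ' ⟨boxMon n N j, boxMon_mem_conv j⟩ =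
      ofSeries₀ hρ ⟨boxMon n N j, boxMon_mem_conv j⟩ := fun j => by
    rw [ofSeries_apply, ofSeries_apply]
  have h4 : ∀ k, ofSeries₀ hρ' ⟨(g k).1, conv_mono hle (g k).2⟩ = G k := fun k => by
    rw [← hg k, ofSeries_apply, ofSeries_apply]
  simp only [h3, h4, add_sub_cancel_left]
  exact Ideal.sum_mem _ fun k _ => Ideal.mul_mem_left _ _ (Ideal.subset_span ⟨k, rfl⟩)

/-! ### Finiteness over fewer variables and the Noetherian property -/

variable {n d : ℕ}

theorem ofSeries₀_boxMon {ρ : ℝ≥0} (hρ : 0 < ρ) {N : ℕ} (j : Fin n → Fin N) :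
    ofSeries₀ hρ ⟨boxMon n N j, boxMon_mem_conv j⟩ = ∏ i, coord i ^ (j i : ℕ) := by
  simp only [← ofSeries₀_X hρ, ← map_pow, ← map_prod]
  congr 1
  exact Subtype.ext (by simp [boxMon])

/-- The finiteness theorem: `𝒪_n / I` is finite over `𝒪_d` via a map `a` when the fibre over the
origin is concentrated at the origin. -/
theorem finite_mk_comp {κ : Type*} [Finite κ] (G : κ → holomorphicGerms n 0)
    {a : (Fin n → ℂ) → Fin d → ℂ} (ha : AnalyticAt ℂ a 0) (ha0 : a 0 = 0) {N : ℕ}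
    (hN : ∀ i, coord i ^ N ∈ Ideal.span (Set.range G) ⊔
      Ideal.span (Set.range fun l => comp a ha ha0 (coord l))) :
    ((Ideal.Quotient.mk (Ideal.span (Set.range G))).comp (comp a ha ha0)).Finite := by
  let := ((Ideal.Quotient.mk (Ideal.span (Set.range G))).comp (comp a ha ha0)).toAlgebra
  let e : (Fin n → Fin N) → holomorphicGerms n 0 ⧸ Ideal.span (Set.range G) :=
    fun j => Ideal.Quotient.mk _ (∏ i, coord i ^ (j i : ℕ))
  refine ⟨Submodule.fg_def.2 ⟨Set.range e, Set.finite_range e, ?_⟩⟩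
  rw [eq_top_iff]
  rintro y -
  obtain ⟨γ, rfl⟩ := Ideal.Quotient.mk_surjective y
  obtain ⟨ρ, hρ, hγ, h⟩ := ((eventually_mem_nhdsWithin (a := (0 : ℝ≥0)) (s := Set.Ioi 0)).and
    ((eventually_exists_ofSeries₀_eq γ).and (weierstrass_division G ha ha0 hN))).exists
  have hρ : 0 < ρ := hρ
  obtain ⟨φ, rfl⟩ := hγ hρ
  obtain ⟨σ, hσ, hdiv⟩ := h hρ
  obtain ⟨Ω, hΩ⟩ := hdiv φ
  rw [Ideal.Quotient.eq.2 hΩ, map_sum]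
  refine Submodule.sum_mem _ fun j _ => ?_
  rw [map_mul, ofSeries₀_boxMon]
  exact Submodule.smul_mem _ (ofSeries₀ hσ (Ω j)) (Submodule.subset_span ⟨j, rfl⟩)

theorem sum_mk {ι : Type*} {p : Fin n → ℂ} (s : Finset ι) {f : ι → (Fin n → ℂ) → ℂ}
    (hf : ∀ i, AnalyticAt ℂ (f i) p) :
    ∑ i ∈ s, mk (f i) (hf i) =
      mk (fun x => ∑ i ∈ s, f i x) (s.analyticAt_fun_sum fun i _ => hf i) := by
  classical
  induction s using Finset.induction_on with
  | empty => rfl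
  | insert i s hi ih =>
    rw [Finset.sum_insert hi, ih]
    simp only [Finset.sum_insert hi]
    rfl

theorem mk_mul_mk {p : Fin n → ℂ} {f g : (Fin n → ℂ) → ℂ} (hf : AnalyticAt ℂ f p)
    (hg : AnalyticAt ℂ g p) : mk f hf * mk g hg = mk (fun x => f x * g x) (hf.mul hg) := rfl

theorem analyticAt_line {f : (Fin n → ℂ) → ℂ} (hf : AnalyticAt ℂ f 0) (v : Fin n → ℂ) :
    AnalyticAt ℂ (fun t : ℂ => f (t • v)) 0 :=
  AnalyticAt.comp (g := f) (f := fun t : ℂ => t • v) (by simpa using hf) (by fun_prop)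

/-- Take `v` in the polydisc of convergence with `f v ≠ 0`. If the restriction to the line vanished
near `0`, the identity theorem on the convex set of `t` with `t • v` in the ball would give `f v =
0` at `t = 1`. -/
theorem exists_line_order_ne_top {f : (Fin n → ℂ) → ℂ} (hf : AnalyticAt ℂ f 0)
    (h0 : mk f hf ≠ 0) : ∃ v : Fin n → ℂ, analyticOrderAt (fun t : ℂ => f (t • v)) 0 ≠ ⊤ := by
  obtain ⟨r, hr, φ, hφ, he⟩ := exists_ev_eq hf
  have hb : Metric.ball (0 : Fin n → ℂ) r ∈ 𝓝 0 := Metric.ball_mem_nhds _ (by exact_mod_cast hr)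
  have hfr : ∃ᶠ x in 𝓝 0, f x ≠ 0 := fun h => h0 
    ((ext_iff_eventuallyEq (hh := analyticAt_const)).2 (by simpa [EventuallyEq] using h))
  obtain ⟨v, hv, hvb⟩ := (hfr.and_eventually hb).exists
  have hon : ∀ x ∈ Metric.ball (0 : Fin n → ℂ) r, AnalyticAt ℂ f x := fun x hx => by
    have hx' : ‖x‖ < r := by simpa using hx
    refine (analyticAt_ev hφ hx').congr ?_
    filter_upwards [Metric.isOpen_ball.mem_nhds hx] with z hz
    exact he z (by simpa using (Metric.mem_ball.1 hz).le)
  refine ⟨v, fun htop => hv ?_⟩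
  rw [analyticOrderAt_eq_top] at htop
  let U : Set ℂ := {t | t • v ∈ Metric.ball (0 : Fin n → ℂ) r}
  have hU : IsPreconnected U := ((convex_ball (0 : Fin n → ℂ) (r : ℝ)).is_linear_preimage
    (f := fun t : ℂ => t • v) ⟨fun a b => add_smul a b v, fun c a => by simp [mul_smul]⟩).isPreconnected
  have han : AnalyticOnNhd ℂ (fun t : ℂ => f (t • v)) U := fun t ht =>
    AnalyticAt.comp (g := f) (f := fun t : ℂ => t • v) (hon _ ht) (by fun_prop)
  have := han.eqOn_zero_of_preconnected_of_eventuallyEq_zero hU (z₀ := 0)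
    (by simp [U, hr]) htop (show (1 : ℂ) ∈ U by simpa [U] using hvb)
  simpa using this

/-- Linear equations of the line spanned by a vector with coordinates proportional to `μ`. -/
noncomputable def lineEqn (i₀ : Fin (n + 1)) (μ : Fin (n + 1) → ℂ) :
    (Fin (n + 1) → ℂ) → Fin n → ℂ :=
  fun x l => x (i₀.succAbove l) - μ (i₀.succAbove l) * x i₀

theorem analyticAt_lineEqn (i₀ : Fin (n + 1)) (μ : Fin (n + 1) → ℂ) :
    AnalyticAt ℂ (lineEqn i₀ μ) 0 := by
  rw [analyticAt_pi_iff]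
  exact fun l => (analyticAt_coord _).sub (analyticAt_const.mul (analyticAt_coord _))

theorem lineEqn_zero (i₀ : Fin (n + 1)) (μ : Fin (n + 1) → ℂ) : lineEqn i₀ μ 0 = 0 := by
  ext l; simp [lineEqn]

/-- The ideal of a line. -/
noncomputable def lineIdeal (i₀ : Fin (n + 1)) (μ : Fin (n + 1) → ℂ) :
    Ideal (holomorphicGerms (n + 1) 0) :=
  Ideal.span (Set.range fun l =>
    comp (lineEqn i₀ μ) (analyticAt_lineEqn i₀ μ) (lineEqn_zero i₀ μ) (coord l))

theorem coord_sub_mem_lineIdeal (i₀ : Fin (n + 1)) {μ : Fin (n + 1) → ℂ} (hμ : μ i₀ = 1)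
    (i : Fin (n + 1)) : coord i - const (μ i) * coord i₀ ∈ lineIdeal i₀ μ := by
  rcases eq_or_ne i i₀ with rfl | hi
  · simp [hμ]
  · obtain ⟨l, rfl⟩ := Fin.exists_succAbove_eq hi
    exact Ideal.subset_span ⟨l, rfl⟩

/-- Modulo the ideal of the line each coordinate is `μ i` times `coord i₀`. Hence `f = ∑ x_i q_i` is
congruent to `coord i₀ * f'` with `f' = ∑ μ i q_i`, whose order along the line is one less. -/
theorem coord_pow_mem_of_order (i₀ : Fin (n + 1)) {μ : Fin (n + 1) → ℂ} (hμ : μ i₀ = 1) (N : ℕ)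
    {f : (Fin (n + 1) → ℂ) → ℂ} (hf : AnalyticAt ℂ f 0)
    (hN : analyticOrderAt (fun t : ℂ => f (t • μ)) 0 = N) :
    coord i₀ ^ N ∈ Ideal.span {mk f hf} ⊔ lineIdeal i₀ μ := by
  have hline : AnalyticAt ℂ (fun t : ℂ => t • μ) 0 := by fun_prop
  induction N generalizing f with
  | zero =>
    have h0 : f 0 ≠ 0 := by
      have := (analyticAt_line hf μ).analyticOrderAt_eq_zero.1 (by simpa using hN)
      simpa using this
    have : Ideal.span {mk f hf} = ⊤ := Ideal.span_singleton_eq_top.2 (isUnit_mk f hf h0)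
    simp [this]
  | succ N ih =>
    have h0 : f 0 = 0 := by
      by_contra h
      have := (analyticAt_line hf μ).analyticOrderAt_eq_zero.2 (by simpa using h)
      have h2 := this.symm.trans hN
      norm_cast at h2
    obtain ⟨q, hq⟩ := exists_eq_const_add_sum (mk f hf)
    rw [value_mk, h0, map_zero, zero_add] at hq
    obtain ⟨f', hf', hmk⟩ := exists_mk_eq (∑ i, const (μ i) * q i)
    have hdiff : mk f hf - coord i₀ * mk f' hf' ∈ lineIdeal i₀ μ := by
      rw [hq, hmk, Finset.mul_sum, ← Finset.sum_sub_distrib]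
      refine Ideal.sum_mem _ fun i _ => ?_
      have : coord i * q i - coord i₀ * (const (μ i) * q i) =
        (coord i - const (μ i) * coord i₀) * q i := by ring
      rw [this]
      exact Ideal.mul_mem_right _ _ (coord_sub_mem_lineIdeal i₀ hμ i)
    choose q' hq' hqq using fun i => exists_mk_eq (q i)
    have e1 : f =ᶠ[𝓝 0] fun x => ∑ i, x i * q' i x := by
      simp only [← hqq, coord_def, mk_mul_mk, sum_mk] at hq
      exact ext_iff_eventuallyEq.1 hq
    have e2 : f' =ᶠ[𝓝 0] fun x => ∑ i, μ i * q' i x := by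
      simp only [← hqq, const_apply, mk_mul_mk, sum_mk] at hmk
      exact ext_iff_eventuallyEq.1 hmk
    have e3 : (fun t : ℂ => f (t • μ)) =ᶠ[𝓝 0] (fun t => t) * fun t => f' (t • μ) := by
      have ht : Tendsto (fun t : ℂ => t • μ) (𝓝 0) (𝓝 0) := by
        simpa using hline.continuousAt.tendsto
      filter_upwards [ht.eventually e1, ht.eventually e2] with t h1 h2
      simp only [Pi.mul_apply]
      rw [h1, h2, Finset.mul_sum]
      exact Finset.sum_congr rfl fun i _ => by simp; ring
    have hN' : analyticOrderAt (fun t : ℂ => f' (t • μ)) 0 = N := by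
      rw [analyticOrderAt_congr e3, analyticOrderAt_mul (f := fun t => t) analyticAt_id
        (analyticAt_line hf' μ)] at hN
      have hid : analyticOrderAt (fun t : ℂ => t) 0 = 1 := by
        exact analyticOrderAt_id
      rw [hid, Nat.cast_add, Nat.cast_one, add_comm] at hN
      exact ENat.add_left_injective_of_ne_top ENat.one_ne_top hN
    have h3 := ih hf' hN'
    obtain ⟨y, hy, z, hz, hyz⟩ := Submodule.mem_sup.1 h3
    obtain ⟨c, rfl⟩ := Ideal.mem_span_singleton'.1 hy
    have : coord i₀ ^ (N + 1) = c * mk f hf +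
        (coord i₀ * z - c * (mk f hf - coord i₀ * mk f' hf')) := by
      rw [pow_succ', ← hyz]; ring
    rw [this]
    exact Submodule.add_mem_sup (Ideal.mul_mem_left _ _ (Ideal.mem_span_singleton_self _))
      (sub_mem (Ideal.mul_mem_left _ _ hz) (Ideal.mul_mem_left _ _ hdiff))

/-- A nonzero germ `g` in `n + 1` variables makes `𝒪_{n+1} / (g)` finite over `𝒪_n`. -/
theorem exists_finite_quotient_span_singleton {g : holomorphicGerms (n + 1) 0} (hg : g ≠ 0) :
    ∃ f : holomorphicGerms n 0 →+* holomorphicGerms (n + 1) 0,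
      ((Ideal.Quotient.mk (Ideal.span {g})).comp f).Finite := by
  obtain ⟨f, hf, rfl⟩ := exists_mk_eq g
  obtain ⟨v, hv⟩ := exists_line_order_ne_top hf hg
  obtain ⟨μ, i₀, hμ, hμv⟩ : ∃ (μ : Fin (n + 1) → ℂ) (i₀ : Fin (n + 1)), μ i₀ = 1 ∧
      analyticOrderAt (fun t : ℂ => f (t • μ)) 0 ≠ ⊤ := by
    by_cases h0 : v = 0
    · subst h0
      have hf0 : f 0 ≠ 0 := fun h => hv (by simp [analyticOrderAt_eq_top, h])
      refine ⟨1, 0, rfl, ?_⟩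
      rw [(analyticAt_line hf 1).analyticOrderAt_eq_zero.2 (by simpa using hf0)]
      exact ENat.zero_ne_top
    -- Rescaling `v` to make one coordinate equal to `1` keeps the order along the line finite.
    · obtain ⟨i₀, hi⟩ := Function.ne_iff.1 h0
      have hi : v i₀ ≠ 0 := hi
      refine ⟨(v i₀)⁻¹ • v, i₀, by simp [hi], fun h => hv ?_⟩
      rw [analyticOrderAt_eq_top] at h ⊢
      have ht : Tendsto (fun t : ℂ => t * v i₀) (𝓝 0) (𝓝 0) := by
        have : ContinuousAt (fun t : ℂ => t * v i₀) 0 := by fun_prop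
        simpa [ContinuousAt] using this
      filter_upwards [ht.eventually h] with t ht
      simpa [smul_smul, mul_assoc, hi] using ht
  obtain ⟨N, hN⟩ := ENat.ne_top_iff_exists.1 hμv
  refine ⟨comp (lineEqn i₀ μ) (analyticAt_lineEqn i₀ μ) (lineEqn_zero i₀ μ), ?_⟩
  have key := finite_mk_comp (fun _ : Unit => mk f hf) (analyticAt_lineEqn i₀ μ)
    (lineEqn_zero i₀ μ) (N := N) fun i => ?_
  · rwa [Set.range_const] at key
  · rw [Set.range_const]
    have h1 := coord_pow_mem_of_order i₀ hμ N hf hN.symm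
    have h2 : coord i ^ N - (const (μ i) * coord i₀) ^ N ∈ lineIdeal i₀ μ :=
      Ideal.mem_of_dvd _ (sub_dvd_pow_sub_pow _ _ N) (coord_sub_mem_lineIdeal i₀ hμ i)
    have h3 : (coord i : holomorphicGerms (n + 1) 0) ^ N = const (μ i) ^ N * coord i₀ ^ N +
        (coord i ^ N - (const (μ i) * coord i₀) ^ N) := by ring
    rw [h3]
    exact add_mem (Ideal.mul_mem_left _ _ h1) (Ideal.mem_sup_right h2)

/-- **Rückert's basis theorem**: the ring of holomorphic germs is Noetherian. -/
instance isNoetherianRing (n : ℕ) : IsNoetherianRing (holomorphicGerms n 0) := by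
  induction n with
  | zero =>
    refine ⟨fun I => ?_⟩
    rcases eq_or_ne I ⊥ with rfl | hI
    · exact Submodule.fg_bot
    · obtain ⟨g, hg, hg0⟩ := Submodule.exists_mem_ne_zero_of_ne_bot hI
      have : IsUnit g := by
        rw [isUnit_iff_value_ne_zero]
        intro h
        obtain ⟨q, hq⟩ := exists_eq_const_add_sum g
        exact hg0 (by rw [hq, h]; simp)
      rw [Ideal.eq_top_of_isUnit_mem I hg this]
      exact ⟨{1}, by simp⟩
  | succ n ih =>
    refine ⟨fun I => ?_⟩
    rcases eq_or_ne I ⊥ with rfl | hI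
    · exact Submodule.fg_bot
    · obtain ⟨g, hg, hg0⟩ := Submodule.exists_mem_ne_zero_of_ne_bot hI
      obtain ⟨f, hf⟩ := exists_finite_quotient_span_singleton hg0
      let := f.toAlgebra
      let := ((Ideal.Quotient.mk (Ideal.span {g})).comp f).toAlgebra
      have : IsScalarTower (holomorphicGerms n 0) (holomorphicGerms (n + 1) 0)
        (holomorphicGerms (n + 1) 0 ⧸ Ideal.span {g}) := IsScalarTower.of_algebraMap_eq' rfl
      have : Module.Finite (holomorphicGerms n 0) (holomorphicGerms (n + 1) 0 ⧸ Ideal.span {g}) :=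
        hf
      have h1 : IsNoetherian (holomorphicGerms n 0)
        (holomorphicGerms (n + 1) 0 ⧸ Ideal.span {g}) := isNoetherian_of_isNoetherianRing_of_finite _ _
      have h2 : IsNoetherian (holomorphicGerms (n + 1) 0)
        (holomorphicGerms (n + 1) 0 ⧸ Ideal.span {g}) := isNoetherian_of_tower (holomorphicGerms n 0) h1
      -- The ideal is an extension of its image in the Noetherian module `𝒪_{n+1} / (g)` by the
      -- principal ideal `(g)`.
      refine Submodule.fg_of_fg_map_of_fg_inf_ker (Ideal.span {g}).mkQ (h2.noetherian _) ?_
      rw [Submodule.ker_mkQ, inf_eq_right.2]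
      · exact Submodule.fg_span_singleton g
      · rw [Ideal.span_singleton_le_iff_mem]
        exact hg

end holomorphicGerms

open scoped ENNReal NNReal

/-! ### Taylor expansions at points of a polydisc -/

namespace MvPowerSeries

variable {n : ℕ} {ρ : ℝ≥0}

/-- The coordinate functions, as elements of `conv n ρ`. -/
noncomputable def convX (n : ℕ) (ρ : ℝ≥0) (i : Fin n) : conv n ρ := ⟨X i, X_mem_conv i⟩

/-- The ideal of `conv n ρ` generated by the functions `x i - p i`. -/
noncomputable def pointIdeal (ρ : ℝ≥0) (p : Fin n → ℂ) : Ideal (conv n ρ) :=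
  Ideal.span (Set.range fun i => convX n ρ i - algebraMap ℂ _ (p i))

theorem evHom_convX {x : Fin n → ℂ} (hx : ‖x‖ ≤ ρ) (i : Fin n) :
    evHom x hx (convX n ρ i) = x i := ev_X i

theorem exists_eq_algebraMap_add_sum {p : Fin n → ℂ} (hp : ‖p‖ < ρ) (h : conv n ρ) :
    ∃ q : Fin n → conv n ρ, h = algebraMap ℂ _ (ev p h.1) +
      ∑ i, (convX n ρ i - algebraMap ℂ _ (p i)) * q i := by
  obtain ⟨K, hK⟩ := exists_eq_C_add_sum (n := n) (r := ‖p‖₊) (ρ := ρ) (by exact_mod_cast hp)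
  obtain ⟨q, hq, he⟩ := hK p le_rfl h.1 h.2
  have hqm : ∀ i, q i ∈ conv n ρ := fun i =>
    ne_top_of_le_ne_top (ENNReal.mul_ne_top ENNReal.coe_ne_top h.2) (hq i)
  refine ⟨fun i => ⟨q i, hqm i⟩, Subtype.ext ?_⟩
  rw [he]
  simp [convX, MvPowerSeries.algebraMap_apply, ← he]

/-- The polynomial functions in `x - p`. -/
noncomputable def polyAt (ρ : ℝ≥0) (p : Fin n → ℂ) : MvPolynomial (Fin n) ℂ →ₐ[ℂ] conv n ρ :=
  MvPolynomial.aeval fun i => convX n ρ i - algebraMap ℂ _ (p i)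

theorem ev_polyAt {p x : Fin n → ℂ} (hx : ‖x‖ ≤ ρ) (P : MvPolynomial (Fin n) ℂ) :
    ev x (polyAt ρ p P).1 = MvPolynomial.eval (x - p) P := by
  have h : (evHom x hx).comp (polyAt ρ p) = MvPolynomial.aeval (x - p) := by
    ext i
    simp [polyAt, evHom_convX]
  exact DFunLike.congr_fun h P

/-- **Taylor expansion** at a point of the polydisc, in algebraic form. -/
theorem exists_sub_polyAt_mem {p : Fin n → ℂ} (hp : ‖p‖ < ρ) (M : ℕ) (h : conv n ρ) :
    ∃ P : MvPolynomial (Fin n) ℂ, P.totalDegree ≤ M ∧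
      h - polyAt ρ p P ∈ pointIdeal ρ p ^ (M + 1) := by
  induction M generalizing h with
  | zero =>
    obtain ⟨q, hq⟩ := exists_eq_algebraMap_add_sum hp h
    refine ⟨MvPolynomial.C (ev p h.1), by simp, ?_⟩
    rw [← MvPolynomial.algebraMap_eq, AlgHom.commutes, zero_add, pow_one]
    nth_rw 1 [hq]
    rw [add_sub_cancel_left]
    exact Ideal.sum_mem _ fun i _ => Ideal.mul_mem_right _ _ (Ideal.subset_span ⟨i, rfl⟩)
  | succ M ih =>
    obtain ⟨q, hq⟩ := exists_eq_algebraMap_add_sum hp h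
    choose P hP hPq using fun i => ih (q i)
    refine ⟨MvPolynomial.C (ev p h.1) + ∑ i, MvPolynomial.X i * P i, ?_, ?_⟩
    · refine (MvPolynomial.totalDegree_add _ _).trans (max_le (by simp) ?_)
      refine MvPolynomial.totalDegree_finsetSum_le fun i _ => ?_
      refine (MvPolynomial.totalDegree_mul _ _).trans ?_
      rw [MvPolynomial.totalDegree_X]
      have := hP i
      omega
    · rw [map_add, map_sum, ← MvPolynomial.algebraMap_eq, AlgHom.commutes]
      nth_rw 1 [hq]
      rw [add_sub_add_left_eq_sub, ← Finset.sum_sub_distrib]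
      refine Ideal.sum_mem _ fun i _ => ?_
      rw [map_mul, polyAt, MvPolynomial.aeval_X, ← mul_sub, pow_succ']
      exact Ideal.mul_mem_mul (Ideal.subset_span ⟨i, rfl⟩) (hPq i)

theorem isBigO_ev_of_mem_pointIdeal_pow {p : Fin n → ℂ} (hp : ‖p‖ < ρ) (M : ℕ) {h : conv n ρ}
    (hh : h ∈ pointIdeal ρ p ^ M) :
    (fun x => ev x h.1) =O[𝓝 p] fun x => ‖x - p‖ ^ M := by
  have hnear : ∀ᶠ x in 𝓝 p, ‖x‖ ≤ ρ := by
    filter_upwards [(continuous_norm.isOpen_preimage _ isOpen_Iio).mem_nhds hp] with x hx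
    exact le_of_lt hx
  have hbdd : ∀ f : conv n ρ, (fun x => ev x f.1) =O[𝓝 p] fun _ => (1 : ℝ) := fun f =>
    (analyticAt_ev f.2 hp).continuousAt.isBigO_one ℝ
  have hadd : ∀ (k : ℕ) (f g : conv n ρ), (fun x => ev x f.1) =O[𝓝 p] (fun x => ‖x - p‖ ^ k) →
      (fun x => ev x g.1) =O[𝓝 p] (fun x => ‖x - p‖ ^ k) →
      (fun x => ev x (f + g).1) =O[𝓝 p] (fun x => ‖x - p‖ ^ k) := fun k f g hf hg => by
    refine (hf.add hg).congr' ?_ EventuallyEq.rfl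
    filter_upwards [hnear] with x hx
    exact ((evHom x hx).map_add f g).symm
  have hmul : ∀ (f g : conv n ρ) {u v : (Fin n → ℂ) → ℝ}, (fun x => ev x f.1) =O[𝓝 p] u →
      (fun x => ev x g.1) =O[𝓝 p] v → (fun x => ev x (f * g).1) =O[𝓝 p] (fun x => u x * v x) :=
    fun f g u v hf hg => by
    refine (hf.mul hg).congr' ?_ EventuallyEq.rfl
    filter_upwards [hnear] with x hx
    exact ((evHom x hx).map_mul f g).symm
  induction M generalizing h with
  | zero => simpa using hbdd h
  | succ M ih =>
    rw [pow_succ] at hh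
    refine Submodule.mul_induction_on hh (fun f hf g hg => ?_) fun f g hf hg => hadd _ f g hf hg
    have hg' : (fun x => ev x g.1) =O[𝓝 p] fun x => ‖x - p‖ ^ 1 := by
      refine Submodule.span_induction (fun y hy => ?_) ?_ (fun f g _ _ hf hg => hadd 1 f g hf hg)
        (fun c f _ hf => ?_) hg
      · obtain ⟨i, rfl⟩ := hy
        refine Asymptotics.IsBigO.of_bound 1 ?_
        filter_upwards [hnear] with x hx
        have : ev x (convX n ρ i - algebraMap ℂ _ (p i) : conv n ρ).1 = x i - p i := by
          have := map_sub (evHom x hx) (convX n ρ i) (algebraMap ℂ _ (p i))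
          rw [evHom_convX, AlgHom.commutes] at this
          exact this
        rw [this, one_mul, pow_one, norm_norm]
        exact norm_le_pi_norm (x - p) i
      · refine (Asymptotics.isBigO_zero _ _).congr' ?_ EventuallyEq.rfl
        filter_upwards [hnear] with x hx
        exact ((evHom x hx).map_zero).symm
      · simpa using hmul c f (hbdd c) hf
    simpa [pow_succ] using hmul f g (ih hf) hg'

end MvPowerSeries

theorem Polynomial.X_pow_dvd_of_isBigO {Q : Polynomial ℂ} {m : ℕ}
    (h : (fun s => Q.eval s) =O[𝓝 0] fun s : ℂ => s ^ m) : Polynomial.X ^ m ∣ Q := by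
  induction m with
  | zero => simp
  | succ m ih =>
    obtain ⟨R, rfl⟩ := ih (h.trans (Asymptotics.IsBigO.of_bound 1 (by
      filter_upwards [Metric.ball_mem_nhds (0 : ℂ) one_pos] with s hs
      rw [mem_ball_zero_iff] at hs
      rw [pow_succ, norm_mul, one_mul]
      exact mul_le_of_le_one_right (norm_nonneg _) hs.le)))
    have hR : (fun s => R.eval s) =O[𝓝[≠] 0] fun s : ℂ => s := by
      obtain ⟨c, hc⟩ := (h.mono (nhdsWithin_le_nhds (s := {0}ᶜ))).bound
      refine Asymptotics.IsBigO.of_bound c ?_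
      filter_upwards [hc, self_mem_nhdsWithin] with s hs hs0
      have hs0 : (0 : ℝ) < ‖s‖ ^ m := by
        have : s ≠ 0 := hs0
        positivity
      rw [Polynomial.eval_mul, Polynomial.eval_pow, Polynomial.eval_X, norm_mul, pow_succ, norm_mul,
        norm_pow] at hs
      refine le_of_mul_le_mul_left ?_ hs0
      linarith
    have hR0 : R.eval 0 = 0 := by
      have h1 : Tendsto (fun s : ℂ => R.eval s) (𝓝[≠] 0) (𝓝 0) :=
        hR.trans_tendsto (tendsto_id.mono_left nhdsWithin_le_nhds)
      have h2 : Tendsto (fun s : ℂ => R.eval s) (𝓝[≠] 0) (𝓝 (R.eval 0)) :=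
        (R.continuous.tendsto 0).mono_left nhdsWithin_le_nhds
      exact tendsto_nhds_unique h2 h1
    obtain ⟨S, rfl⟩ := Polynomial.X_dvd_iff.2 ((Polynomial.coeff_zero_eq_eval_zero R).trans hR0)
    exact ⟨S, by rw [pow_succ, mul_assoc]⟩

/-- On each line through `p` the polynomial has degree at most `M` and is divisible by the power `M
+ 1` of the parameter, so it vanishes. -/
theorem MvPolynomial.eq_zero_of_isBigO {n M : ℕ} {p : Fin n → ℂ} {P : MvPolynomial (Fin n) ℂ}
    (hP : P.totalDegree ≤ M)
    (h : (fun x => MvPolynomial.eval (x - p) P) =O[𝓝 p] fun x => ‖x - p‖ ^ (M + 1)) : P = 0 := by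
  refine MvPolynomial.funext fun y => ?_
  rw [map_zero]
  let Q : Polynomial ℂ := MvPolynomial.aeval (fun i => Polynomial.C (y i) * Polynomial.X) P
  have hQ : ∀ s, Q.eval s = MvPolynomial.eval (s • y) P := fun s => by
    have h1 : (Polynomial.aeval s).comp (MvPolynomial.aeval fun i =>
        Polynomial.C (y i) * Polynomial.X) = MvPolynomial.aeval (s • y) := by
      refine MvPolynomial.algHom_ext fun i => ?_
      rw [AlgHom.comp_apply, MvPolynomial.aeval_X, map_mul, Polynomial.aeval_C, Polynomial.aeval_X,
        MvPolynomial.aeval_X, mul_comm]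
      rfl
    have h2 := DFunLike.congr_fun h1 P
    rw [AlgHom.comp_apply, Polynomial.coe_aeval_eq_eval, MvPolynomial.aeval_eq_eval] at h2
    exact h2
  have hdeg : Q.natDegree ≤ M := by
    have := MvPolynomial.aeval_natDegree_le (m := M) P hP
      (fun i => Polynomial.C (y i) * Polynomial.X) (n := 1) fun i => by
        exact (Polynomial.natDegree_C_mul_le _ _).trans Polynomial.natDegree_X_le
    simpa using this
  have hQO : (fun s => Q.eval s) =O[𝓝 0] fun s : ℂ => s ^ (M + 1) := by
    have ht : Tendsto (fun s : ℂ => p + s • y) (𝓝 0) (𝓝 p) := by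
      have : ContinuousAt (fun s : ℂ => p + s • y) 0 := by fun_prop
      simpa [ContinuousAt] using this
    have h1 := h.comp_tendsto ht
    have h2 : (fun s => Q.eval s) = (fun x => MvPolynomial.eval (x - p) P) ∘
        fun s : ℂ => p + s • y := by
      funext s
      simp [hQ]
    rw [h2]
    refine h1.trans (Asymptotics.IsBigO.of_bound (‖y‖ ^ (M + 1)) (Eventually.of_forall fun s => ?_))
    simp only [Function.comp_apply, add_sub_cancel_left, norm_smul, mul_pow, norm_mul, norm_pow,
      norm_norm]
    rw [mul_comm]
  have hQ0 : Q = 0 := Polynomial.eq_zero_of_dvd_of_natDegree_lt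
    (Polynomial.X_pow_dvd_of_isBigO hQO) (by rw [Polynomial.natDegree_X_pow]; omega)
  have := hQ 1
  rw [hQ0, one_smul] at this
  simpa using this.symm

namespace MvPowerSeries

variable {n : ℕ} {ρ : ℝ≥0}

/-- The Taylor polynomial of degree at most `M` differs from `h` by an element of the desired ideal
power. It is therefore itself of order `M + 1`, hence zero. -/
theorem mem_pointIdeal_pow_of_isBigO {p : Fin n → ℂ} (hp : ‖p‖ < ρ) {M : ℕ} {h : conv n ρ}
    (hh : (fun x => ev x h.1) =O[𝓝 p] fun x => ‖x - p‖ ^ (M + 1)) :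
    h ∈ pointIdeal ρ p ^ (M + 1) := by
  obtain ⟨P, hP, hmem⟩ := exists_sub_polyAt_mem hp M h
  have hnear : ∀ᶠ x in 𝓝 p, ‖x‖ ≤ ρ := by
    filter_upwards [(continuous_norm.isOpen_preimage _ isOpen_Iio).mem_nhds hp] with x hx
    exact le_of_lt hx
  have h1 := isBigO_ev_of_mem_pointIdeal_pow hp _ hmem
  have h2 : (fun x => MvPolynomial.eval (x - p) P) =O[𝓝 p] fun x => ‖x - p‖ ^ (M + 1) := by
    refine (hh.sub h1).congr' ?_ EventuallyEq.rfl
    filter_upwards [hnear] with x hx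
    have h3 := (evHom x hx).map_sub h (polyAt ρ p P)
    have h4 : ev x (h - polyAt ρ p P).1 = ev x h.1 - ev x (polyAt ρ p P).1 := h3
    rw [h4, ev_polyAt hx]
    ring
  have h0 := MvPolynomial.eq_zero_of_isBigO hP h2
  rwa [h0, map_zero, sub_zero] at hmem

theorem exists_taylor_isBigO {p : Fin n → ℂ} {u : (Fin n → ℂ) → ℂ} (hu : AnalyticAt ℂ u p) (M : ℕ) :
    ∃ P : MvPolynomial (Fin n) ℂ,
      (fun x => u x - MvPolynomial.eval (x - p) P) =O[𝓝 p] fun x => ‖x - p‖ ^ M := by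
  have hu' : AnalyticAt ℂ (fun x => u (p + x)) 0 :=
    AnalyticAt.comp (g := u) (f := fun x => p + x) (by simpa using hu) (by fun_prop)
  obtain ⟨ρ, hρ, φ, hφ, he⟩ := exists_ev_eq hu'
  have h0 : ‖(0 : Fin n → ℂ)‖ < ρ := by simpa using hρ
  obtain ⟨P, -, hmem⟩ := exists_sub_polyAt_mem h0 M ⟨φ, hφ⟩
  refine ⟨P, ?_⟩
  have h1 := isBigO_ev_of_mem_pointIdeal_pow h0 _ (Ideal.pow_le_pow_right (Nat.le_succ M) hmem)
  have ht : Tendsto (fun x => x - p) (𝓝 p) (𝓝 0) := by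
    have : ContinuousAt (fun x => x - p) p := by fun_prop
    simpa [ContinuousAt] using this
  have hnear : ∀ᶠ x in 𝓝 (0 : Fin n → ℂ), ‖x‖ ≤ ρ := by
    filter_upwards [(continuous_norm.isOpen_preimage _ isOpen_Iio).mem_nhds h0] with x hx
    exact le_of_lt hx
  refine (h1.comp_tendsto ht).congr' ?_ (Eventually.of_forall fun x => by simp)
  filter_upwards [ht.eventually hnear] with x hx
  have h3 := (evHom (x - p) hx).map_sub ⟨φ, hφ⟩ (polyAt ρ 0 P)
  have h4 : ev (x - p) ((⟨φ, hφ⟩ : conv n ρ) - polyAt ρ 0 P).1 =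
    ev (x - p) φ - ev (x - p) (polyAt ρ 0 P).1 := h3
  rw [Function.comp_apply, h4, ev_polyAt hx, he _ hx]
  simp

/-- The inverse is minus the geometric series `∑ x_i^k / c^(k+1)`, convergent for `ρ < ‖c‖`. This
confines the points attached to maximal ideals to the closed polydisc. -/
theorem isUnit_convX_sub (hρ : 0 < ρ) {i : Fin n} {c : ℂ} (hc : (ρ : ℝ) < ‖c‖) :
    IsUnit (convX n ρ i - algebraMap ℂ _ c) := by
  have hc0 : c ≠ 0 := norm_pos_iff.1 (ρ.2.trans_lt hc)
  have hcρ : (ρ : ℝ≥0∞) * ‖c⁻¹‖ₑ < 1 := by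
    rw [enorm_eq_nnnorm, ← ENNReal.coe_mul, ← ENNReal.coe_one, ENNReal.coe_lt_coe,
      ← NNReal.coe_lt_coe]
    push_cast
    rw [norm_inv, ← div_eq_mul_inv, div_lt_one (norm_pos_iff.2 hc0)]
    exact hc
  let f : ℕ → MvPowerSeries (Fin n) ℂ := fun k => C (c⁻¹ ^ (k + 1)) * X i ^ k
  have hf : ∀ k, nrm ρ (f k) ≤ ‖c⁻¹‖ₑ * (ρ * ‖c⁻¹‖ₑ) ^ k := fun k => by
    have h1 : f k = monomial (Finsupp.single i k) (c⁻¹ ^ (k + 1)) := by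
      change C (c⁻¹ ^ (k + 1)) * X i ^ k = _
      rw [X_pow_eq, ← monomial_zero_eq_C_apply, monomial_mul_monomial, zero_add, mul_one]
    rw [h1, nrm_monomial, Finsupp.degree_single, enorm_pow, pow_succ, mul_pow]
    exact le_of_eq (by ring)
  have hsum : ∑' k, nrm ρ (f k) ≠ ∞ := by
    refine ne_top_of_le_ne_top ?_ (ENNReal.tsum_le_tsum hf)
    rw [ENNReal.tsum_mul_left, ENNReal.tsum_geometric]
    refine ENNReal.mul_ne_top enorm_ne_top (ENNReal.inv_ne_top.2 ?_)
    exact (tsub_pos_of_lt hcρ).ne'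
  obtain ⟨S, hS⟩ := exists_coeffHasSum hρ hsum
  have hSm : S ∈ conv n ρ := ne_top_of_le_ne_top hsum hS.nrm_le
  have key : C c * S = X i * S + 1 := by
    refine MvPowerSeries.ext fun α => ?_
    have h1 := hS.mul_left (C c) α
    have h2 := hS.mul_left (X i) α
    have e2 : (fun k => coeff α (X i * f k)) = fun k => coeff α (C c * f (k + 1)) := by
      funext k
      congr 1
      simp only [f]
      rw [← mul_assoc (C c), ← map_mul C, pow_succ _ (k + 1), mul_comm c, mul_assoc, inv_mul_cancel₀ hc0,
        mul_one, pow_succ (X i)]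
      ring
    rw [e2] at h2
    have h3 := (hasSum_nat_add_iff (f := fun k => coeff α (C c * f k)) 1).1 h2
    rw [h1.unique h3, map_add]
    congr 1
    simp only [f, Finset.range_one, Finset.sum_singleton]
    rw [← mul_assoc, ← map_mul C, zero_add, pow_one, mul_inv_cancel₀ hc0]
    simp
  refine IsUnit.of_mul_eq_one (-⟨S, hSm⟩) (Subtype.ext ?_)
  change (X i - C c) * -S = 1
  linear_combination key

end MvPowerSeries

open scoped ENNReal NNReal

/-! ### Ideals of finite codimension and their points -/

namespace Ideal

variable {k A : Type*} [Field k] [CommRing A] [Algebra k A]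

theorem exists_sub_algebraMap_mem [IsAlgClosed k] (m : Ideal A) [m.IsMaximal]
    [Module.Finite k (A ⧸ m)] (x : A) : ∃ c : k, x - algebraMap k A c ∈ m := by
  let := Ideal.Quotient.field m
  have hb : Function.Bijective (algebraMap k (A ⧸ m)) :=
    IsAlgClosed.algebraMap_bijective_of_isIntegral
  obtain ⟨c, hc⟩ := hb.2 (Ideal.Quotient.mk m x)
  refine ⟨c, ?_⟩
  rw [← Ideal.Quotient.eq, ← hc]
  rfl

/-- If `a ∉ K`, let `m` be a maximal ideal containing the conductor `(K : a)`. In the Noetherian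
ring `A ⧸ K` the class of `a` lies in all powers of `m`, so Krull's intersection theorem gives `r ∈
m` with `r a - a ∈ K`. Then `r - 1` lies in the conductor, hence in `m`, which is absurd. -/
theorem mem_of_forall_isMaximal_of_finite (K : Ideal A) [Module.Finite k (A ⧸ K)] {a : A}
    (h : ∀ m : Ideal A, m.IsMaximal → K ≤ m → Module.Finite k (A ⧸ m) →
      ∀ M : ℕ, ∃ b ∈ K, a - b ∈ m ^ M) : a ∈ K := by
  by_contra ha
  let Kc : Ideal A := Submodule.comap (LinearMap.mulRight A a) K
  have hKc : ∀ r, r ∈ Kc ↔ r * a ∈ K := fun r => Iff.rfl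
  obtain ⟨m, hm, hle⟩ := Ideal.exists_le_maximal Kc fun h => ha (by
    simpa using (hKc 1).1 (h ▸ Submodule.mem_top))
  have hKm : K ≤ m := fun r hr => hle ((hKc r).2 (Ideal.mul_mem_right _ _ hr))
  have hfin : Module.Finite k (A ⧸ m) :=
    Module.Finite.of_surjective (Ideal.Quotient.factorₐ k hKm).toLinearMap
      (Ideal.Quotient.factor_surjective hKm)
  have : IsNoetherianRing (A ⧸ K) := IsNoetherianRing.of_finite k _
  have hα : Ideal.Quotient.mk K a ∈
      (⨅ M : ℕ, m.map (Ideal.Quotient.mk K) ^ M • ⊤ : Submodule (A ⧸ K) (A ⧸ K)) := by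
    rw [Submodule.mem_iInf]
    intro M
    obtain ⟨b, hb, hab⟩ := h m hm hKm hfin M
    have h3 : Ideal.Quotient.mk K a = Ideal.Quotient.mk K (a - b) := by
      rw [Ideal.Quotient.eq, sub_sub_cancel]
      exact hb
    rw [h3, smul_eq_mul, Ideal.mul_top, ← Ideal.map_pow]
    exact Ideal.mem_map_of_mem _ hab
  obtain ⟨⟨r, hr⟩, hrα⟩ := (Ideal.mem_iInf_smul_pow_eq_bot_iff _ _).1 hα
  obtain ⟨r, hrm, rfl⟩ := (Ideal.mem_map_iff_of_surjective _ Ideal.Quotient.mk_surjective).1 hr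
  have h4 : r * a - a ∈ K := by
    rw [← Ideal.Quotient.eq, map_mul]
    exact hrα
  have h5 : r - 1 ∈ m := hle ((hKc _).2 (by rwa [sub_mul, one_mul]))
  exact hm.ne_top ((Ideal.eq_top_iff_one _).2 (by simpa using Ideal.sub_mem _ hrm h5))

end Ideal

namespace MvPowerSeries

variable {n : ℕ} {ρ ρ' : ℝ≥0}

/-- Restriction of convergent power series to a smaller polydisc. -/
noncomputable def convIncl (h : ρ ≤ ρ') : conv n ρ' →ₐ[ℂ] conv n ρ :=
  Subalgebra.inclusion (conv_mono h)

theorem map_convIncl_pointIdeal_le (h : ρ ≤ ρ') (p : Fin n → ℂ) :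
    (pointIdeal ρ' p).map (convIncl h) ≤ pointIdeal ρ p := by
  rw [pointIdeal, Ideal.map_span, Ideal.span_le]
  rintro _ ⟨_, ⟨i, rfl⟩, rfl⟩
  exact Ideal.subset_span ⟨i, rfl⟩

theorem exists_point_of_isMaximal (hρ : 0 < ρ) (m : Ideal (conv n ρ)) [m.IsMaximal]
    [Module.Finite ℂ (conv n ρ ⧸ m)] :
    ∃ p : Fin n → ℂ, ‖p‖ ≤ ρ ∧ pointIdeal ρ p ≤ m := by
  choose p hmem using fun i => Ideal.exists_sub_algebraMap_mem m (k := ℂ) (convX n ρ i)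
  refine ⟨p, (pi_norm_le_iff_of_nonneg ρ.2).2 fun i => ?_, ?_⟩
  · by_contra! hlt
    exact Ideal.IsPrime.ne_top' (I := m) (Ideal.eq_top_of_isUnit_mem _ (hmem i) (isUnit_convX_sub hρ hlt))
  · rw [pointIdeal, Ideal.span_le]
    rintro _ ⟨i, rfl⟩
    exact hmem i

/-- The coefficients in a local relation are only germs at `p`. Replacing them by Taylor polynomials
gives a combination defined on the whole polydisc that agrees with `a` to any prescribed order. -/
theorem sub_sum_polyAt_mul_mem_pointIdeal_pow {p : Fin n → ℂ} (hp : ‖p‖ < ρ) {κ : Type*} [Finite κ]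
    {g : κ → conv n ρ} {a : conv n ρ}
    (h : holomorphicGerms.ofSeries p hp a ∈
      Ideal.span (Set.range fun k => holomorphicGerms.ofSeries p hp (g k))) (M : ℕ) :
    ∃ b ∈ Ideal.span (Set.range g), a - b ∈ pointIdeal ρ p ^ (M + 1) := by
  have := Fintype.ofFinite κ
  obtain ⟨c, hc⟩ := Ideal.mem_span_range_iff_exists_fun.1 h
  choose u hu huc using fun k => holomorphicGerms.exists_mk_eq (c k)
  choose P hP using fun k => exists_taylor_isBigO (hu k) (M + 1)
  refine ⟨∑ k, polyAt ρ p (P k) * g k,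
    Ideal.sum_mem _ fun k _ => Ideal.mul_mem_left _ _ (Ideal.subset_span ⟨k, rfl⟩), ?_⟩
  refine mem_pointIdeal_pow_of_isBigO hp ?_
  have hnear : ∀ᶠ x in 𝓝 p, ‖x‖ ≤ ρ := by
    filter_upwards [(continuous_norm.isOpen_preimage _ isOpen_Iio).mem_nhds hp] with x hx
    exact le_of_lt hx
  have e1 : (fun x => ev x a.1) =ᶠ[𝓝 p] fun x => ∑ k, u k x * ev x (g k).1 := by
    rw [← holomorphicGerms.ext_iff_eventuallyEq (hg := analyticAt_ev a.2 hp)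
      (hh := Finset.univ.analyticAt_fun_sum fun k _ => (hu k).fun_mul (analyticAt_ev (g k).2 hp)),
      ← holomorphicGerms.sum_mk _ fun k => (hu k).fun_mul (analyticAt_ev (g k).2 hp)]
    rw [holomorphicGerms.ofSeries_apply] at hc
    rw [← hc]
    refine Finset.sum_congr rfl fun k _ => ?_
    rw [← huc k]
    rfl
  have e2 : (fun x => ∑ k, (u k x - MvPolynomial.eval (x - p) (P k)) * ev x (g k).1) =ᶠ[𝓝 p]
      fun x => ev x (a - ∑ k, polyAt ρ p (P k) * g k).1 := by
    filter_upwards [e1, hnear] with x hx hxρ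
    have h3 : ev x (a - ∑ k, polyAt ρ p (P k) * g k).1 =
        ev x a.1 - evHom x hxρ (∑ k, polyAt ρ p (P k) * g k) :=
      map_sub (evHom x hxρ) a _
    rw [h3, hx, map_sum, ← Finset.sum_sub_distrib]
    refine Finset.sum_congr rfl fun k _ => ?_
    have h4 : evHom x hxρ (polyAt ρ p (P k) * g k) =
        ev x (polyAt ρ p (P k)).1 * ev x (g k).1 := map_mul (evHom x hxρ) _ _
    rw [h4, ev_polyAt hxρ, sub_mul]
  refine Asymptotics.IsBigO.congr' (Asymptotics.IsBigO.fun_sum fun k _ => ?_) e2 EventuallyEq.rfl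
  simpa using (hP k).mul ((analyticAt_ev (g k).2 hp).continuousAt.isBigO_one ℝ)

/-- A local criterion for membership in an ideal of finite codimension of `conv n ρ`. -/
theorem convIncl_mem_of_forall_point (hρ : 0 < ρ) (hlt : ρ < ρ') {κ : Type*} [Finite κ]
    (K : Ideal (conv n ρ)) [Module.Finite ℂ (conv n ρ ⧸ K)] {g : κ → conv n ρ'} {a : conv n ρ'}
    (hg : ∀ k, convIncl hlt.le (g k) ∈ K)
    (H : ∀ (p : Fin n → ℂ) (hp : ‖p‖ < ρ'), (∀ h, convIncl hlt.le h ∈ K → ev p h.1 = 0) →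
      holomorphicGerms.ofSeries p hp a ∈
        Ideal.span (Set.range fun k => holomorphicGerms.ofSeries p hp (g k))) :
    convIncl hlt.le a ∈ K := by
  refine Ideal.mem_of_forall_isMaximal_of_finite (k := ℂ) K fun m hm hKm hmf M => ?_
  obtain ⟨p, hpρ, hpm⟩ := exists_point_of_isMaximal hρ m
  -- The two radii serve here: points of the closed polydisc of radius `ρ` are interior to the
  -- larger one, where germs make sense.
  have hp : ‖p‖ < ρ' := hpρ.trans_lt (by exact_mod_cast hlt)
  have hmap : ∀ h ∈ pointIdeal ρ' p, convIncl hlt.le h ∈ m := fun h hh =>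
    hpm (map_convIncl_pointIdeal_le hlt.le p (Ideal.mem_map_of_mem _ hh))
  -- Elements of `K` vanish at `p`: `h - h(p)` and `h` lie in `m`, so the constant `h(p)` does, and
  -- it cannot be a unit.
  have hloc := H p hp fun h hh => by
    obtain ⟨q, hq⟩ := exists_eq_algebraMap_add_sum hp h
    have h1 : convIncl hlt.le (h - algebraMap ℂ _ (ev p h.1)) ∈ m := hmap _ (by
      nth_rw 1 [hq]
      rw [add_sub_cancel_left]
      exact Ideal.sum_mem _ fun i _ => Ideal.mul_mem_right _ _ (Ideal.subset_span ⟨i, rfl⟩))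
    rw [map_sub, AlgHom.commutes] at h1
    have h2 := Ideal.sub_mem _ (hKm hh) h1
    rw [sub_sub_cancel] at h2
    by_contra h0
    exact hm.ne_top (Ideal.eq_top_of_isUnit_mem _ h2 ((Ne.isUnit h0).map _))
  obtain ⟨b, hb, hab⟩ := sub_sum_polyAt_mul_mem_pointIdeal_pow hp hloc M
  refine ⟨convIncl hlt.le b, ?_, ?_⟩
  · have : Ideal.span (Set.range g) ≤ K.comap (convIncl hlt.le) :=
      Ideal.span_le.2 (by rintro _ ⟨k, rfl⟩; exact hg k)
    exact this hb
  · have := Ideal.mem_map_of_mem (convIncl hlt.le) hab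
    rw [Ideal.map_pow, map_sub] at this
    exact Ideal.pow_le_pow_right M.le_succ
      (Ideal.pow_right_mono ((map_convIncl_pointIdeal_le hlt.le p).trans hpm) _ this)

end MvPowerSeries

/-! ### Coordinates over a ring of germs in one variable -/

open scoped ENNReal NNReal

/-- A finite torsion-free module over a principal ideal domain is free. The equivalence packages
existence and uniqueness of coordinates without mentioning the module structure. -/
theorem RingHom.exists_coordinates {R S : Type*} [CommRing R] [IsDomain R] [IsPrincipalIdealRing R]
    [CommRing S] (f : R →+* S) (I : Ideal S) (hf : ((Ideal.Quotient.mk I).comp f).Finite)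
    (h0 : ∀ r y, r ≠ 0 → f r * y ∈ I → y ∈ I) :
    ∃ (d : ℕ) (e : Fin d → S) (c : S → Fin d → R),
      ∀ h γ, h - ∑ j, f (γ j) * e j ∈ I ↔ γ = c h := by
  let := ((Ideal.Quotient.mk I).comp f).toAlgebra
  have : Module.Finite R (S ⧸ I) := hf
  have hsmul : ∀ (r : R) (y : S), r • (Ideal.Quotient.mk I y) = Ideal.Quotient.mk I (f r * y) :=
    fun r y => rfl
  have : Module.IsTorsionFree R (S ⧸ I) := by
    refine Module.IsTorsionFree.of_smul_eq_zero fun r y hry => ?_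
    obtain ⟨y, rfl⟩ := Ideal.Quotient.mk_surjective y
    rw [hsmul, Ideal.Quotient.eq_zero_iff_mem] at hry
    by_cases hr : r = 0
    · exact Or.inl hr
    · exact Or.inr (Ideal.Quotient.eq_zero_iff_mem.2 (h0 r y hr hry))
  obtain ⟨d, b⟩ := Module.basisOfFiniteTypeTorsionFree' (R := R) (M := S ⧸ I)
  choose e he using fun j => Ideal.Quotient.mk_surjective (b j)
  refine ⟨d, e, fun h => b.equivFun (Ideal.Quotient.mk I h), fun h γ => ?_⟩
  rw [← Ideal.Quotient.eq, map_sum]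
  simp only [← hsmul, he]
  rw [← b.equivFun_symm_apply, LinearEquiv.eq_symm_apply, eq_comm]

theorem Ideal.finite_quotient_of_linearMap {k A V : Type*} [Field k] [CommRing A] [Algebra k A]
    [AddCommGroup V] [Module k V] [Module.Finite k V] (K : Ideal A) (Θ : A →ₗ[k] V)
    (h : ∀ x, Θ x = 0 → x ∈ K) : Module.Finite k (A ⧸ K) := by
  have : Module.Finite k (A ⧸ LinearMap.ker Θ) :=
    Module.Finite.equiv Θ.quotKerEquivRange.symm
  refine Module.Finite.of_surjective
    ((LinearMap.ker Θ).liftQ (Ideal.Quotient.mkₐ k K).toLinearMap fun x hx =>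
      Ideal.Quotient.eq_zero_iff_mem.2 (h x hx)) fun y => ?_
  obtain ⟨x, rfl⟩ := Ideal.Quotient.mk_surjective y
  exact ⟨Submodule.Quotient.mk x, rfl⟩

namespace holomorphicGerms

open MvPowerSeries

theorem exists_coord_pow_mem_span {γ : holomorphicGerms 1 0} (hγ : γ ≠ 0) :
    ∃ N : ℕ, coord 0 ^ N ∈ Ideal.span {γ} := by
  obtain ⟨f, hf, rfl⟩ := exists_mk_eq γ
  have hord : analyticOrderAt (fun t : ℂ => f (t • 1)) 0 ≠ ⊤ := fun h => hγ (by
    refine (ext_iff_eventuallyEq (hh := analyticAt_const)).2 ?_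
    rw [analyticOrderAt_eq_top] at h
    have ht : Tendsto (fun x : Fin 1 → ℂ => x 0) (𝓝 0) (𝓝 0) := by
      exact (continuous_apply (0 : Fin 1)).tendsto 0
    filter_upwards [ht.eventually h] with x hx
    have : x 0 • (1 : Fin 1 → ℂ) = x := by
      ext i
      rw [Fin.fin_one_eq_zero i]
      simp
    rwa [this] at hx)
  obtain ⟨N, hN⟩ := ENat.ne_top_iff_exists.1 hord
  refine ⟨N, ?_⟩
  have h := coord_pow_mem_of_order (0 : Fin 1) (μ := 1) rfl N hf hN.symm
  rwa [lineIdeal, Set.range_eq_empty, Ideal.span_empty, sup_bot_eq] at h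

theorem coord_pow_ne_zero {n : ℕ} (i : Fin n) (N : ℕ) :
    (coord i : holomorphicGerms n 0) ^ N ≠ 0 := by
  have h1 : (0 : ℝ≥0) < 1 := one_pos
  rw [← ofSeries₀_X h1, ← map_pow, ← map_zero (ofSeries₀ h1)]
  refine fun h => ?_
  have h2 := congrArg Subtype.val (ofSeries₀_injective h1 h)
  have h3 : (X i : MvPowerSeries (Fin n) ℂ) ^ N = 0 := h2
  rw [X_pow_eq] at h3
  have h4 := congrArg (coeff (Finsupp.single i N)) h3
  rw [coeff_monomial_same] at h4
  exact one_ne_zero h4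

instance isDomain_one : IsDomain (holomorphicGerms 1 0) := by
  have : NoZeroDivisors (holomorphicGerms 1 0) := ⟨fun {a b} hab => by
    by_contra! h
    obtain ⟨N, hN⟩ := exists_coord_pow_mem_span h.1
    obtain ⟨M, hM⟩ := exists_coord_pow_mem_span h.2
    obtain ⟨u, hu⟩ := Ideal.mem_span_singleton'.1 hN
    obtain ⟨v, hv⟩ := Ideal.mem_span_singleton'.1 hM
    refine coord_pow_ne_zero (0 : Fin 1) (N + M) ?_
    rw [pow_add, ← hu, ← hv]
    linear_combination u * v * hab⟩
  exact NoZeroDivisors.to_isDomain _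

instance isPrincipalIdealRing_one : IsPrincipalIdealRing (holomorphicGerms 1 0) := by
  have h : (IsLocalRing.maximalIdeal (holomorphicGerms 1 0)).IsPrincipal :=
    ⟨⟨coord 0, by rw [maximalIdeal_eq_span, Set.range_unique]; rfl⟩⟩
  exact ((tfae_of_isNoetherianRing_of_isLocalRing_of_isDomain (holomorphicGerms 1 0)).out 0 4).2 h

end holomorphicGerms

/-- `K` is the ideal of the fibre over the character `χ`. It is stable under multiplication because
the coordinates of `h * h'` are obtained from those of `h'` by the matrix of coordinates of the `h *
e i`, which has entries in `B`. It has finite codimension as the kernel of a linear map to `k ^ d`.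
-/
theorem RingHom.exists_ideal_of_coordinates {k A B R S : Type*} [Field k] [CommRing A] [Algebra k A]
    [CommRing B] [Algebra k B] [CommRing R] [CommRing S] (ιA : A →+* S) (ιB : B →+* R)
    (hιB : Function.Injective ιB) (f : R →+* S)
    (hf : ∀ z : k, f (ιB (algebraMap k B z)) = ιA (algebraMap k A z)) (I : Ideal S) {d : ℕ}
    (e : Fin d → A) (c : S → Fin d → R)
    (hc : ∀ h γ, h - ∑ j, f (γ j) * ιA (e j) ∈ I ↔ γ = c h)
    (hlift : ∀ h j, ∃ b, ιB b = c (ιA h) j) (χ : B →ₐ[k] k) :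
    ∃ K : Ideal A, Module.Finite k (A ⧸ K) ∧ ∀ h, h ∈ K ↔ ∀ j b, ιB b = c (ιA h) j → χ b = 0 := by
  choose ω hω using hlift
  have hc' : ∀ h, h - ∑ j, f (c h j) * ιA (e j) ∈ I := fun h => (hc h _).2 rfl
  have hadd : ∀ h h', ω (h + h') = ω h + ω h' := fun h h' => by
    funext j
    refine hιB ?_
    simp only [Pi.add_apply, map_add, hω]
    rw [← Pi.add_apply]
    refine congrFun ((hc _ _).1 ?_).symm j
    have := add_mem (hc' (ιA h)) (hc' (ιA h'))
    convert this using 1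
    simp only [Pi.add_apply, map_add, add_mul, Finset.sum_add_distrib]
    ring
  have hmul : ∀ h h' j, ω (h * h') j = ∑ i, ω h' i * ω (h * e i) j := fun h h' j => by
    refine hιB ?_
    simp only [map_sum, map_mul, hω]
    refine congrFun ((hc (ιA h * ιA h') fun j => ∑ i, c (ιA h') i * c (ιA h * ιA (e i)) j).1 ?_).symm j
    have h1 := I.mul_mem_left (ιA h) (hc' (ιA h'))
    have h2 : ∑ i, f (c (ιA h') i) * (ιA h * ιA (e i) -
        ∑ j, f (c (ιA h * ιA (e i)) j) * ιA (e j)) ∈ I :=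
      Ideal.sum_mem _ fun i _ => I.mul_mem_left _ (hc' _)
    convert add_mem h1 h2 using 1
    simp only [mul_sub, Finset.sum_sub_distrib, map_sum, map_mul, Finset.sum_mul, Finset.mul_sum]
    rw [Finset.sum_comm]
    simp only [mul_assoc, mul_left_comm (ιA h)]
    ring
  have hsmul : ∀ (z : k) h, ω (z • h) = z • ω h := fun z h => by
    funext j
    refine hιB ?_
    rw [hω, Pi.smul_apply, Algebra.smul_def, Algebra.smul_def, map_mul, map_mul, hω]
    refine congrFun ((hc _ fun j => ιB (algebraMap k B z) * c (ιA h) j).1 ?_).symm j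
    have h1 := I.mul_mem_left (ιA (algebraMap k A z)) (hc' (ιA h))
    convert h1 using 1
    simp only [map_mul, hf, mul_sub, Finset.mul_sum, mul_assoc]
  let Θ : A →ₗ[k] Fin d → k :=
    { toFun := fun h j => χ (ω h j)
      map_add' := fun h h' => by
        funext j
        rw [hadd, Pi.add_apply, map_add, Pi.add_apply]
      map_smul' := fun z h => by
        funext j
        rw [hsmul, Pi.smul_apply, map_smul, Pi.smul_apply, RingHom.id_apply] }
  let K : Ideal A :=
    { carrier := {h | Θ h = 0}
      add_mem' := fun {x y} hx hy => by
        change Θ (x + y) = 0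
        rw [map_add, show Θ x = 0 from hx, show Θ y = 0 from hy, add_zero]
      zero_mem' := map_zero Θ
      smul_mem' := fun h h' hh' => by
        funext j
        change χ (ω (h * h') j) = 0
        rw [hmul, map_sum]
        refine Finset.sum_eq_zero fun i _ => ?_
        have : χ (ω h' i) = 0 := congrFun hh' i
        rw [map_mul, this, zero_mul] }
  refine ⟨K, Ideal.finite_quotient_of_linearMap K Θ fun x hx => hx, fun h => ⟨fun hh j b hb => ?_, fun hh => ?_⟩⟩
  · rw [hιB (hb.trans (hω h j).symm)]
    exact congrFun hh j
  · funext j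
    exact hh j _ (hω h j)

open scoped ENNReal NNReal

/-! ### Testing ideal membership away from the origin -/

namespace holomorphicGerms

open MvPowerSeries

variable {n : ℕ}

theorem eventually_exists_ev_eq {g : (Fin n → ℂ) → ℂ} (hg : AnalyticAt ℂ g 0) :
    ∀ᶠ ρ in 𝓝[>] (0 : ℝ≥0), ∃ φ : conv n ρ, ∀ x, ‖x‖ ≤ ρ → ev x φ.1 = g x := by
  obtain ⟨r, hr, φ, hφ, he⟩ := exists_ev_eq hg
  filter_upwards [Ioc_mem_nhdsGT hr] with ρ hρr
  exact ⟨⟨φ, conv_mono hρr.2 hφ⟩, fun x hx => he x (hx.trans (by exact_mod_cast hρr.2))⟩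

theorem ofSeries_eq_mk {ρ : ℝ≥0} {p : Fin n → ℂ} (hp : ‖p‖ < ρ) {φ : conv n ρ}
    {g : (Fin n → ℂ) → ℂ} (h : ∀ x, ‖x‖ ≤ ρ → ev x φ.1 = g x) :
    ∃ hg : AnalyticAt ℂ g p, ofSeries p hp φ = mk g hg := by
  have hnear : (fun x => ev x φ.1) =ᶠ[𝓝 p] g := by
    filter_upwards [(continuous_norm.isOpen_preimage _ isOpen_Iio).mem_nhds hp] with x hx
    exact h x (le_of_lt hx)
  exact ⟨(analyticAt_ev φ.2 hp).congr hnear,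
    (ext_iff_eventuallyEq (hg := analyticAt_ev φ.2 hp)).2 hnear⟩

/-- The coordinates of a convergent power series with respect to a basis of `𝒪_n / I` over `𝒪_d`
converge on a uniform polydisc. -/
theorem eventually_exists_lift_coordinates {d r N : ℕ} {κ : Type*} [Finite κ]
    (G : κ → holomorphicGerms n 0) {a : (Fin n → ℂ) → Fin d → ℂ} (ha : AnalyticAt ℂ a 0)
    (ha0 : a 0 = 0)
    (hN : ∀ i, coord i ^ N ∈ Ideal.span (Set.range G) ⊔
      Ideal.span (Set.range fun l => comp a ha ha0 (coord l)))
    (e : Fin r → holomorphicGerms n 0) (c : holomorphicGerms n 0 → Fin r → holomorphicGerms d 0)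
    (hc : ∀ h γ, h - ∑ j, comp a ha ha0 (γ j) * e j ∈ Ideal.span (Set.range G) ↔ γ = c h) :
    ∀ᶠ ρ in 𝓝[>] (0 : ℝ≥0), ∀ hρ : 0 < ρ, ∃ σ, ∃ hσ : 0 < σ, ∀ (h : conv n ρ) j,
      ∃ b : conv d σ, ofSeries₀ hσ b = c (ofSeries₀ hρ h) j := by
  filter_upwards [weierstrass_division G ha ha0 hN] with ρ hdiv hρ
  obtain ⟨σ, hσ, hdiv⟩ := hdiv hρ
  have hc' : ∀ h, h - ∑ j, comp a ha ha0 (c h j) * e j ∈ Ideal.span (Set.range G) :=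
    fun h => (hc h _).2 rfl
  let mon : (Fin n → Fin N) → holomorphicGerms n 0 :=
    fun w => ofSeries₀ hρ ⟨boxMon n N w, boxMon_mem_conv w⟩
  have hev : ∀ᶠ τ in 𝓝[>] (0 : ℝ≥0), ∀ w j, ∀ hτ : 0 < τ, ∃ φ : conv d τ,
      ofSeries₀ hτ φ = c (mon w) j :=
    eventually_all.2 fun w => eventually_all.2 fun j => eventually_exists_ofSeries₀_eq _
  -- The coordinates of any series are combinations of those of the finitely many box monomials,
  -- with the division coefficients `Ω w` as multipliers; one radius `τ ≤ σ` serves them all.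
  have hsmall : ∀ᶠ τ in 𝓝[>] (0 : ℝ≥0), τ ∈ Set.Ioc 0 σ := Ioc_mem_nhdsGT hσ
  obtain ⟨τ, ⟨hτ, hτσ⟩, hlift⟩ := (hsmall.and hev).exists
  have hτσ : τ ≤ σ := hτσ
  choose M hM using fun w j => hlift w j hτ
  refine ⟨τ, hτ, fun h j => ?_⟩
  obtain ⟨Ω, hΩ⟩ := hdiv h
  refine ⟨∑ w, convIncl hτσ (Ω w) * M w j, ?_⟩
  have key := (hc (ofSeries₀ hρ h) fun j => ∑ w, ofSeries₀ hσ (Ω w) * c (mon w) j).1 ?_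
  · rw [← key, map_sum]
    refine Finset.sum_congr rfl fun w _ => ?_
    rw [map_mul, hM]
    rfl
  · have h2 : ∑ w, comp a ha ha0 (ofSeries₀ hσ (Ω w)) * (mon w - ∑ j, comp a ha ha0 (c (mon w) j) * e j) ∈
        Ideal.span (Set.range G) :=
      Ideal.sum_mem _ fun w _ => Ideal.mul_mem_left _ _ (hc' _)
    convert add_mem hΩ h2 using 1
    simp only [mul_sub, Finset.sum_sub_distrib, map_sum, map_mul, Finset.sum_mul, Finset.mul_sum]
    rw [Finset.sum_comm]
    simp only [mul_assoc, mon]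
    ring

set_option maxHeartbeats 1000000 in
/-- Membership in an ideal of `𝒪_n` of depth at least one and dimension at most one can be tested
away from the origin. -/
theorem mk_mem_span_of_eventually {κ : Type*} [Finite κ] {g : κ → (Fin n → ℂ) → ℂ}
    (hg : ∀ k, AnalyticAt ℂ (g k) 0) {a s : (Fin n → ℂ) → ℂ} (ha : AnalyticAt ℂ a 0)
    (hs : AnalyticAt ℂ s 0) (hs0 : s 0 = 0)
    (hreg : ∀ y, mk s hs * y ∈ Ideal.span (Set.range fun k => mk (g k) (hg k)) →
      y ∈ Ideal.span (Set.range fun k => mk (g k) (hg k)))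
    {N : ℕ} (hN : ∀ i, coord i ^ N ∈
      Ideal.span (Set.range fun k => mk (g k) (hg k)) ⊔ Ideal.span {mk s hs})
    (hloc : ∀ᶠ p in 𝓝[≠] (0 : Fin n → ℂ), ∀ (hgp : ∀ k, AnalyticAt ℂ (g k) p)
      (hap : AnalyticAt ℂ a p), (∀ k, g k p = 0) →
        mk a hap ∈ Ideal.span (Set.range fun k => mk (g k) (hgp k))) :
    mk a ha ∈ Ideal.span (Set.range fun k => mk (g k) (hg k)) := by
  set G : κ → holomorphicGerms n 0 := fun k => mk (g k) (hg k) with hG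
  let I := Ideal.span (Set.range G)
  have hS : AnalyticAt ℂ (fun x (_ : Fin 1) => s x) 0 := analyticAt_pi_iff.2 fun _ => hs
  have hS0 : (fun x (_ : Fin 1) => s x) 0 = 0 := funext fun _ => hs0
  let t := comp (fun x (_ : Fin 1) => s x) hS hS0
  have ht : t (coord 0) = mk s hs := rfl
  have hN' : ∀ i, coord i ^ N ∈ Ideal.span (Set.range G) ⊔
      Ideal.span (Set.range fun l => comp (fun x (_ : Fin 1) => s x) hS hS0 (coord l)) := fun i => by
    have h1 : (Set.range fun l => comp (fun x (_ : Fin 1) => s x) hS hS0 (coord l)) = {mk s hs} :=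
      Set.range_unique
    rw [h1]
    exact hN i
  have hpow : ∀ (M : ℕ) y, mk s hs ^ M * y ∈ I → y ∈ I := fun M y h => by
    induction M with
    | zero => simpa using h
    | succ M ih =>
      refine ih (hreg _ ?_)
      rwa [← mul_assoc, ← pow_succ']
  -- Every nonzero germ in one variable divides a power of the coordinate, which maps to a power of
  -- `s`; so torsion-freeness follows from regularity of `s` modulo `I`.
  obtain ⟨r, e, c, hc⟩ := t.exists_coordinates I (finite_mk_comp G hS hS0 hN') fun γ y hγ hy => by
    obtain ⟨M, hM⟩ := exists_coord_pow_mem_span hγ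
    obtain ⟨u, hu⟩ := Ideal.mem_span_singleton'.1 hM
    refine hpow M y ?_
    rw [← ht, ← map_pow, ← hu, map_mul, mul_assoc]
    exact Ideal.mul_mem_left _ _ hy
  -- a polydisc on which everything converges
  obtain ⟨δ, hδ, hδloc⟩ := Metric.eventually_nhds_iff.1 (eventually_nhdsWithin_iff.1 hloc)
  have hδ' : ∀ᶠ ρ : ℝ≥0 in 𝓝[>] 0, (ρ : ℝ) < δ := by
    have : Tendsto (fun ρ : ℝ≥0 => (ρ : ℝ)) (𝓝[>] 0) (𝓝 0) := 
      (NNReal.continuous_coe.tendsto' 0 0 NNReal.coe_zero).mono_left nhdsWithin_le_nhds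
    exact this.eventually_lt_const hδ
  obtain ⟨ρ', ⟨hρ', hρδ⟩, ⟨φs, hφs⟩, ⟨φa, hφa⟩, hφg⟩ :=
    (((eventually_mem_nhdsWithin (a := (0 : ℝ≥0)) (s := Set.Ioi 0)).and hδ').and
      ((eventually_exists_ev_eq hs).and ((eventually_exists_ev_eq ha).and
        (eventually_all.2 fun k => eventually_exists_ev_eq (hg k))))).exists
  choose φg hφg using hφg
  have hρ' : 0 < ρ' := hρ'
  have hsmall : ∀ᶠ ρ in 𝓝[>] (0 : ℝ≥0), ρ ∈ Set.Ioo 0 ρ' := Ioo_mem_nhdsGT hρ'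
  obtain ⟨ρ, ⟨hρ, hlt⟩, hcoord, hE⟩ :=
    (hsmall.and
      ((eventually_exists_lift_coordinates G hS hS0 hN' e c hc).and
        (eventually_all.2 fun j => eventually_exists_ofSeries₀_eq (e j)))).exists
  choose ê hê using fun j => hE j hρ
  obtain ⟨σ, hσ, hlift⟩ := hcoord hρ
  have hgerm : ∀ {φ : conv n ρ'} {f : (Fin n → ℂ) → ℂ} (hf : AnalyticAt ℂ f 0),
      (∀ x, ‖x‖ ≤ ρ' → ev x φ.1 = f x) → ofSeries₀ hρ (convIncl hlt.le φ) = mk f hf :=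
    fun {φ f} hf h => by
      obtain ⟨_, h2⟩ := ofSeries_eq_mk (p := 0) (by simpa using hρ') h
      exact h2
  have hcz : ∀ {h : holomorphicGerms n 0}, c h = 0 ↔ h ∈ I := fun {h} => by
    rw [eq_comm, ← hc h 0]
    simp
  have hcmul : ∀ γ h, c (t γ * h) = fun j => γ * c h j := fun γ h => by
    refine ((hc _ _).1 ?_).symm
    have := Ideal.mul_mem_left I (t γ) ((hc h _).2 rfl)
    convert this using 1
    simp only [map_mul, mul_sub, Finset.mul_sum, mul_assoc]
  obtain ⟨b, hb⟩ : ∃ b : Fin r → conv 1 σ, ∀ j, ofSeries₀ hσ (b j) = c (mk a ha) j := by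
    choose b hb using fun j => hlift (convIncl hlt.le φa) j
    exact ⟨b, fun j => (hb j).trans (by rw [hgerm ha hφa])⟩
  obtain ⟨b₁, hb₁⟩ : ∃ b : Fin r → conv 1 σ, ∀ j, ofSeries₀ hσ (b j) = c 1 j := by
    choose b hb using fun j => hlift 1 j
    exact ⟨b, fun j => (hb j).trans (by rw [map_one])⟩
  -- The coordinates of `a` vanish at every `z ≠ 0` of the closed disc of radius `σ`; `K` below is
  -- the ideal of the fibre over `z`.
  have hzero : ∀ z : ℂ, ‖z‖ ≤ σ → z ≠ 0 → ∀ j, ev (fun _ => z) (b j).1 = 0 := fun z hz hz0 => by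
    have hz' : ‖fun _ : Fin 1 => z‖ ≤ σ := by simpa using hz
    obtain ⟨K, hKfin, hK⟩ := RingHom.exists_ideal_of_coordinates (k := ℂ) (ofSeries₀ hρ) (ofSeries₀ hσ)
      (ofSeries₀_injective hσ) t (fun z => by
        have h1 := ofSeries₀_C (n := 1) hσ z
        have h2 := ofSeries₀_C (n := n) hρ z
        exact (congrArg t h1).trans h2.symm) I ê c (by simpa only [hê] using hc) hlift
      (evHom (fun _ => z) hz')
    have hKa : convIncl hlt.le φa ∈ K := by
      have hmem : ∀ h, ofSeries₀ hρ h ∈ I → h ∈ K := fun h hh => (hK h).2 fun j β hβ => by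
        have : β = 0 := ofSeries₀_injective hσ (by rw [hβ, hcz.2 hh, map_zero]; rfl)
        rw [this, map_zero]
      -- The coordinates of `(s - z) * 1` are `x - z` times those of `1`, so they vanish at `z`.
      -- Hence `s p = z` at every point `p` where `K` vanishes, and `p ≠ 0`.
      have hKs : convIncl hlt.le (φs - algebraMap ℂ _ z) ∈ K := (hK _).2 fun j β hβ => by
        have h1 : ofSeries₀ hρ (convIncl hlt.le (φs - algebraMap ℂ _ z)) =
            t (coord 0 - const z) * 1 := by
          rw [map_sub, map_sub, hgerm hs hφs, mul_one, map_sub, ht, AlgHom.commutes]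
          congr 1
          exact ofSeries₀_C hρ z
        have h2 : β = (convX 1 σ 0 - algebraMap ℂ _ z) * b₁ j := by
          refine ofSeries₀_injective hσ ?_
          rw [hβ, h1, hcmul, map_mul, map_sub, hb₁]
          have e1 : ofSeries₀ hσ (convX 1 σ 0) = coord 0 := ofSeries₀_X hσ 0
          have e2 : ofSeries₀ hσ (algebraMap ℂ (conv 1 σ) z) = const z := ofSeries₀_C hσ z
          rw [e1, e2]
        rw [h2, map_mul, map_sub, evHom_convX, AlgHom.commutes]
        simp
      refine convIncl_mem_of_forall_point hρ hlt K (g := φg) (fun k => hmem _ ?_) fun p hp hpK => ?_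
      · rw [hgerm (hg k) (hφg k)]
        exact Ideal.subset_span ⟨k, rfl⟩
      · have hgK : ∀ k, convIncl hlt.le (φg k) ∈ K := fun k => hmem _ (by
          rw [hgerm (hg k) (hφg k)]
          exact Ideal.subset_span ⟨k, rfl⟩)
        have hsp : s p = z := by
          have h1 := hpK _ hKs
          have h2 : ev p (φs - algebraMap ℂ _ z : conv n ρ').1 = s p - z := by
            have := map_sub (evHom p hp.le) φs (algebraMap ℂ _ z)
            rw [AlgHom.commutes] at this
            rw [← hφs p hp.le]
            exact this
          exact sub_eq_zero.1 (h2.symm.trans h1)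
        have hp0 : p ≠ 0 := by
          rintro rfl
          exact hz0 (hsp.symm.trans hs0)
        obtain ⟨hap, hap'⟩ := ofSeries_eq_mk hp hφa
        choose hgp hgp' using fun k => ofSeries_eq_mk hp (hφg k)
        have := hδloc (by rw [dist_zero_right]; exact hp.trans hρδ) hp0 hgp hap fun k => by
          rw [← hφg k p hp.le]
          exact hpK _ (hgK k)
        rw [hap']
        simpa only [hgp'] using this
    exact fun j => (hK _).1 hKa j (b j) (by rw [hb, hgerm ha hφa])
  refine hcz.1 (funext fun j => ?_)
  rw [← hb j]
  -- Multiplying by the coordinate takes care of the excluded value `z = 0`; the factor is cancelled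
  -- in the domain `𝒪_1`.
  have hXb : convX 1 σ 0 * b j = 0 := by
    refine Subtype.ext (eq_zero_of_ev_eventually_eq_zero hσ (convX 1 σ 0 * b j).2 ?_)
    filter_upwards [Metric.closedBall_mem_nhds (0 : Fin 1 → ℂ) (show (0 : ℝ) < σ from hσ)] with x hx
    rw [mem_closedBall_zero_iff] at hx
    have h1 : ev x (convX 1 σ 0 * b j).1 = x 0 * ev x (b j).1 := by
      have := map_mul (evHom x hx) (convX 1 σ 0) (b j)
      rw [evHom_convX] at this
      exact this
    have h2 : x = fun _ => x 0 := funext fun i => by rw [Fin.fin_one_eq_zero i]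
    rw [h1]
    by_cases hx0 : x 0 = 0
    · rw [hx0, zero_mul]
    · have := hzero (x 0) ((norm_le_pi_norm x 0).trans hx) hx0 j
      rw [← h2] at this
      rw [this, mul_zero]
  have h3 : coord 0 * ofSeries₀ hσ (b j) = 0 := by
    have := congrArg (ofSeries₀ hσ) hXb
    rw [map_mul, map_zero] at this
    rw [← this]
    congr 1
    exact (ofSeries₀_X hσ 0).symm
  exact (mul_eq_zero.1 h3).resolve_left (by simpa using coord_pow_ne_zero (0 : Fin 1) 1)

end holomorphicGerms

/-- Elements `a, b` such that `a / b` is integral, with denominators cleared. -/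
def IntegralRel {R : Type*} [CommRing R] (a b : R) : Prop :=
  ∃ (k : ℕ) (c : Fin k → R), a ^ k + ∑ i, c i * a ^ (i : ℕ) * b ^ (k - i) = 0

/-! ### Integral closedness in terms of divisibility -/

section IntegralRel

variable {R : Type*} [CommRing R]

open Polynomial in
theorem integralRel_of_isIntegral {K : Type*} [CommRing K] [Algebra R K] [IsFractionRing R K]
    {a : R} {b : nonZeroDivisors R} (h : IsIntegral R (IsLocalization.mk' K a b)) :
    IntegralRel a (b : R) := by
  obtain ⟨p, hp, hpe⟩ := h
  have h1 := scaleRoots_aeval_eq_zero_of_aeval_mk'_eq_zero hpe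
  rw [aeval_algebraMap_apply, IsFractionRing.to_map_eq_zero_iff, coe_aeval_eq_eval,
    eval_eq_sum_range, natDegree_scaleRoots, Finset.sum_range_succ] at h1
  refine ⟨p.natDegree, fun i => p.coeff i, ?_⟩
  rw [← h1, add_comm, Finset.sum_range]
  congr 1
  · refine Finset.sum_congr rfl fun i _ => ?_
    rw [coeff_scaleRoots]
    ring
  · rw [coeff_scaleRoots, hp.coeff_natDegree]
    simp

open Polynomial in
theorem isIntegral_of_integralRel {K : Type*} [CommRing K] [Algebra R K] [IsFractionRing R K]
    {a : R} {b : nonZeroDivisors R} (h : IntegralRel a (b : R)) :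
    IsIntegral R (IsLocalization.mk' K a b) := by
  obtain ⟨k, c, h⟩ := h
  refine ⟨X ^ k + ∑ i, C (c i) * X ^ (i : ℕ), ?_, ?_⟩
  · exact monic_X_pow_add (degree_sum_fin_lt _)
  · have hb : IsUnit (algebraMap R K b) := IsLocalization.map_units K b
    have hx : algebraMap R K a = IsLocalization.mk' K a b * algebraMap R K b :=
      (IsLocalization.mk'_spec K a b).symm
    refine (hb.pow k).mul_right_cancel ?_
    have h1 := congrArg (algebraMap R K) h
    rw [map_add, map_sum, map_zero, map_pow] at h1
    simp only [eval₂_add, eval₂_finsetSum, eval₂_mul, eval₂_C, eval₂_X, eval₂_pow]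
    rw [zero_mul, ← h1, hx, add_mul, mul_pow, Finset.sum_mul]
    congr 1
    refine Finset.sum_congr rfl fun i _ => ?_
    rw [map_mul, map_mul, map_pow, map_pow, hx, mul_pow]
    have hk : algebraMap R K b ^ k = algebraMap R K b ^ (i : ℕ) * algebraMap R K b ^ (k - i) := by
      rw [← pow_add, Nat.add_sub_cancel' i.2.le]
    rw [hk]
    ring

/-- Normality without fractions: this form passes along ring maps and to germs at neighbouring
points. -/
theorem isIntegrallyClosed_iff_dvd :
    IsIntegrallyClosed R ↔ ∀ a b : R, b ∈ nonZeroDivisors R → IntegralRel a b → b ∣ a := by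
  rw [isIntegrallyClosed_iff (FractionRing R)]
  refine ⟨fun h a b hb hab => ?_, fun h x hx => ?_⟩
  · obtain ⟨y, hy⟩ := h (isIntegral_of_integralRel (K := FractionRing R) (b := ⟨b, hb⟩) hab)
    rw [IsLocalization.eq_mk'_iff_mul_eq, ← map_mul] at hy
    exact ⟨y, by rw [← IsFractionRing.injective R (FractionRing R) hy, mul_comm]⟩
  · obtain ⟨a, b, rfl⟩ := IsLocalization.exists_mk'_eq (nonZeroDivisors R) x
    obtain ⟨y, rfl⟩ := h a b b.2 (integralRel_of_isIntegral hx)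
    exact ⟨y, by rw [IsLocalization.eq_mk'_iff_mul_eq, ← map_mul, mul_comm]⟩

/-- A normal Noetherian local ring is a domain. -/
theorem isDomain_of_isReduced_of_isIntegrallyClosed [IsLocalRing R] [IsNoetherianRing R]
    [IsReduced R] [IsIntegrallyClosed R] : IsDomain R := by
  have : NoZeroDivisors R := ⟨fun {a c} hac => by
    by_contra! h0
    -- This ideal contains a nonzerodivisor: an element `x` killing it kills `a`, so it lies in the
    -- ideal and `x * x = 0`, whence `x = 0` by reducedness.
    let I : Ideal R := Submodule.annihilator (Ideal.span {a}) ⊔ Ideal.span {a}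
    have hann : ∀ x, x ∈ Submodule.annihilator (Ideal.span {a}) ↔ x * a = 0 := fun x =>
      Submodule.mem_annihilator_span_singleton a x
    obtain ⟨z, hzI, hz⟩ : ((I : Set R) ∩ nonZeroDivisors R).Nonempty := by
      by_contra hne
      have := Ideal.bot_lt_annihilator_of_disjoint_nonZeroDivisors
        (Set.disjoint_iff_inter_eq_empty.2 (Set.not_nonempty_iff_eq_empty.1 hne))
      obtain ⟨x, hx, hx0⟩ := SetLike.exists_of_lt this
      rw [Submodule.mem_annihilator] at hx
      have hxa : x * a = 0 := hx a (Ideal.mem_sup_right (Ideal.mem_span_singleton_self a))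
      have hxx : x * x = 0 := hx x (Ideal.mem_sup_left ((hann x).2 hxa))
      exact hx0 (IsReduced.eq_zero x ⟨2, by rw [sq, hxx]⟩)
    obtain ⟨b, hb, y, hy, rfl⟩ := Submodule.mem_sup.1 hzI
    obtain ⟨r, rfl⟩ := Ideal.mem_span_singleton'.1 hy
    rw [hann] at hb
    -- As `b * a = 0`, the fraction `r a / (b + r a)` is idempotent, hence integral, hence in `R`. A
    -- local ring has only the idempotents `0` and `1`, and these force `a = 0` and `c = 0`
    -- respectively.
    have hrel : IntegralRel (r * a) (b + r * a) := by
      refine ⟨2, ![0, -1], ?_⟩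
      simp only [Fin.sum_univ_two]
      simp
      linear_combination -r * hb
    obtain ⟨e, he⟩ := isIntegrallyClosed_iff_dvd.1 ‹_› _ _ hz hrel
    have hidem : e * (1 - e) = 0 := by
      have h1 : (e * (1 - e)) * (b + r * a) * (b + r * a) = 0 := by
        have h2 : r * a * b = 0 := by linear_combination r * hb
        linear_combination (-(b + r * a) + (r * a + (b + r * a) * e)) * he + h2
      exact (mem_nonZeroDivisors_iff_right.1 hz) _ ((mem_nonZeroDivisors_iff_right.1 hz) _ h1)
    rcases IsLocalRing.isUnit_or_isUnit_one_sub_self e with hu | hu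
    · have he1 : 1 - e = 0 := (hu.mul_right_eq_zero).1 hidem
      have he2 : e = 1 := (sub_eq_zero.1 he1).symm
      rw [he2, mul_one] at he
      have hb0 : b = 0 := by linear_combination -he
      refine h0.2 ((mem_nonZeroDivisors_iff_right.1 hz) c ?_)
      rw [hb0]
      linear_combination r * hac
    · have he1 : e = 0 := (hu.mul_left_eq_zero).1 hidem
      rw [he1, mul_zero] at he
      refine h0.1 ((mem_nonZeroDivisors_iff_right.1 hz) a ?_)
      rw [he]
      linear_combination hb⟩
  exact NoZeroDivisors.to_isDomain R

end IntegralRel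

/-! ### Regular local rings are normal domains -/

section Regular

open IsLocalRing

variable {R : Type*} [CommRing R]

theorem IntegralRel.mem_of_mem {a b : R} (h : IntegralRel a b) {Q : Ideal R} [hQ : Q.IsPrime]
    (hb : b ∈ Q) : a ∈ Q := by
  obtain ⟨k, c, h⟩ := h
  refine hQ.mem_of_pow_mem k ?_
  rw [eq_neg_of_add_eq_zero_left h]
  refine Q.neg_mem (Q.sum_mem fun i _ => Q.mul_mem_left _ (Q.pow_mem_of_mem hb _ ?_))
  omega

theorem IntegralRel.map {S : Type*} [CommRing S] (f : R →+* S) {a b : R} (h : IntegralRel a b) :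
    IntegralRel (f a) (f b) := by
  obtain ⟨k, c, h⟩ := h
  refine ⟨k, fun i => f (c i), ?_⟩
  simpa using congrArg f h

theorem isIntegral_div_iff [IsDomain R] {a b : R} (hb : b ≠ 0) :
    IsIntegral R (algebraMap R (FractionRing R) a / algebraMap R (FractionRing R) b) ↔
      IntegralRel a b := by
  have h := IsFractionRing.mk'_eq_div (K := FractionRing R) (r := a)
    (s := ⟨b, mem_nonZeroDivisors_of_ne_zero hb⟩)
  exact ⟨fun h1 => integralRel_of_isIntegral (K := FractionRing R)
    (b := ⟨b, mem_nonZeroDivisors_of_ne_zero hb⟩) (h ▸ h1), fun h1 => h ▸ isIntegral_of_integralRel h1⟩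

/-- If `R / x` is normal for a prime element `x` of the maximal ideal, then `R` is normal. -/
theorem isIntegrallyClosed_of_prime [IsDomain R] [IsNoetherianRing R] [IsLocalRing R] {x : R}
    (hxm : x ∈ maximalIdeal R) (hx : Prime x) [IsIntegrallyClosed (R ⧸ Ideal.span {x})] :
    IsIntegrallyClosed R := by
  rw [isIntegrallyClosed_iff_dvd]
  intro a₀ b hb hrel₀
  by_contra hdvd
  have hb0 : b ≠ 0 := nonZeroDivisors.ne_zero hb
  let φ := algebraMap R (FractionRing R)
  have hφ : Function.Injective φ := IsFractionRing.injective R _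
  have hφ0 : ∀ {r : R}, r ≠ 0 → φ r ≠ 0 := fun hr h => hr (hφ (h.trans (map_zero φ).symm))
  -- an associated prime of the conductor
  obtain ⟨r, P, hP, hPmem⟩ : ∃ (r : R) (P : Ideal R), P.IsPrime ∧ ∀ p, p ∈ P ↔ b ∣ p * (r * a₀) := by
    let α : R ⧸ Ideal.span {b} := Ideal.Quotient.mk _ a₀
    have hα : α ≠ 0 := fun h => hdvd (Ideal.mem_span_singleton.1 (Ideal.Quotient.eq_zero_iff_mem.1 h))
    have : Nontrivial (Submodule.span R {α}) :=
      ⟨⟨⟨α, Submodule.mem_span_singleton_self α⟩, 0, fun h => hα (congrArg Subtype.val h)⟩⟩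
    obtain ⟨P, hP⟩ := associatedPrimes.nonempty R (Submodule.span R {α})
    obtain ⟨hPp, ⟨y, hy⟩, hPy⟩ := isAssociatedPrime_iff.1 (AssociatedPrimes.mem_iff.1 hP)
    obtain ⟨r, rfl⟩ := Submodule.mem_span_singleton.1 hy
    refine ⟨r, P, hPp, fun p => ?_⟩
    rw [hPy, Submodule.mem_colon_singleton, Submodule.mem_bot, ← Subtype.coe_inj,
      ← Ideal.mem_span_singleton, ← Ideal.Quotient.eq_zero_iff_mem]
    rfl
  set a := r * a₀ with ha
  have hPtop : ¬ b ∣ a := fun h => hP.ne_top ((Ideal.eq_top_iff_one _).2 ((hPmem 1).2 (by rwa [one_mul])))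
  have hbP : b ∈ P := (hPmem b).2 (dvd_mul_right _ _)
  have hrel : IsIntegral R (φ a / φ b) := by
    have h1 := ((isIntegral_div_iff hb0).2 hrel₀).smul r
    have h2 : r • (φ a₀ / φ b) = φ a / φ b := by
      rw [Algebra.smul_def, ha, map_mul, mul_div_assoc]
    rwa [← h2]
  have hrel' : ∀ {u p : R}, p ≠ 0 → p * a = b * u → IntegralRel u p := fun {u p} hp h => by
    refine (isIntegral_div_iff hp).1 ?_
    have h1 : φ u / φ p = φ a / φ b := by
      rw [div_eq_div_iff (hφ0 hp) (hφ0 hb0), ← map_mul, ← map_mul]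
      congr 1
      linear_combination -h
    exact h1 ▸ hrel
  -- If `x a = b w`, then `w / x = a / b` is integral; as `(x)` is prime, this forces `x ∣ w`, and
  -- so `b ∣ a`.
  have hxP : x ∉ P := fun h => by
    obtain ⟨w, hw⟩ := (hPmem x).1 h
    have : (Ideal.span {x}).IsPrime := (Ideal.span_singleton_prime hx.ne_zero).2 hx
    obtain ⟨w', rfl⟩ := Ideal.mem_span_singleton.1
      ((hrel' hx.ne_zero hw).mem_of_mem (Ideal.mem_span_singleton_self x))
    exact hPtop ⟨w', mul_left_cancel₀ hx.ne_zero (by linear_combination hw)⟩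
  obtain ⟨p, hpP, hxp⟩ : ∃ p ∈ P, ¬ x ∣ p := by
    by_contra! h
    have h1 : P ≤ Ideal.span {x} • P := fun p hp => by
      obtain ⟨q, rfl⟩ := h p hp
      exact Submodule.smul_mem_smul (Ideal.mem_span_singleton_self x)
        ((hP.mem_or_mem hp).resolve_left hxP)
    have h2 := Submodule.eq_bot_of_le_smul_of_le_jacobson_bot _ P (IsNoetherian.noetherian P) h1
      ((Ideal.span_singleton_le_iff_mem _).2 (maximalIdeal_le_jacobson _ hxm))
    exact hb0 ((Submodule.mem_bot R).1 (h2 ▸ hbP))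
  -- the ring of multipliers of `P`
  let E : Submodule R (FractionRing R) :=
    { carrier := {y | ∀ p ∈ P, ∃ q ∈ P, y * φ p = φ q}
      add_mem' := fun {y z} hy hz p hp => by
        obtain ⟨q, hq, h⟩ := hy p hp
        obtain ⟨q', hq', h'⟩ := hz p hp
        exact ⟨q + q', P.add_mem hq hq', by rw [add_mul, h, h', map_add]⟩
      zero_mem' := fun p _ => ⟨0, P.zero_mem, by rw [zero_mul, map_zero]⟩
      smul_mem' := fun t y hy p hp => by
        obtain ⟨q, hq, h⟩ := hy p hp
        exact ⟨t * q, P.mul_mem_left _ hq, by rw [Algebra.smul_def, mul_assoc, h, map_mul]⟩ }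
  -- If `p a = b u` with `p ∈ P`, then `u / p` is integral, so `u` lies in the prime `P` together
  -- with `p`.
  have hγE : φ a / φ b ∈ E := fun p hp => by
    obtain ⟨u, hu⟩ := (hPmem p).1 hp
    refine ⟨u, ?_, ?_⟩
    · rcases eq_or_ne p 0 with rfl | hp0
      · rw [zero_mul, eq_comm, mul_eq_zero] at hu
        rw [hu.resolve_left hb0]
        exact P.zero_mem
      · exact (hrel' hp0 hu).mem_of_mem hp
    · rw [div_mul_eq_mul_div, div_eq_iff (hφ0 hb0), ← map_mul, ← map_mul]
      congr 1
      linear_combination hu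
  have hEint : ∀ y ∈ E, IsIntegral R y := fun y hy => by
    refine isIntegral_of_smul_mem_submodule (M := FractionRing R)
      (Submodule.map (Algebra.linearMap R (FractionRing R)) P) ?_
      ((IsNoetherian.noetherian P).map _) y ?_
    · rw [Submodule.ne_bot_iff]
      exact ⟨φ b, ⟨b, hbP, rfl⟩, hφ0 hb0⟩
    · rintro _ ⟨p, hp, rfl⟩
      obtain ⟨q, hq, h⟩ := hy p hp
      exact ⟨q, hq, h.symm⟩
  have hEfg : E.FG := by
    have hle : E ≤ Submodule.span R {(φ b)⁻¹} := fun y hy => by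
      obtain ⟨q, _, h⟩ := hy b hbP
      refine Submodule.mem_span_singleton.2 ⟨q, ?_⟩
      rw [Algebra.smul_def]
      exact ((eq_mul_inv_iff_mul_eq₀ (hφ0 hb0)).2 h).symm
    have := isNoetherian_span_of_finite R (Set.finite_singleton ((φ b)⁻¹))
    have := isNoetherian_of_le hle
    exact (Submodule.fg_top E).1 (IsNoetherian.noetherian ⊤)
  -- Write `y = q / p` with `x ∤ p`. Normality of `R / x` gives `t` with `q` congruent to `t p`
  -- modulo `x`, and `(y - t) / x` again multiplies `P` into itself because `x` is prime and `x ∉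
  -- P`.
  have hkey : E ≤ Submodule.span R {1} ⊔ Ideal.span {x} • E := fun y hy => by
    obtain ⟨q, hq, hyp⟩ := hy p hpP
    have hp0 : p ≠ 0 := fun h => hxp (h ▸ dvd_zero x)
    have hy' : y = φ q / φ p := (eq_div_of_mul_eq (hφ0 hp0) hyp)
    have hqp : IntegralRel q p := (isIntegral_div_iff hp0).1 (hy' ▸ hEint y hy)
    have : (Ideal.span {x}).IsPrime := (Ideal.span_singleton_prime hx.ne_zero).2 hx
    have h1 := isIntegrallyClosed_iff_dvd.1 ‹IsIntegrallyClosed (R ⧸ Ideal.span {x})› _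
      (Ideal.Quotient.mk _ p) (mem_nonZeroDivisors_of_ne_zero fun h =>
        hxp (Ideal.mem_span_singleton.1 (Ideal.Quotient.eq_zero_iff_mem.1 h)))
      (hqp.map (Ideal.Quotient.mk (Ideal.span {x})))
    obtain ⟨t, ht⟩ := h1
    obtain ⟨t, rfl⟩ := Ideal.Quotient.mk_surjective t
    rw [← map_mul, Ideal.Quotient.eq, Ideal.mem_span_singleton] at ht
    obtain ⟨w, hw⟩ := ht
    have hyt : (y - φ t) * φ p = φ x * φ w := by
      rw [sub_mul, hyp, ← map_mul, ← map_mul, ← map_sub, ← hw, mul_comm p]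
    have hx0 := hφ0 hx.ne_zero
    have hE' : (y - φ t) / φ x ∈ E := fun p' hp' => by
      obtain ⟨z, hz, hyz⟩ := hy p' hp'
      have h2 : (y - φ t) * φ p' = φ (z - t * p') := by rw [sub_mul, hyz, map_sub, map_mul]
      have h3 : (z - t * p') * p = x * (w * p') := hφ (by
        rw [map_mul, ← h2, map_mul, map_mul]
        linear_combination φ p' * hyt)
      obtain ⟨z', hz'⟩ := (hx.dvd_or_dvd ⟨_, h3⟩).resolve_right hxp
      have h4 : x * z' ∈ P := hz' ▸ P.sub_mem hz (P.mul_mem_left _ hp')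
      refine ⟨z', (hP.mem_or_mem h4).resolve_left hxP, ?_⟩
      rw [div_mul_eq_mul_div, h2, hz', map_mul, mul_div_cancel_left₀ _ hx0]
    have h5 : y = t • (1 : FractionRing R) + x • ((y - φ t) / φ x) := by
      rw [Algebra.smul_def, Algebra.smul_def, mul_div_cancel₀ _ hx0]
      change y = φ t * 1 + (y - φ t)
      ring
    rw [h5]
    exact Submodule.add_mem_sup (Submodule.smul_mem _ _ (Submodule.mem_span_singleton_self 1))
      (Submodule.smul_mem_smul (Ideal.mem_span_singleton_self x) hE')
  -- Nakayama's lemma gives `E ≤ R`, so `a / b` lies in `R`, contradicting the choice of `a`.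
  have hE1 := Submodule.le_of_le_smul_of_le_jacobson_bot hEfg
    ((Ideal.span_singleton_le_iff_mem _).2 (maximalIdeal_le_jacobson _ hxm)) hkey hγE
  obtain ⟨t, ht⟩ := Submodule.mem_span_singleton.1 hE1
  refine hPtop ⟨t, hφ ?_⟩
  rw [Algebra.smul_def, mul_one, eq_div_iff (hφ0 hb0)] at ht
  rw [← ht, map_mul, mul_comm]

/-- As `x ∉ m²`, some coefficient of `x` in a minimal generating set of `m` is a unit, and the
corresponding generator becomes redundant modulo `x`. -/
theorem spanFinrank_maximalIdeal_quotient_lt [IsLocalRing R] [IsNoetherianRing R] {x : R}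
    (hxm : x ∈ maximalIdeal R) (hx2 : x ∉ maximalIdeal R ^ 2) [IsLocalRing (R ⧸ Ideal.span {x})] :
    (maximalIdeal (R ⧸ Ideal.span {x})).spanFinrank < (maximalIdeal R).spanFinrank := by
  classical
  obtain ⟨s, hcard, hs⟩ := Submodule.FG.exists_span_finset_card_eq_spanFinrank
    (IsNoetherian.noetherian (maximalIdeal R))
  have hsm : ∀ a ∈ s, a ∈ maximalIdeal R := fun a ha => hs ▸ Submodule.subset_span ha
  obtain ⟨f, -, hf⟩ := Submodule.mem_span_finset.1 (hs ▸ hxm)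
  obtain ⟨a, ha, hfa⟩ : ∃ a ∈ s, IsUnit (f a) := by
    by_contra! h
    refine hx2 ?_
    rw [← hf, sq]
    exact Ideal.sum_mem _ fun a ha => Ideal.mul_mem_mul ((mem_maximalIdeal _).2 (h a ha)) (hsm a ha)
  let π := Ideal.Quotient.mk (Ideal.span {x})
  have hπx : π x = 0 := Ideal.Quotient.eq_zero_iff_mem.2 (Ideal.mem_span_singleton_self x)
  have hπ : Function.Surjective π := Ideal.Quotient.mk_surjective
  have hmax : maximalIdeal (R ⧸ Ideal.span {x}) = Ideal.span (π '' (s.erase a : Finset R)) := by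
    have h1 : maximalIdeal (R ⧸ Ideal.span {x}) = (maximalIdeal R).map π :=
      (IsLocalRing.map_maximalIdeal_of_surjective π hπ).symm
    rw [h1, ← hs]
    change Ideal.map π (Ideal.span (s : Set R)) = _
    rw [Ideal.map_span]
    refine le_antisymm (Ideal.span_le.2 ?_) (Ideal.span_mono (Set.image_mono (by simp)))
    rintro _ ⟨y, hy, rfl⟩
    rcases eq_or_ne y a with rfl | hya
    · have h2 : π (f y) * π y = -∑ z ∈ s.erase y, π (f z) * π z := by
        rw [← Finset.add_sum_erase _ _ ha] at hf
        have h3 := congrArg π hf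
        rw [hπx, map_add, map_sum] at h3
        simp only [smul_eq_mul, map_mul] at h3
        exact eq_neg_of_add_eq_zero_left h3
      refine (Ideal.unit_mul_mem_iff_mem _ (hfa.map π)).1 ?_
      rw [h2]
      exact neg_mem (Ideal.sum_mem _ fun z hz => Ideal.mul_mem_left _ _
        (Ideal.subset_span ⟨z, hz, rfl⟩))
    · exact Ideal.subset_span ⟨y, by simpa [hya] using hy, rfl⟩
  rw [hmax, ← hcard]
  refine (Submodule.spanFinrank_span_le_ncard_of_finite ((Finset.finite_toSet _).image _)).trans_lt ?_
  refine (Set.ncard_image_le (Finset.finite_toSet _)).trans_lt ?_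
  rw [Set.ncard_coe_finset]
  exact Finset.card_erase_lt_of_mem ha

/-- Induction on the dimension. Choose `x ∈ m` outside `m²` and all minimal primes; then `R / x` is
regular of smaller dimension, hence a normal domain, and `(x)` is prime. A minimal prime `P ≤ (x)`
not containing `x` satisfies `P = x P`, so `P = 0` by Nakayama, and `isIntegrallyClosed_of_prime`
applies. -/
theorem IsRegularLocalRing.isDomain_and_isIntegrallyClosed (d : ℕ) :
    ∀ (R : Type*) [CommRing R] [IsRegularLocalRing R], (maximalIdeal R).spanFinrank = d →
      IsDomain R ∧ IsIntegrallyClosed R := by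
  induction d with
  | zero =>
    intro R _ _ hd
    have hm : maximalIdeal R = ⊥ :=
      (Submodule.spanFinrank_eq_zero_iff_eq_bot (IsNoetherian.noetherian _)).1 hd
    have hunit : ∀ r : R, r ≠ 0 → IsUnit r := fun r hr => by
      by_contra h
      exact hr ((Submodule.mem_bot R).1 (hm ▸ (mem_maximalIdeal r).2 h))
    have : NoZeroDivisors R := ⟨fun {a b} hab => by
      by_contra! h
      exact h.2 ((hunit a h.1).mul_right_eq_zero.1 hab)⟩
    refine ⟨NoZeroDivisors.to_isDomain R, isIntegrallyClosed_iff_dvd.2 fun a b hb _ => ?_⟩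
    exact (hunit b (nonZeroDivisors.ne_zero hb)).dvd
  | succ d ih =>
    intro R _ _ hd
    have hdim : ringKrullDim R = (d + 1 : ℕ) := by
      rw [← hd, IsRegularLocalRing.spanFinrank_maximalIdeal]
    obtain ⟨x, hxm, hx2, hxP⟩ : ∃ x ∈ maximalIdeal R, x ∉ maximalIdeal R ^ 2 ∧
        ∀ P ∈ minimalPrimes R, x ∉ P := by
      by_contra! h
      have hsub : ((maximalIdeal R : Ideal R) : Set R) ⊆
          ⋃ I ∈ insert (maximalIdeal R ^ 2) (minimalPrimes R), (I : Set R) := fun x hx => by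
        by_cases hx2 : x ∈ maximalIdeal R ^ 2
        · exact Set.mem_biUnion (Set.mem_insert _ _) hx2
        · obtain ⟨P, hP, hxP⟩ := h x hx hx2
          exact Set.mem_biUnion (Set.mem_insert_of_mem _ hP) hxP
      -- Prime avoidance tolerates `m²` as the exceptional non-prime member.
      obtain ⟨I, hI, hle⟩ := (Ideal.subset_union_prime_finite (f := id)
        ((minimalPrimes.finite_of_isNoetherianRing R).insert _) (maximalIdeal R ^ 2)
        (maximalIdeal R ^ 2) fun I hI h1 _ => (hI.resolve_left h1).1.1).1 hsub
      rcases hI with rfl | hI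
      · have hle : maximalIdeal R ≤ maximalIdeal R • maximalIdeal R := by
          rw [smul_eq_mul, ← sq]
          exact hle
        have h0 := Submodule.eq_bot_of_le_smul_of_le_jacobson_bot _ _
          (IsNoetherian.noetherian (maximalIdeal R)) hle (maximalIdeal_le_jacobson _)
        rw [h0, Submodule.spanFinrank_bot] at hd
        omega
      · have hIp : I.IsPrime := hI.1.1
        have heq : maximalIdeal R = I := le_antisymm hle (le_maximalIdeal hIp.ne_top)
        have h0 : (maximalIdeal R).height = 0 := by
          rw [heq, Ideal.height_eq_zero_iff]
          exact hI
        have h1 := maximalIdeal_height_eq_ringKrullDim (R := R)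
        rw [h0, hdim] at h1
        norm_cast at h1
    have hne : Nontrivial (R ⧸ Ideal.span {x}) := Ideal.Quotient.nontrivial_iff.2 fun h =>
      (mem_maximalIdeal x).1 hxm (Ideal.span_singleton_eq_top.1 h)
    have : IsLocalRing (R ⧸ Ideal.span {x}) :=
      IsLocalRing.of_surjective' (Ideal.Quotient.mk _) Ideal.Quotient.mk_surjective
    have hlt := spanFinrank_maximalIdeal_quotient_lt hxm hx2
    have hge : ((d : ℕ) : WithBot ℕ∞) ≤ ringKrullDim (R ⧸ Ideal.span {x}) := by
      have h1 := Ideal.height_le_ringKrullDim_quotient_add_one hxm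
      rw [maximalIdeal_height_eq_ringKrullDim, hdim] at h1
      rw [Nat.cast_add, Nat.cast_one] at h1
      exact ENat.WithBot.add_le_add_one_right_iff.1 h1
    have hreg : IsRegularLocalRing (R ⧸ Ideal.span {x}) := by
      refine IsRegularLocalRing.of_spanFinrank_maximalIdeal_le _ (le_trans ?_ hge)
      exact_mod_cast (by omega)
    have hd' : (maximalIdeal (R ⧸ Ideal.span {x})).spanFinrank = d := by
      refine le_antisymm (by omega) ?_
      have h1 := hge.trans (ringKrullDim_le_spanFinrank_maximalIdeal (R := R ⧸ Ideal.span {x}))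
      exact_mod_cast h1
    obtain ⟨hdom, hic⟩ := ih (R ⧸ Ideal.span {x}) hd'
    have hprime : (Ideal.span {x}).IsPrime := (Ideal.Quotient.isDomain_iff_prime _).1 hdom
    obtain ⟨P, hP, hPx⟩ := Ideal.exists_minimalPrimes_le (bot_le : ⊥ ≤ Ideal.span {x})
    have hPp : P.IsPrime := hP.1.1
    have hP0 : P = ⊥ := by
      refine Submodule.eq_bot_of_le_smul_of_le_jacobson_bot (Ideal.span {x}) P
        (IsNoetherian.noetherian P) (fun p hp => ?_)
        ((Ideal.span_singleton_le_iff_mem _).2 (maximalIdeal_le_jacobson _ hxm))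
      obtain ⟨q, rfl⟩ := Ideal.mem_span_singleton.1 (hPx hp)
      exact Submodule.smul_mem_smul (Ideal.mem_span_singleton_self x)
        ((hPp.mem_or_mem hp).resolve_left (hxP P hP))
    have : IsDomain R := by
      have : NoZeroDivisors R := ⟨fun {a b} hab => by
        simpa [hP0] using hPp.mem_or_mem (x := a) (y := b) (hab ▸ P.zero_mem)⟩
      exact NoZeroDivisors.to_isDomain R
    have hx0 : x ≠ 0 := fun h => hxP P hP (h ▸ P.zero_mem)
    exact ⟨this, isIntegrallyClosed_of_prime hxm ((Ideal.span_singleton_prime hx0).1 hprime)⟩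

end Regular

/-! ### Depth and exchange of regular elements -/

section Depth

open IsLocalRing

variable {R : Type*} [CommRing R]

theorem Ideal.mem_sup_span_singleton_iff {J : Ideal R} {r w : R} :
    r ∈ J ⊔ Ideal.span {w} ↔ ∃ v, r - w * v ∈ J := by
  rw [sup_comm, Ideal.mem_span_singleton_sup]
  refine ⟨fun ⟨v, j, hj, h⟩ => ⟨v, ?_⟩, fun ⟨v, hv⟩ => ⟨v, _, hv, by ring⟩⟩
  rwa [← h, mul_comm v, add_sub_cancel_left]

/-- `x` is a nonzerodivisor modulo `J`. -/
def Ideal.RegularMod (J : Ideal R) (x : R) : Prop := ∀ z, x * z ∈ J → z ∈ J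

namespace Ideal.RegularMod

variable {J : Ideal R} {x y z : R}

theorem mem_of_forall_mul_mem [IsLocalRing R] {s : R} (hs : s ∈ maximalIdeal R)
    (h : J.RegularMod s) (u : R) (hu : ∀ z ∈ maximalIdeal R, z * u ∈ J) : u ∈ J :=
  h u (hu s hs)

/-- Prime avoidance for `R ⧸ J₁ × R ⧸ J₂`: without such an `s`, the maximal ideal would lie in an
associated prime and kill a nonzero element. Treating both ideals at once provides the common
element that `exchange_two` needs. -/
theorem exists_of_forall_mul_mem [IsLocalRing R] [IsNoetherianRing R] {J₁ J₂ : Ideal R}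
    (h₁ : ∀ u, (∀ z ∈ maximalIdeal R, z * u ∈ J₁) → u ∈ J₁)
    (h₂ : ∀ u, (∀ z ∈ maximalIdeal R, z * u ∈ J₂) → u ∈ J₂) :
    ∃ s ∈ maximalIdeal R, J₁.RegularMod s ∧ J₂.RegularMod s := by
  by_contra! h
  let M := (R ⧸ J₁) × (R ⧸ J₂)
  have hM : ∀ r ∈ maximalIdeal R, ¬ IsSMulRegular M r := fun r hr hreg => by
    refine h r hr (fun z hz => ?_) fun z hz => ?_
    · have h1 : r • ((Ideal.Quotient.mk J₁ z, 0) : M) = r • 0 :=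
        Prod.ext (by
          change Ideal.Quotient.mk J₁ (r * z) = _
          rw [Ideal.Quotient.eq_zero_iff_mem.2 hz]
          simp) (by simp)
      exact Ideal.Quotient.eq_zero_iff_mem.1 (congrArg Prod.fst (hreg h1))
    · have h1 : r • ((0, Ideal.Quotient.mk J₂ z) : M) = r • 0 :=
        Prod.ext (by simp) (by
          change Ideal.Quotient.mk J₂ (r * z) = _
          rw [Ideal.Quotient.eq_zero_iff_mem.2 hz]
          simp)
      exact Ideal.Quotient.eq_zero_iff_mem.1 (congrArg Prod.snd (hreg h1))
  have hsub : ((maximalIdeal R : Ideal R) : Set R) ⊆ ⋃ P ∈ associatedPrimes R M, (P : Set R) := by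
    rw [biUnion_associatedPrimes_eq_compl_regular R M]
    exact fun r hr => hM r hr
  obtain ⟨P, hP, hle⟩ := (Ideal.subset_union_prime_finite (f := id)
    (associatedPrimes.finite R M) ⊥ ⊥ fun I hI _ _ => IsAssociatedPrime.isPrime hI).1 hsub
  obtain ⟨hPp, ⟨u₁, u₂⟩, hPu⟩ := isAssociatedPrime_iff.1 (AssociatedPrimes.mem_iff.1 hP)
  obtain ⟨u₁, rfl⟩ := Ideal.Quotient.mk_surjective u₁
  obtain ⟨u₂, rfl⟩ := Ideal.Quotient.mk_surjective u₂
  have hmem : ∀ r, r ∈ P ↔ r * u₁ ∈ J₁ ∧ r * u₂ ∈ J₂ := fun r => by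
    rw [hPu, Submodule.mem_colon_singleton, Submodule.mem_bot, Prod.ext_iff,
      ← Ideal.Quotient.eq_zero_iff_mem, ← Ideal.Quotient.eq_zero_iff_mem]
    rfl
  refine hPp.ne_top ((Ideal.eq_top_iff_one P).2 ((hmem 1).2 ⟨?_, ?_⟩))
  · rw [one_mul]
    exact h₁ _ fun z hz => ((hmem z).1 (hle hz)).1
  · rw [one_mul]
    exact h₂ _ fun z hz => ((hmem z).1 (hle hz)).2

/-- The socles modulo `x` and modulo `y` correspond. If `m u` lies in `J + (y)`, write `x u = y v`
modulo `J`; then `m v` lies in `J + (x)`, so `v = x w` modulo `J`, and cancelling `x` gives `u = y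
w` modulo `J`. -/
theorem exchange [IsLocalRing R] [IsNoetherianRing R] (hxm : x ∈ maximalIdeal R)
    (hx : J.RegularMod x) (hy : J.RegularMod y)
    (h : ∃ s ∈ maximalIdeal R, (J ⊔ span {x}).RegularMod s) :
    ∃ s ∈ maximalIdeal R, (J ⊔ span {y}).RegularMod s := by
  obtain ⟨s, hs, hreg⟩ := h
  have hsoc : ∀ u, (∀ z ∈ maximalIdeal R, z * u ∈ J ⊔ span {y}) → u ∈ J ⊔ span {y} := fun u hu => by
    simp only [mem_sup_span_singleton_iff] at hu ⊢
    obtain ⟨v, hv⟩ := hu x hxm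
    obtain ⟨w', hw'⟩ := mem_sup_span_singleton_iff.1
      (hreg.mem_of_forall_mul_mem hs v fun z hz => by
        obtain ⟨w, hw⟩ := hu z hz
        refine mem_sup_span_singleton_iff.2 ⟨w, hy _ ?_⟩
        have := J.sub_mem (J.mul_mem_left x hw) (J.mul_mem_left z hv)
        convert this using 1
        ring)
    refine ⟨w', hx _ ?_⟩
    have := J.add_mem hv (J.mul_mem_left y hw')
    convert this using 1
    ring
  obtain ⟨t, ht, h1, -⟩ := exists_of_forall_mul_mem hsoc hsoc
  exact ⟨t, ht, h1⟩

/-- From `x u = z v` modulo `J` follows `v = x w` modulo `J`, and `x` can be cancelled. -/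
theorem swap (hx : J.RegularMod x) (hz : (J ⊔ span {x}).RegularMod z) :
    (J ⊔ span {z}).RegularMod x := fun u hu => by
  obtain ⟨v, hv⟩ := mem_sup_span_singleton_iff.1 hu
  obtain ⟨w, hw⟩ := mem_sup_span_singleton_iff.1 (hz v (mem_sup_span_singleton_iff.2 ⟨u, by
    have := J.neg_mem hv
    convert this using 1
    ring⟩))
  refine mem_sup_span_singleton_iff.2 ⟨w, hx _ ?_⟩
  have := J.add_mem hv (J.mul_mem_left z hw)
  convert this using 1
  ring

/-- Pick `z` regular modulo both `J + (x)` and `J + (y)`. Exchange `s` for `z` modulo `J + (x)`,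
permute, and then exchange `x` for `y` modulo `J + (z)`. -/
theorem exchange_two [IsLocalRing R] [IsNoetherianRing R] (hxm : x ∈ maximalIdeal R)
    (hx : J.RegularMod x) (hy : J.RegularMod y)
    (h : ∃ s ∈ maximalIdeal R, (J ⊔ span {x}).RegularMod s ∧
      ∃ t ∈ maximalIdeal R, (J ⊔ span {x} ⊔ span {s}).RegularMod t) :
    ∃ s ∈ maximalIdeal R, (J ⊔ span {y}).RegularMod s ∧
      ∃ t ∈ maximalIdeal R, (J ⊔ span {y} ⊔ span {s}).RegularMod t := by
  obtain ⟨s, hs, hxs, ht⟩ := h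
  obtain ⟨s', hs', hys'⟩ := exchange hxm hx hy ⟨s, hs, hxs⟩
  obtain ⟨z, hz, hxz, hyz⟩ := exists_of_forall_mul_mem (hxs.mem_of_forall_mul_mem hs)
    (hys'.mem_of_forall_mul_mem hs')
  have hw := exchange hs hxs hxz ht
  refine ⟨z, hz, hyz, ?_⟩
  rw [sup_right_comm] at hw ⊢
  exact exchange hxm (hx.swap hxz) (hy.swap hyz) hw

theorem map_mk_iff {I : Ideal R} :
    (I.map (Ideal.Quotient.mk J)).RegularMod (Ideal.Quotient.mk J x) ↔ (J ⊔ I).RegularMod x := by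
  simp only [RegularMod, Ideal.Quotient.mk_surjective.forall, ← map_mul, mem_quotient_iff_mem_sup,
    sup_comm I]

theorem ringKrullDim_quotient_succ [IsLocalRing R] [IsNoetherianRing R] (hxm : x ∈ maximalIdeal R)
    (hJ : J ≠ ⊤) (hx : J.RegularMod x) :
    ringKrullDim (R ⧸ J ⊔ span {x}) + 1 = ringKrullDim (R ⧸ J) := by
  have : Nontrivial (R ⧸ J) := Ideal.Quotient.nontrivial_iff.2 hJ
  have : IsLocalRing (R ⧸ J) :=
    IsLocalRing.of_surjective' (Ideal.Quotient.mk J) Ideal.Quotient.mk_surjective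
  have hreg : IsSMulRegular (R ⧸ J) (Ideal.Quotient.mk J x) := by
    rw [isSMulRegular_iff_right_eq_zero_of_smul]
    intro z hz
    obtain ⟨z, rfl⟩ := Ideal.Quotient.mk_surjective z
    rw [smul_eq_mul, ← map_mul, Ideal.Quotient.eq_zero_iff_mem] at hz
    exact Ideal.Quotient.eq_zero_iff_mem.2 (hx z hz)
  have hmem : Ideal.Quotient.mk J x ∈ maximalIdeal (R ⧸ J) := by
    rw [← IsLocalRing.map_maximalIdeal_of_surjective _ Ideal.Quotient.mk_surjective]
    exact Ideal.mem_map_of_mem _ hxm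
  rw [← ringKrullDim_quotient_span_singleton_succ_eq_ringKrullDim hreg hmem,
    ← ringKrullDim_eq_of_ringEquiv (DoubleQuot.quotQuotEquivQuotSup J (span {x})), Ideal.map_span,
    Set.image_singleton]

end Ideal.RegularMod

theorem Ideal.exists_maximalIdeal_pow_le_of_ringKrullDim_eq_zero [IsLocalRing R]
    [IsNoetherianRing R] {J : Ideal R} (h : ringKrullDim (R ⧸ J) = 0) :
    ∃ N, maximalIdeal R ^ N ≤ J := by
  have hJ : J ≠ ⊤ := fun hJ => by
    have : Subsingleton (R ⧸ J) := Ideal.Quotient.subsingleton_iff.2 hJ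
    rw [ringKrullDim_eq_bot_of_subsingleton] at h
    exact WithBot.bot_ne_zero h
  have : Nontrivial (R ⧸ J) := Ideal.Quotient.nontrivial_iff.2 hJ
  have : IsLocalRing (R ⧸ J) :=
    IsLocalRing.of_surjective' (Ideal.Quotient.mk J) Ideal.Quotient.mk_surjective
  have : Ring.KrullDimLE 0 (R ⧸ J) := ringKrullDimZero_iff_ringKrullDim_eq_zero.2 h
  obtain ⟨N, hN⟩ := (isArtinianRing_iff_isNilpotent_maximalIdeal (R ⧸ J)).1
    (isArtinianRing_iff_krullDimLE_zero.2 this)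
  refine ⟨N, fun r hr => Ideal.Quotient.eq_zero_iff_mem.1 ?_⟩
  have h1 := Ideal.mem_map_of_mem (Ideal.Quotient.mk J) hr
  rwa [Ideal.map_pow, IsLocalRing.map_maximalIdeal_of_surjective _ Ideal.Quotient.mk_surjective,
    hN] at h1

/-- A normal Noetherian local domain of dimension at least two has depth at least two. -/
theorem exists_regularMod_span_singleton [IsLocalRing R] [IsNoetherianRing R] [IsDomain R]
    [IsIntegrallyClosed R] (hdim : 2 ≤ ringKrullDim R) {a : R} (ha : a ≠ 0) :
    ∃ s ∈ maximalIdeal R, (Ideal.span {a}).RegularMod s := by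
  have hsoc : ∀ u, (∀ z ∈ maximalIdeal R, z * u ∈ Ideal.span {a}) → u ∈ Ideal.span {a} := by
    intro u hu
    by_contra hua
    have hu0 : u ≠ 0 := fun h => hua (h ▸ Ideal.zero_mem _)
    simp only [Ideal.mem_span_singleton] at hu hua
    -- Either the fraction `u / a` maps the maximal ideal into itself, so it is integral and `a ∣
    -- u`, or some product with it is a unit.
    by_cases hcase : ∀ z ∈ maximalIdeal R, ∃ w ∈ maximalIdeal R, z * u = a * w
    · refine hua (isIntegrallyClosed_iff_dvd.1 ‹_› u a (mem_nonZeroDivisors_of_ne_zero ha)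
        ((isIntegral_div_iff ha).1 ?_))
      let φ := algebraMap R (FractionRing R)
      have hφ : Function.Injective φ := IsFractionRing.injective R _
      have hφ0 : ∀ {r : R}, r ≠ 0 → φ r ≠ 0 := fun hr h => hr (hφ (h.trans (map_zero φ).symm))
      have hm : maximalIdeal R ≠ ⊥ := fun h => by
        have := ringKrullDim_eq_zero_of_isField (isField_iff_maximalIdeal_eq.2 h)
        rw [this] at hdim
        exact absurd hdim (by norm_num)
      obtain ⟨z, hz, hz0⟩ := Submodule.exists_mem_ne_zero_of_ne_bot hm
      refine isIntegral_of_smul_mem_submodule (M := FractionRing R)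
        (Submodule.map (Algebra.linearMap R (FractionRing R)) (maximalIdeal R)) ?_
        ((IsNoetherian.noetherian _).map _) _ ?_
      · rw [Submodule.ne_bot_iff]
        exact ⟨φ z, ⟨z, hz, rfl⟩, hφ0 hz0⟩
      · rintro _ ⟨p, hp, rfl⟩
        obtain ⟨w, hw, h⟩ := hcase p hp
        refine ⟨w, hw, ?_⟩
        change φ w = φ u / φ a * φ p
        rw [div_mul_eq_mul_div, eq_div_iff (hφ0 ha), ← map_mul, ← map_mul]
        congr 1
        linear_combination -h
    -- Here `x u = a v` with `v` a unit; this makes `x` generate the maximal ideal, against `2 ≤ dim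
    -- R`.
    · push Not at hcase
      obtain ⟨x, hxm, hx⟩ := hcase
      obtain ⟨v, hv⟩ := hu x hxm
      have hvu : IsUnit v := by
        by_contra h
        exact hx v ((mem_maximalIdeal v).2 h) hv
      have hmax : maximalIdeal R = Ideal.span {x} := by
        refine le_antisymm (fun y hy => ?_) ((Ideal.span_singleton_le_iff_mem _).2 hxm)
        obtain ⟨w, hw⟩ := hu y hy
        refine Ideal.mem_span_singleton.2 ((hvu.dvd_mul_right).1 ⟨w, ?_⟩)
        have : a * u ≠ 0 := mul_ne_zero ha hu0
        refine mul_left_cancel₀ this ?_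
        linear_combination a * v * hw - a * w * hv
      have h1 := hdim.trans (ringKrullDim_le_spanFinrank_maximalIdeal (R := R))
      have h2 : (maximalIdeal R).spanFinrank ≤ 1 := by
        rw [hmax]
        exact (Submodule.spanFinrank_span_le_ncard_of_finite (Set.finite_singleton x)).trans
          (Set.ncard_singleton x).le
      have h3 : 2 ≤ (maximalIdeal R).spanFinrank := by exact_mod_cast h1
      omega
  obtain ⟨t, ht, h1, -⟩ := Ideal.RegularMod.exists_of_forall_mul_mem hsoc hsoc
  exact ⟨t, ht, h1⟩

theorem isWeaklyRegular_mk_iff {J : Ideal R} {x y z : R} :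
    RingTheory.Sequence.IsWeaklyRegular (R ⧸ J)
      [Ideal.Quotient.mk J x, Ideal.Quotient.mk J y, Ideal.Quotient.mk J z] ↔
      J.RegularMod x ∧ (J ⊔ Ideal.span {x}).RegularMod y ∧
        (J ⊔ Ideal.span {x} ⊔ Ideal.span {y}).RegularMod z := by
  have key : ∀ (l : List R) (w : R),
      IsSMulRegular ((R ⧸ J) ⧸ (Ideal.ofList (l.map (Ideal.Quotient.mk J)) • ⊤ : Submodule (R ⧸ J) (R ⧸ J)))
        (Ideal.Quotient.mk J w) ↔ (J ⊔ Ideal.ofList l).RegularMod w := fun l w => by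
    rw [isSMulRegular_quotient_iff_mem_of_smul_mem, smul_eq_mul, Ideal.mul_top, ← Ideal.map_ofList,
      ← Ideal.RegularMod.map_mk_iff]
    rfl
  rw [RingTheory.Sequence.isWeaklyRegular_iff_Fin]
  have h0 := key [] x
  have h1 := key [x] y
  have h2 := key [x, y] z
  simp only [Ideal.ofList_nil, sup_bot_eq, Ideal.ofList_cons, ← sup_assoc] at h0 h1 h2
  rw [← h0, ← h1, ← h2]
  exact ⟨fun h => ⟨h 0, h 1, h 2⟩, fun ⟨a, b, c⟩ i => by
    fin_cases i
    exacts [a, b, c]⟩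

end Depth

/-! ### Propagation of membership to nearby points -/

namespace holomorphicGerms

variable {n : ℕ} {p : Fin n → ℂ}

theorem mk_pow_mk {f : (Fin n → ℂ) → ℂ} (hf : AnalyticAt ℂ f p) (k : ℕ) :
    mk f hf ^ k = mk (fun x => f x ^ k) (hf.fun_pow k) := rfl

theorem span_range_option {S κ : Type*} [CommRing S] (f : Option κ → S) :
    Ideal.span (Set.range f) = Ideal.span (Set.range fun k => f (some k)) ⊔ Ideal.span {f none} := by
  rw [← Ideal.span_union]
  congr 1
  ext x
  simp [Option.exists, eq_comm]

/-- Membership in a finitely generated ideal propagates to nearby points. -/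
theorem eventually_mk_mem_span {κ : Type*} [Finite κ] {g : κ → (Fin n → ℂ) → ℂ}
    (hg : ∀ k, AnalyticAt ℂ (g k) p) {h : (Fin n → ℂ) → ℂ} (hh : AnalyticAt ℂ h p)
    (hmem : mk h hh ∈ Ideal.span (Set.range fun k => mk (g k) (hg k))) :
    ∀ᶠ q in 𝓝 p, ∀ (hgq : ∀ k, AnalyticAt ℂ (g k) q) (hhq : AnalyticAt ℂ h q),
      mk h hhq ∈ Ideal.span (Set.range fun k => mk (g k) (hgq k)) := by
  have := Fintype.ofFinite κ
  obtain ⟨c, hc⟩ := Ideal.mem_span_range_iff_exists_fun.1 hmem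
  choose u hu huc using fun k => exists_mk_eq (c k)
  have he : (fun x => ∑ k, u k x * g k x) =ᶠ[𝓝 p] h := by
    rw [← ext_iff_eventuallyEq (hg := Finset.univ.analyticAt_fun_sum fun k _ => (hu k).fun_mul (hg k))
      (hh := hh), ← sum_mk _ fun k => (hu k).fun_mul (hg k), ← hc]
    refine Finset.sum_congr rfl fun k _ => ?_
    rw [← huc k]
    rfl
  filter_upwards [he.eventually_nhds, eventually_all.2 fun k => (hu k).eventually_analyticAt]
    with q hq huq hgq hhq
  refine Ideal.mem_span_range_iff_exists_fun.2 ⟨fun k => mk (u k) (huq k), ?_⟩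
  have h1 := sum_mk Finset.univ fun k => (huq k).fun_mul (hgq k)
  exact h1.trans (ext_iff_eventuallyEq.2 hq)

end holomorphicGerms

/-! ### Serre's criterion for surface germs and the theorem -/

namespace ComplexSpaceGerm

open holomorphicGerms IsLocalRing

theorem idealAt_eq_span (X : ComplexSpaceGerm) {p : Fin X.n → ℂ}
    (h : ∀ i, AnalyticAt ℂ (X.eqn i) p) :
    X.idealAt p = Ideal.span (Set.range fun i => holomorphicGerms.mk (X.eqn i) (h i)) := by
  refine congrArg Ideal.span (Set.ext fun φ => ?_)
  exact ⟨fun ⟨i, _, hφ⟩ => ⟨i, hφ.symm⟩, fun ⟨i, hφ⟩ => ⟨i, h i, hφ.symm⟩⟩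

theorem idealAt_zeroLocus (X : ComplexSpaceGerm) (F : (Fin X.n → ℂ) → ℂ) (hF : AnalyticAt ℂ F 0)
    (hF0 : F 0 = 0) :
    (X.zeroLocus F hF hF0).idealAt 0 = X.idealAt 0 ⊔ Ideal.span {holomorphicGerms.mk F hF} := by
  rw [idealAt_eq_span _ (X.zeroLocus F hF hF0).analyticAt, idealAt_eq_span _ X.analyticAt,
    sup_comm, ← Ideal.span_union]
  refine congrArg Ideal.span (Set.ext fun φ => ?_)
  constructor
  · rintro ⟨i, rfl⟩
    refine Fin.cases ?_ (fun i => ?_) i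
    · exact Or.inl rfl
    · exact Or.inr ⟨i, rfl⟩
  · rintro (rfl | ⟨i, rfl⟩)
    · exact ⟨(0 : Fin (X.k + 1)), rfl⟩
    · exact ⟨i.succ, rfl⟩

variable (X : ComplexSpaceGerm)

theorem ne_top_sup {X : ComplexSpaceGerm} {b : holomorphicGerms X.n 0}
    (hb : b ∈ maximalIdeal (holomorphicGerms X.n 0)) : X.idealAt 0 ⊔ Ideal.span {b} ≠ ⊤ := fun h => by
  have hle : X.idealAt 0 ⊔ Ideal.span {b} ≤ maximalIdeal (holomorphicGerms X.n 0) :=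
    sup_le (le_maximalIdeal X.idealAt_ne_top) ((Ideal.span_singleton_le_iff_mem _).2 hb)
  exact (maximalIdeal.isMaximal _).ne_top (top_le_iff.1 (h ▸ hle))

/-- On a surface germ of depth two, membership in a principal ideal generated by a nonzerodivisor
can be tested away from the base point. -/
theorem mk_mem_sup_of_eventually (hdim : ringKrullDim X.localRing = 2)
    (hdepth : ∃ c ∈ maximalIdeal (holomorphicGerms X.n 0), (X.idealAt 0).RegularMod c ∧
      ∃ d ∈ maximalIdeal (holomorphicGerms X.n 0), (X.idealAt 0 ⊔ Ideal.span {c}).RegularMod d)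
    {a b : (Fin X.n → ℂ) → ℂ} (ha : AnalyticAt ℂ a 0) (hb : AnalyticAt ℂ b 0)
    (hbm : holomorphicGerms.mk b hb ∈ maximalIdeal (holomorphicGerms X.n 0))
    (hreg : (X.idealAt 0).RegularMod (holomorphicGerms.mk b hb))
    (hloc : ∀ᶠ p in 𝓝[≠] (0 : Fin X.n → ℂ), ∀ (_ : ∀ i, AnalyticAt ℂ (X.eqn i) p)
      (hap : AnalyticAt ℂ a p) (hbp : AnalyticAt ℂ b p), (∀ i, X.eqn i p = 0) →
        holomorphicGerms.mk a hap ∈ X.idealAt p ⊔ Ideal.span {holomorphicGerms.mk b hbp}) :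
    holomorphicGerms.mk a ha ∈ X.idealAt 0 ⊔ Ideal.span {holomorphicGerms.mk b hb} := by
  obtain ⟨c, hcm, hc, hd⟩ := hdepth
  -- Depth two passes from `c` to `b`. Each regular element lowers the dimension by one, so the
  -- ideal with `b` and `s` added has a quotient of dimension zero and contains a power of the
  -- maximal ideal.
  obtain ⟨s, hsm, hs⟩ := Ideal.RegularMod.exchange hcm hc hreg hd
  obtain ⟨s, hs', rfl⟩ := exists_mk_eq s
  have hdim0 : ringKrullDim (holomorphicGerms X.n 0 ⧸
      X.idealAt 0 ⊔ Ideal.span {holomorphicGerms.mk b hb} ⊔ Ideal.span {holomorphicGerms.mk s hs'}) = 0 := by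
    have h1 := hreg.ringKrullDim_quotient_succ hbm X.idealAt_ne_top
    have h2 := hs.ringKrullDim_quotient_succ hsm (ne_top_sup hbm)
    rw [show ringKrullDim (holomorphicGerms X.n 0 ⧸ X.idealAt 0) = 1 + 1 from
      hdim.trans one_add_one_eq_two.symm, ENat.WithBot.add_one_cancel] at h1
    rw [h1] at h2
    exact ENat.WithBot.add_one_cancel.1 (h2.trans (zero_add 1).symm)
  obtain ⟨N, hN⟩ := Ideal.exists_maximalIdeal_pow_le_of_ringKrullDim_eq_zero hdim0
  let g : Option (Fin X.k) → (Fin X.n → ℂ) → ℂ := fun o => o.elim b X.eqn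
  have hg : ∀ o, AnalyticAt ℂ (g o) 0 := fun o => by
    cases o
    exacts [hb, X.analyticAt _]
  have hspan : Ideal.span (Set.range fun o => holomorphicGerms.mk (g o) (hg o)) =
      X.idealAt 0 ⊔ Ideal.span {holomorphicGerms.mk b hb} := by
    rw [span_range_option, idealAt_eq_span X X.analyticAt]
    rfl
  rw [← hspan] at hs hN ⊢
  refine mk_mem_span_of_eventually hg ha hs' (mem_maximalIdeal_iff.1 hsm) hs (N := N)
    (fun i => hN (Ideal.pow_mem_pow (mem_maximalIdeal_iff.2 rfl) N)) ?_
  filter_upwards [hloc] with p hp hgp hap h0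
  have := hp (fun i => hgp (some i)) hap (hgp none) fun i => h0 (some i)
  rw [span_range_option]
  rwa [idealAt_eq_span X fun i => hgp (some i)] at this

theorem eventually_mem_idealAt {h : (Fin X.n → ℂ) → ℂ} (hh : AnalyticAt ℂ h 0)
    (hmem : holomorphicGerms.mk h hh ∈ X.idealAt 0) :
    ∀ᶠ p in 𝓝[≠] (0 : Fin X.n → ℂ), ∀ (_ : ∀ i, AnalyticAt ℂ (X.eqn i) p)
      (hhp : AnalyticAt ℂ h p), holomorphicGerms.mk h hhp ∈ X.idealAt p := by
  rw [idealAt_eq_span X X.analyticAt] at hmem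
  filter_upwards [(eventually_mk_mem_span X.analyticAt hh hmem).filter_mono nhdsWithin_le_nhds]
    with p hp hX hhp
  rw [idealAt_eq_span X hX]
  exact hp hX hhp

/-- Serre's criterion: both halves of normality are membership statements that hold at the nearby
smooth points, whose stalks are normal domains, and depth two carries them to the base point through
`mk_mem_sup_of_eventually`. -/
theorem isNormal_of_depth (hsing : X.HasIsolatedSingularity) (hdim : ringKrullDim X.localRing = 2)
    (hdepth : ∃ c ∈ maximalIdeal (holomorphicGerms X.n 0), (X.idealAt 0).RegularMod c ∧
      ∃ d ∈ maximalIdeal (holomorphicGerms X.n 0), (X.idealAt 0 ⊔ Ideal.span {c}).RegularMod d) :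
    X.IsNormal := by
  have hreg : ∀ {p}, IsRegularLocalRing (X.stalk p) →
      IsDomain (X.stalk p) ∧ IsIntegrallyClosed (X.stalk p) := fun {p} _ =>
    IsRegularLocalRing.isDomain_and_isIntegrallyClosed _ _ rfl
  constructor
  · have hdepth' := hdepth
    obtain ⟨c, hcm, hc, -⟩ := hdepth'
    -- Off the base point the radical adds nothing, so `y` lies in the ideal plus `(c)`; as `c` is
    -- regular, the cofactor is again in the radical. Thus the radical is contained in the ideal
    -- plus `c` times the radical, and Nakayama applies.
    have hrad : (X.idealAt 0).radical ≤ X.idealAt 0 := by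
      refine Submodule.le_of_le_smul_of_le_jacobson_bot (I := Ideal.span {c})
        (IsNoetherian.noetherian _)
        ((Ideal.span_singleton_le_iff_mem _).2 (maximalIdeal_le_jacobson _ hcm)) fun y hy => ?_
      obtain ⟨k, hk⟩ := hy
      obtain ⟨a, ha, rfl⟩ := exists_mk_eq y
      obtain ⟨γ, hγ, rfl⟩ := exists_mk_eq c
      rw [mk_pow_mk] at hk
      have hmem : holomorphicGerms.mk a ha ∈ X.idealAt 0 ⊔ Ideal.span {holomorphicGerms.mk γ hγ} := by
        refine X.mk_mem_sup_of_eventually hdim hdepth ha hγ hcm hc ?_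
        filter_upwards [hsing, X.eventually_mem_idealAt _ hk] with p hp hkp hX hap hγp h0
        have hdom := (hreg (hp h0)).1
        have hprime := (Ideal.Quotient.isDomain_iff_prime _).1 hdom
        refine Ideal.mem_sup_left (hprime.mem_of_pow_mem k ?_)
        rw [mk_pow_mk]
        exact hkp hX _
      obtain ⟨v, hv⟩ := Ideal.mem_sup_span_singleton_iff.1 hmem
      have hvr : v ∈ (X.idealAt 0).radical := by
        refine ⟨k, ?_⟩
        have h1 : (holomorphicGerms.mk γ hγ * v) ^ k ∈ X.idealAt 0 := by
          have h2 := Ideal.mem_of_dvd _ (sub_dvd_pow_sub_pow (holomorphicGerms.mk a ha) (holomorphicGerms.mk γ hγ * v) k) hv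
          have h3 := sub_mem hk h2
          rwa [← mk_pow_mk ha, sub_sub_cancel] at h3
        rw [mul_pow] at h1
        have h4 : ∀ j y, holomorphicGerms.mk γ hγ ^ j * y ∈ X.idealAt 0 → y ∈ X.idealAt 0 := fun j => by
          induction j with
          | zero => simp
          | succ j ih =>
            intro y hy
            rw [pow_succ', mul_assoc] at hy
            exact ih y (hc _ hy)
        exact h4 k _ h1
      have h5 := Submodule.add_mem_sup hv
        (Submodule.smul_mem_smul (Ideal.mem_span_singleton_self (holomorphicGerms.mk γ hγ)) hvr)
      rwa [smul_eq_mul (holomorphicGerms.mk γ hγ) v, sub_add_cancel] at h5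
    have : (X.idealAt 0).IsRadical := hrad
    exact (Ideal.isRadical_iff_quotient_reduced _).1 this
  · rw [isIntegrallyClosed_iff_dvd]
    intro a b hb hab
    obtain ⟨k, c, hrel⟩ := hab
    obtain ⟨a, rfl⟩ := Ideal.Quotient.mk_surjective a
    obtain ⟨b, rfl⟩ := Ideal.Quotient.mk_surjective b
    choose c hc using fun i => Ideal.Quotient.mk_surjective (c i)
    obtain rfl := funext hc
    obtain ⟨a, ha, rfl⟩ := exists_mk_eq a
    obtain ⟨b, hb', rfl⟩ := exists_mk_eq b
    choose γ hγ hγc using fun i => exists_mk_eq (c i)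
    obtain rfl := funext hγc
    by_cases hbm : holomorphicGerms.mk b hb' ∈ maximalIdeal (holomorphicGerms X.n 0)
    swap
    · have hu : IsUnit (holomorphicGerms.mk b hb') := by
        by_contra h
        exact hbm ((mem_maximalIdeal _).2 h)
      exact (hu.map _).dvd
    have hreg' : (X.idealAt 0).RegularMod (holomorphicGerms.mk b hb') := fun z hz => by
      rw [← Ideal.Quotient.eq_zero_iff_mem] at hz ⊢
      rw [map_mul, mul_comm] at hz
      exact (mem_nonZeroDivisors_iff_right.1 hb) _ hz
    have han : ∀ {p : Fin X.n → ℂ}, AnalyticAt ℂ a p → AnalyticAt ℂ b p →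
        (∀ i, AnalyticAt ℂ (γ i) p) → AnalyticAt ℂ (fun x => a x ^ k +
          ∑ i : Fin k, γ i x * a x ^ (i : ℕ) * b x ^ (k - i)) p := fun h1 h2 h3 =>
      (h1.fun_pow k).fun_add (Finset.univ.analyticAt_fun_sum fun i _ =>
        ((h3 i).fun_mul (h1.fun_pow i)).fun_mul (h2.fun_pow (k - i)))
    have hmk : ∀ {p : Fin X.n → ℂ} (h1 : AnalyticAt ℂ a p) (h2 : AnalyticAt ℂ b p)
        (h3 : ∀ i, AnalyticAt ℂ (γ i) p), holomorphicGerms.mk a h1 ^ k +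
          ∑ i : Fin k, holomorphicGerms.mk (γ i) (h3 i) * holomorphicGerms.mk a h1 ^ (i : ℕ) * holomorphicGerms.mk b h2 ^ (k - i) =
          holomorphicGerms.mk _ (han h1 h2 h3) := fun h1 h2 h3 => by
      have := sum_mk Finset.univ fun i : Fin k =>
        ((h3 i).fun_mul (h1.fun_pow i)).fun_mul (h2.fun_pow (k - i))
      exact congrArg (holomorphicGerms.mk a h1 ^ k + ·) this
    have hmem : holomorphicGerms.mk _ (han ha hb' hγ) ∈ X.idealAt 0 := by
      rw [← hmk ha hb' hγ, ← Ideal.Quotient.eq_zero_iff_mem, ← hrel]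
      simp only [map_add, map_sum, map_mul, map_pow]
    -- The integral equation persists at nearby points, where integral closedness of the stalk gives
    -- divisibility of `a` by `b`.
    have key : holomorphicGerms.mk a ha ∈ X.idealAt 0 ⊔ Ideal.span {holomorphicGerms.mk b hb'} := by
      refine X.mk_mem_sup_of_eventually hdim hdepth ha hb' hbm hreg' ?_
      filter_upwards [hsing, X.eventually_mem_idealAt _ hmem,
        (eventually_all.2 fun i => (hγ i).eventually_analyticAt).filter_mono nhdsWithin_le_nhds]
        with p hp hmp hγp hX hap hbp h0
      obtain ⟨hdom, hic⟩ := hreg (hp h0)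
      have hrelp : IntegralRel (Ideal.Quotient.mk (X.idealAt p) (holomorphicGerms.mk a hap))
          (Ideal.Quotient.mk (X.idealAt p) (holomorphicGerms.mk b hbp)) := by
        refine ⟨k, fun i => Ideal.Quotient.mk _ (holomorphicGerms.mk (γ i) (hγp i)), ?_⟩
        have h1 := hmp hX (han hap hbp hγp)
        rw [← hmk hap hbp hγp, ← Ideal.Quotient.eq_zero_iff_mem] at h1
        simpa only [map_add, map_sum, map_mul, map_pow] using h1
      have hdvd : Ideal.Quotient.mk (X.idealAt p) (holomorphicGerms.mk b hbp) ∣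
          Ideal.Quotient.mk (X.idealAt p) (holomorphicGerms.mk a hap) := by
        -- If `b` vanishes in the stalk, the integral equation puts `a` in the zero ideal too, which
        -- is prime there.
        by_cases hb0 : Ideal.Quotient.mk (X.idealAt p) (holomorphicGerms.mk b hbp) = 0
        · have := hdom.toNontrivial
          have hbot : (⊥ : Ideal (X.stalk p)).IsPrime := Ideal.isPrime_bot
          have := hrelp.mem_of_mem (Q := ⊥) ((Submodule.mem_bot _).2 hb0)
          rw [(Submodule.mem_bot _).1 this]
          exact dvd_zero _
        · exact isIntegrallyClosed_iff_dvd.1 hic _ _ (mem_nonZeroDivisors_of_ne_zero hb0) hrelp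
      obtain ⟨v, hv⟩ := hdvd
      obtain ⟨v, rfl⟩ := Ideal.Quotient.mk_surjective v
      rw [← map_mul, Ideal.Quotient.eq] at hv
      exact Ideal.mem_sup_span_singleton_iff.2 ⟨v, hv⟩
    obtain ⟨v, hv⟩ := Ideal.mem_sup_span_singleton_iff.1 key
    exact ⟨Ideal.Quotient.mk _ v, by rw [← map_mul, Ideal.Quotient.eq]; exact hv⟩

theorem mem_maximalIdeal_of_mk_mem (X : ComplexSpaceGerm) {x : holomorphicGerms X.n 0}
    (hx : Ideal.Quotient.mk (X.idealAt 0) x ∈ maximalIdeal X.localRing) :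
    x ∈ maximalIdeal (holomorphicGerms X.n 0) :=
  (mem_maximalIdeal _).2 fun h => (mem_maximalIdeal _).1 hx (h.map _)

theorem mk_mem_maximalIdeal (X : ComplexSpaceGerm) {x : holomorphicGerms X.n 0}
    (hx : x ∈ maximalIdeal (holomorphicGerms X.n 0)) :
    Ideal.Quotient.mk (X.idealAt 0) x ∈ maximalIdeal X.localRing := by
  have := Ideal.map_mono (f := Ideal.Quotient.mk (X.idealAt 0)) (le_refl _)
    (Ideal.mem_map_of_mem (Ideal.Quotient.mk (X.idealAt 0)) hx)
  refine le_maximalIdeal (fun h => ?_) this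
  have h1 := Ideal.comap_map_of_surjective' (Ideal.Quotient.mk (X.idealAt 0))
    Ideal.Quotient.mk_surjective (maximalIdeal (holomorphicGerms X.n 0))
  rw [h, Ideal.comap_top, Ideal.mk_ker, sup_eq_left.2 (le_maximalIdeal X.idealAt_ne_top)] at h1
  exact (maximalIdeal.isMaximal _).ne_top h1.symm

/-- A germ of dimension three is Cohen–Macaulay iff its ideal admits a regular sequence of
length three. -/
theorem isCohenMacaulay_iff (X : ComplexSpaceGerm) (hdim : ringKrullDim X.localRing = 3) :
    X.IsCohenMacaulay ↔ ∃ x ∈ maximalIdeal (holomorphicGerms X.n 0), (X.idealAt 0).RegularMod x ∧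
      ∃ y ∈ maximalIdeal (holomorphicGerms X.n 0), (X.idealAt 0 ⊔ Ideal.span {x}).RegularMod y ∧
      ∃ z ∈ maximalIdeal (holomorphicGerms X.n 0),
        (X.idealAt 0 ⊔ Ideal.span {x} ⊔ Ideal.span {y}).RegularMod z := by
  constructor
  · rintro ⟨rs, hm, hrs, hl⟩
    rw [hdim] at hl
    obtain ⟨r₁, r₂, r₃, rfl⟩ := List.length_eq_three.1 (by exact_mod_cast hl : rs.length = 3)
    obtain ⟨x, rfl⟩ := Ideal.Quotient.mk_surjective r₁
    obtain ⟨y, rfl⟩ := Ideal.Quotient.mk_surjective r₂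
    obtain ⟨z, rfl⟩ := Ideal.Quotient.mk_surjective r₃
    obtain ⟨hx, hy, hz⟩ := isWeaklyRegular_mk_iff.1 hrs.toIsWeaklyRegular
    exact ⟨x, X.mem_maximalIdeal_of_mk_mem (hm _ (by simp)), hx,
      y, X.mem_maximalIdeal_of_mk_mem (hm _ (by simp)), hy,
      z, X.mem_maximalIdeal_of_mk_mem (hm _ (by simp)), hz⟩
  · rintro ⟨x, hxm, hx, y, hym, hy, z, hzm, hz⟩
    have hm : ∀ r ∈ [Ideal.Quotient.mk (X.idealAt 0) x, Ideal.Quotient.mk (X.idealAt 0) y,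
        Ideal.Quotient.mk (X.idealAt 0) z], r ∈ maximalIdeal X.localRing := by
      simp only [List.mem_cons, List.not_mem_nil, or_false]
      rintro r (rfl | rfl | rfl)
      exacts [X.mk_mem_maximalIdeal hxm, X.mk_mem_maximalIdeal hym, X.mk_mem_maximalIdeal hzm]
    refine ⟨_, hm, ?_, hdim ▸ rfl⟩
    exact RingTheory.Sequence.IsRegular.of_isWeaklyRegular_of_mem_maximalIdeal _ hm
      (isWeaklyRegular_mk_iff.2 ⟨hx, hy, hz⟩)

/-- A normal surface germ has depth two. -/
theorem exists_regularMod_of_isNormal (X : ComplexSpaceGerm) (hX : X.IsNormal)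
    (hdim : ringKrullDim X.localRing = 2) :
    ∃ c ∈ maximalIdeal (holomorphicGerms X.n 0), (X.idealAt 0).RegularMod c ∧
      ∃ d ∈ maximalIdeal (holomorphicGerms X.n 0), (X.idealAt 0 ⊔ Ideal.span {c}).RegularMod d := by
  obtain ⟨h1, h2⟩ := hX
  have hdom : IsDomain X.localRing := isDomain_of_isReduced_of_isIntegrallyClosed
  obtain ⟨a, ham, ha⟩ : ∃ a ∈ maximalIdeal X.localRing, a ≠ 0 := by
    by_contra! h
    have hf : IsField X.localRing :=
      isField_iff_maximalIdeal_eq.2 ((Submodule.eq_bot_iff _).2 h)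
    rw [ringKrullDim_eq_zero_of_isField hf] at hdim
    exact absurd hdim (by norm_num)
  obtain ⟨s, hsm, hs⟩ := exists_regularMod_span_singleton hdim.ge ha
  obtain ⟨a, rfl⟩ := Ideal.Quotient.mk_surjective a
  obtain ⟨s, rfl⟩ := Ideal.Quotient.mk_surjective s
  refine ⟨a, X.mem_maximalIdeal_of_mk_mem ham, fun z hz => ?_, s, X.mem_maximalIdeal_of_mk_mem hsm,
    ?_⟩
  · rw [← Ideal.Quotient.eq_zero_iff_mem] at hz ⊢
    exact (mul_eq_zero.1 ((map_mul _ _ _).symm.trans hz)).resolve_left ha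
  · rw [← Ideal.RegularMod.map_mk_iff, Ideal.map_span, Set.image_singleton]
    exact hs

end ComplexSpaceGerm

theorem mainTheorem3 (Y : ComplexSpaceGerm)
    (hnormal : Y.IsNormal)
    (hdim : ringKrullDim Y.localRing = 3)
    (hsing : Y.HasIsolatedSingularity)
    (F : (Fin Y.n → ℂ) → ℂ) (hF : AnalyticAt ℂ F 0) (hF0 : F 0 = 0)
    (hf : Y.toLocalRing F hF ≠ 0)
    (hzero : (Y.zeroLocus F hF hF0).HasIsolatedSingularity) :
    (Y.zeroLocus F hF hF0).IsNormal ↔ Y.IsCohenMacaulay := by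
  obtain ⟨h1, h2⟩ := hnormal
  have hdom : IsDomain Y.localRing := isDomain_of_isReduced_of_isIntegrallyClosed
  have hFm : holomorphicGerms.mk F hF ∈ IsLocalRing.maximalIdeal (holomorphicGerms Y.n 0) :=
    holomorphicGerms.mem_maximalIdeal_iff.2 hF0
  have hFreg : (Y.idealAt 0).RegularMod (holomorphicGerms.mk F hF) := fun z hz => by
    rw [← Ideal.Quotient.eq_zero_iff_mem] at hz ⊢
    exact (mul_eq_zero.1 ((map_mul _ _ _).symm.trans hz)).resolve_left hf
  have hI := Y.idealAt_zeroLocus F hF hF0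
  have hdimZ : ringKrullDim (Y.zeroLocus F hF hF0).localRing = 2 := by
    have h := hFreg.ringKrullDim_quotient_succ hFm Y.idealAt_ne_top
    rw [← hI, show ringKrullDim (holomorphicGerms Y.n 0 ⧸ Y.idealAt 0) = 2 + 1 from
      hdim.trans (by norm_num), ENat.WithBot.add_one_cancel] at h
    exact h
  rw [Y.isCohenMacaulay_iff hdim]
  constructor
  · intro hZ
    obtain ⟨c, hcm, hc, d, hdm, hd⟩ :=
      (Y.zeroLocus F hF hF0).exists_regularMod_of_isNormal hZ hdimZ
    rw [hI] at hc hd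
    exact ⟨_, hFm, hFreg, c, hcm, hc, d, hdm, hd⟩
  · rintro ⟨x, hxm, hx, hyz⟩
    -- The given regular sequence need not involve `F`; exchanging its first element for `F` leaves
    -- a regular sequence of length two on the zero locus.
    obtain ⟨s, hsm, hs, t, htm, ht⟩ := Ideal.RegularMod.exchange_two hxm hx hFreg hyz
    rw [← hI] at hs ht
    exact (Y.zeroLocus F hF hF0).isNormal_of_depth hzero hdimZ ⟨s, hsm, hs, t, htm, ht⟩
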